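/- Fix an integer $d\ge 1$; $\log$ is the binary logarithm. Work on the real RAM. Its memory consists of finitely many variables and arrays, each holding either real numbers or words (natural numbers below a bound $W$). In unit time it reads or writes a cell, performs $+,-,\times$ or division on words or on reals, computes a remainder of words, $\log x$ or $2^x$ for a real $x$, turns a word into a real, or compares two words or two reals. There is no rounding of reals to words, and a program is a fixed finite text. For a query box $R$ and points $p_1,\dots,p_n$ with colors, let $P\cap R$ be the family of points lying in $R$; if it is non-empty, let $\mathcal D_R(u)$ be the fraction of its points that have color $u$, and put $$H(P\cap R)=-\sum_{u}\mathcal D_R(u)\log \mathcal D_R(u),\qquad H_\alpha(P\cap R)=-\frac1{\alpha-1}\log\sum_{u}\mathcal D_R(u)^\alpha ,$$ the sums being over the colors that occur in $P\cap R$; both are $0$ if $P\cap R=\emptyset$. **Theorem.** There are a construction program, a query program and constants $C,k$, all depending only on $d$, with the following property. Let $\alpha>1$ and $t\in[0,1]$ be real, let $P$ consist of $n$ points $p_1,\dots,p_n\in\mathbb R^d$ (repetitions allowed), each with a color, let $W\ge (n+2)^k$ and let the colors be numbers below $W$. Given $n,\alpha,t$, the points and the colors, the construction program halts and leaves a data structure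 in memory: a block consisting of the first $S$ cells of each of finitely many arrays. Given only the contents of this block and a closed box $R=\prod_{j=1}^d[a_j,b_j]$ (the rest of the memory being arbitrary), the query program halts, outputs $H(P\cap R)$ and $H_\alpha(P\cap R)$ exactly, and leaves the data structure unchanged. If $n\ge 2$, moreover, - the data structure has at most $C\left(n\log^{2d-1}n+n^{(2d-1)t+1}\right)$ cells; - the construction takes at most $C\left(n\log^{2d}n+n^{(2d-1)t+1}\log^{d+1}n\right)$ time; - every query takes at most $C\, n^{1-t}\log^{2d}n$ time. -/

import Mathlib

/-!
A real RAM: a uniform imperative language over machine words and real numbers, with unit-cost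
operations, and the two entropies of a finite coloured family.
-/

namespace RealRAM

/-- A machine state: word variables, real variables, and word and real arrays (`iarr a i` is cell
`i` of the word array `a`). A program text names only finitely many variables and arrays. -/
structure State where
  ivar : ℕ → ℕ
  rvar : ℕ → ℝ
  iarr : ℕ → ℕ → ℕ
  rarr : ℕ → ℕ → ℝ

/-- Word expressions. -/
inductive IExpr where
  | const (c : ℕ)
  | var (x : ℕ)
  | read (a : ℕ) (i : IExpr)
  | add (e f : IExpr)
  | sub (e f : IExpr)
  | mul (e f : IExpr)
  | div (e f : IExpr)
  | mod (e f : IExpr)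

/-- Real expressions. There is no rounding and no conversion of a real into a word: words can
depend on reals through comparisons only. -/
inductive RExpr where
  | ofInt (e : IExpr)
  | var (x : ℕ)
  | read (a : ℕ) (i : IExpr)
  | add (e f : RExpr)
  | sub (e f : RExpr)
  | mul (e f : RExpr)
  | div (e f : RExpr)
  | log2 (e : RExpr)
  | exp2 (e : RExpr)

/-- Tests. -/
inductive BExpr where
  | ilt (e f : IExpr)
  | rlt (e f : RExpr)
  | not (b : BExpr)
  | and (b b' : BExpr)

/-- Programs. -/
inductive Stmt where
  | skip
  | iset (x : ℕ) (e : IExpr)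
  | rset (x : ℕ) (e : RExpr)
  | iwrite (a : ℕ) (i : IExpr) (e : IExpr)
  | rwrite (a : ℕ) (i : IExpr) (e : RExpr)
  | seq (p q : Stmt)
  | cond (b : BExpr) (p q : Stmt)
  | loop (b : BExpr) (p : Stmt)

/-- Value of a word expression on a machine whose words are the numbers below `W`:
arithmetic is modulo `W`, subtraction is truncated at `0`. -/
def IExpr.eval (W : ℕ) (s : State) : IExpr → ℕ
  | const c => c % W
  | var x => s.ivar x
  | read a i => s.iarr a (i.eval W s)
  | add e f => (e.eval W s + f.eval W s) % W
  | sub e f => e.eval W s - f.eval W s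
  | mul e f => (e.eval W s * f.eval W s) % W
  | div e f => e.eval W s / f.eval W s
  | mod e f => e.eval W s % f.eval W s

/-- Number of unit-cost operations in a word expression. -/
def IExpr.cost : IExpr → ℕ
  | const _ => 1
  | var _ => 1
  | read _ i => i.cost + 1
  | add e f => e.cost + f.cost + 1
  | sub e f => e.cost + f.cost + 1
  | mul e f => e.cost + f.cost + 1
  | div e f => e.cost + f.cost + 1
  | mod e f => e.cost + f.cost + 1

/-- Value of a real expression: exact real arithmetic, the binary logarithm (returning `0` outside
its domain) and `x ↦ 2 ^ x`. -/
noncomputable def RExpr.eval (W : ℕ) (s : State) : RExpr → ℝ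
  | ofInt e => (e.eval W s : ℝ)
  | var x => s.rvar x
  | read a i => s.rarr a (i.eval W s)
  | add e f => e.eval W s + f.eval W s
  | sub e f => e.eval W s - f.eval W s
  | mul e f => e.eval W s * f.eval W s
  | div e f => e.eval W s / f.eval W s
  | log2 e => open Classical in if 0 < e.eval W s then Real.logb 2 (e.eval W s) else 0
  | exp2 e => (2 : ℝ) ^ e.eval W s

/-- Number of unit-cost operations in a real expression. -/
def RExpr.cost : RExpr → ℕ
  | ofInt e => e.cost + 1
  | var _ => 1
  | read _ i => i.cost + 1
  | add e f => e.cost + f.cost + 1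
  | sub e f => e.cost + f.cost + 1
  | mul e f => e.cost + f.cost + 1
  | div e f => e.cost + f.cost + 1
  | log2 e => e.cost + 1
  | exp2 e => e.cost + 1

/-- Truth of a test. -/
def BExpr.Holds (W : ℕ) (s : State) : BExpr → Prop
  | ilt e f => e.eval W s < f.eval W s
  | rlt e f => e.eval W s < f.eval W s
  | not b => ¬ b.Holds W s
  | and b b' => b.Holds W s ∧ b'.Holds W s

/-- Number of unit-cost operations in a test. -/
def BExpr.cost : BExpr → ℕ
  | ilt e f => e.cost + f.cost + 1
  | rlt e f => e.cost + f.cost + 1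
  | not b => b.cost + 1
  | and b b' => b.cost + b'.cost + 1

/-- `Exec W p s s' T`: with words below `W`, the program `p` started in the state `s` halts in the
state `s'` after `T` unit-cost steps. -/
inductive Exec (W : ℕ) : Stmt → State → State → ℕ → Prop where
  | skip (s : State) : Exec W .skip s s 1
  | iset (s : State) (x : ℕ) (e : IExpr) :
      Exec W (.iset x e) s { s with ivar := Function.update s.ivar x (e.eval W s) } (e.cost + 1)
  | rset (s : State) (x : ℕ) (e : RExpr) :
      Exec W (.rset x e) s { s with rvar := Function.update s.rvar x (e.eval W s) } (e.cost + 1)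
  | iwrite (s : State) (a : ℕ) (i e : IExpr) :
      Exec W (.iwrite a i e) s
        { s with iarr := Function.update s.iarr a
                  (Function.update (s.iarr a) (i.eval W s) (e.eval W s)) }
        (i.cost + e.cost + 1)
  | rwrite (s : State) (a : ℕ) (i : IExpr) (e : RExpr) :
      Exec W (.rwrite a i e) s
        { s with rarr := Function.update s.rarr a
                  (Function.update (s.rarr a) (i.eval W s) (e.eval W s)) }
        (i.cost + e.cost + 1)
  | seq {p q : Stmt} {s s₁ s₂ : State} {T₁ T₂ : ℕ} :
      Exec W p s s₁ T₁ → Exec W q s₁ s₂ T₂ → Exec W (.seq p q) s s₂ (T₁ + T₂)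
  | cond_true {b : BExpr} {p q : Stmt} {s s' : State} {T : ℕ} :
      b.Holds W s → Exec W p s s' T → Exec W (.cond b p q) s s' (b.cost + 1 + T)
  | cond_false {b : BExpr} {p q : Stmt} {s s' : State} {T : ℕ} :
      ¬ b.Holds W s → Exec W q s s' T → Exec W (.cond b p q) s s' (b.cost + 1 + T)
  | loop_true {b : BExpr} {p : Stmt} {s s₁ s₂ : State} {T₁ T₂ : ℕ} :
      b.Holds W s → Exec W p s s₁ T₁ → Exec W (.loop b p) s₁ s₂ T₂ →
      Exec W (.loop b p) s s₂ (b.cost + 1 + T₁ + T₂)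
  | loop_false {b : BExpr} {p : Stmt} {s : State} :
      ¬ b.Holds W s → Exec W (.loop b p) s s (b.cost + 1)

/-- Input convention of the construction: `n` is in word variable `0`, `α` and `t` are in the real
variables `0` and `1`, coordinate `j` of point `i` is in cell `i` of the real array `j`, and the
colour of point `i` is in cell `i` of the word array `0`. Everything else is arbitrary. -/
def BuildInput {d n : ℕ} (α t : ℝ) (p : Fin n → Fin d → ℝ) (c : Fin n → ℕ) (s : State) : Prop :=
  s.ivar 0 = n ∧ s.rvar 0 = α ∧ s.rvar 1 = t ∧
    (∀ (i : Fin n) (j : Fin d), s.rarr j i = p i j) ∧ ∀ i : Fin n, s.iarr 0 i = c i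

/-- Input convention of a query: the `j`-th side `[lo j, hi j]` of the query box is in the real
variables `2 * j` and `2 * j + 1`. -/
def QueryInput {d : ℕ} (lo hi : Fin d → ℝ) (s : State) : Prop :=
  ∀ j : Fin d, s.rvar (2 * j) = lo j ∧ s.rvar (2 * j + 1) = hi j

/-- The two states agree on the first `S` cells of the first `A` word arrays and the first `A` real
arrays, a block of `2 * A * S` cells. -/
def SameBlock (A S : ℕ) (s s' : State) : Prop :=
  ∀ a < A, ∀ i < S, s.iarr a i = s'.iarr a i ∧ s.rarr a i = s'.rarr a i

end RealRAM

/-- The points (by index) that lie in the closed box `∏ j, [lo j, hi j]`. -/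
noncomputable def pointsInBox {d n : ℕ} (p : Fin n → Fin d → ℝ) (lo hi : Fin d → ℝ) :
    Finset (Fin n) :=
  open Classical in Finset.univ.filter fun i => ∀ j, lo j ≤ p i j ∧ p i j ≤ hi j

/-- The fraction of the points of `Q` that have colour `u`. -/
noncomputable def colorFreq {n : ℕ} (c : Fin n → ℕ) (Q : Finset (Fin n)) (u : ℕ) : ℝ :=
  ((Q.filter fun i => c i = u).card : ℝ) / (Q.card : ℝ)

/-- Shannon entropy, in bits, of the colour distribution of `Q` (`0` if `Q` is empty). -/
noncomputable def shannonEntropy {n : ℕ} (c : Fin n → ℕ) (Q : Finset (Fin n)) : ℝ :=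
  -∑ u ∈ Q.image c, colorFreq c Q u * Real.logb 2 (colorFreq c Q u)

/-- Rényi entropy of order `α`, in bits, of the colour distribution of `Q` (`0` if `Q` is
empty). -/
noncomputable def renyiEntropy {n : ℕ} (α : ℝ) (c : Fin n → ℕ) (Q : Finset (Fin n)) : ℝ :=
  -(1 / (α - 1)) * Real.logb 2 (∑ u ∈ Q.image c, colorFreq c Q u ^ α)

/-!
Sort the points in each coordinate and cut each order into about `n ^ t` buckets of about
`n ^ (1 - t)` points. A box of buckets is a choice of two bucket numbers per coordinate, strictly
between which the points must lie; its `2 * d` numbers are the digits of a key in the base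
`keyBase`. Both entropies of a family with colour multiplicities `m_u` are functions of the three
sums `∑ m_u`, `∑ m_u log m_u`, `∑ m_u ^ α` (`shannonEntropy_eq`, `renyiEntropy_eq`), and each sum
is updated in constant time when one point is inserted, provided that the multiplicity of its
colour is known (`colorSum_insert`, `insertProg_runs`).

The construction stores the three sums for all boxes of buckets. There are about `n ^ (2 * d * t)`
of them, but fixing all sides except the upper one in the last coordinate leaves
`n ^ ((2 * d - 1) * t)` sweeps over the `n` points (`sweepBody_runs`). At the end of a sweep the
multiplicities of all colours in a box without upper bound in the last coordinate are known, and
they are stored too, one cell per point (`keyBody_runs`). This table has `n ^ ((2 * d - 1) * t + 1)`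
cells and makes the multiplicities in any box of buckets available as a difference of two entries
(`mult_bucketBox`).

A query finds by binary search the buckets that contain its `2 * d` sides (`locate_runs`,
`located_of_below`). The points in its box are those in the box of buckets strictly between, whose
sums are in the table, and some of the points in the `2 * d` boundary buckets, which are inserted
one at a time (`scan_visit_runs`). A first scan over the boundary buckets clears the marks that
prevent double insertion and fetches the multiplicities of the colours met (`scan_reset_runs`); so
working storage, whose contents are arbitrary, is never read before it is written.

Sorting is done by repeated extraction from a tournament tree (`sortProg_runs`), in time
`O(n log n)`.

Programs are verified in a small total-correctness logic: `Runs W p s c Q` bounds the running time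
by `c`, `Stmt.wp` handles loop-free code, and `Frame` says that a program changes only what its
text assigns, so that loop invariants need to mention only what the loop changes. Constants in
running times are costs of program texts, which depend on `d` only; they are kept existential.

Word variables: `0` number of points, `1` bucket size, `2` key base, `3` key, `4` loop counter, `5`
current point, `6` its colour count, `7` position or tree node, `8` key of a box, `10` to `12`
binary search, `13` and `14` keys of open boxes, `20 + q` bucket of side `q` of the query. Real
variables: `2 * d + k` running sums, `2 * d + 3` the order `α`. Word arrays: `0` colours, `1`
parameters, `2` colour counts of open boxes, `3 + 2 * j` and `4 + 2 * j` sorted order and bucket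
numbers in coordinate `j`, and as working storage `2 * d + 4` colour counts, `2 * d + 5` the
tournament tree, `2 * d + 6` marks. Real arrays: `j` coordinates, `d + k` sums of the boxes, `d + 3`
the order `α`.
-/

namespace RealRAM

/-! ### A cost-aware program logic for the real RAM -/

/-- The word variables that the text of a program assigns. -/
def Stmt.WI : Stmt → ℕ → Prop
  | .iset x _, y => y = x
  | .seq p q, y => p.WI y ∨ q.WI y
  | .cond _ p q, y => p.WI y ∨ q.WI y
  | .loop _ p, y => p.WI y
  | _, _ => False

/-- The real variables that the text of a program assigns. -/
def Stmt.WR : Stmt → ℕ → Prop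
  | .rset x _, y => y = x
  | .seq p q, y => p.WR y ∨ q.WR y
  | .cond _ p q, y => p.WR y ∨ q.WR y
  | .loop _ p, y => p.WR y
  | _, _ => False

/-- The word arrays that the text of a program writes to. -/
def Stmt.WA : Stmt → ℕ → Prop
  | .iwrite a _ _, y => y = a
  | .seq p q, y => p.WA y ∨ q.WA y
  | .cond _ p q, y => p.WA y ∨ q.WA y
  | .loop _ p, y => p.WA y
  | _, _ => False

/-- The real arrays that the text of a program writes to. -/
def Stmt.WB : Stmt → ℕ → Prop
  | .rwrite a _ _, y => y = a
  | .seq p q, y => p.WB y ∨ q.WB y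
  | .cond _ p q, y => p.WB y ∨ q.WB y
  | .loop _ p, y => p.WB y
  | _, _ => False

/-- `s'` differs from `s` at most in the variables and arrays that `p` names as targets. -/
structure Frame (p : Stmt) (s s' : State) : Prop where
  ivar : ∀ x, ¬ p.WI x → s'.ivar x = s.ivar x
  rvar : ∀ x, ¬ p.WR x → s'.rvar x = s.rvar x
  iarr : ∀ a, ¬ p.WA a → s'.iarr a = s.iarr a
  rarr : ∀ a, ¬ p.WB a → s'.rarr a = s.rarr a

theorem Frame.refl (p : Stmt) (s : State) : Frame p s s :=
  ⟨fun _ _ => rfl, fun _ _ => rfl, fun _ _ => rfl, fun _ _ => rfl⟩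

theorem Frame.trans {p : Stmt} {s s₁ s₂ : State} (h : Frame p s s₁) (h' : Frame p s₁ s₂) :
    Frame p s s₂ :=
  ⟨fun x hx => (h'.ivar x hx).trans (h.ivar x hx), fun x hx => (h'.rvar x hx).trans (h.rvar x hx),
    fun x hx => (h'.iarr x hx).trans (h.iarr x hx), fun x hx => (h'.rarr x hx).trans (h.rarr x hx)⟩

theorem Frame.mono {p q : Stmt} {s s' : State} (h : Frame p s s')
    (hI : ∀ x, p.WI x → q.WI x) (hR : ∀ x, p.WR x → q.WR x)
    (hA : ∀ x, p.WA x → q.WA x) (hB : ∀ x, p.WB x → q.WB x) : Frame q s s' :=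
  ⟨fun x hx => h.ivar x fun h' => hx (hI x h'), fun x hx => h.rvar x fun h' => hx (hR x h'),
    fun x hx => h.iarr x fun h' => hx (hA x h'), fun x hx => h.rarr x fun h' => hx (hB x h')⟩

theorem Frame.seq_left {p q : Stmt} {s s' : State} (h : Frame p s s') : Frame (.seq p q) s s' :=
  h.mono (fun _ => .inl) (fun _ => .inl) (fun _ => .inl) (fun _ => .inl)

theorem Frame.seq_right {p q : Stmt} {s s' : State} (h : Frame q s s') : Frame (.seq p q) s s' :=
  h.mono (fun _ => .inr) (fun _ => .inr) (fun _ => .inr) (fun _ => .inr)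

theorem Frame.loop {b : BExpr} {p : Stmt} {s s' : State} (h : Frame p s s') :
    Frame (.loop b p) s s' :=
  h.mono (fun _ => id) (fun _ => id) (fun _ => id) (fun _ => id)

theorem Exec.frame {W : ℕ} {p : Stmt} {s s' : State} {T : ℕ} (h : Exec W p s s' T) :
    Frame p s s' := by
  induction h with
  | skip s => exact .refl _ _
  | iset s x e =>
    exact ⟨fun y hy => Function.update_of_ne hy _ _, fun _ _ => rfl, fun _ _ => rfl,
      fun _ _ => rfl⟩
  | rset s x e =>
    exact ⟨fun _ _ => rfl, fun y hy => Function.update_of_ne hy _ _, fun _ _ => rfl,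
      fun _ _ => rfl⟩
  | iwrite s a i e =>
    exact ⟨fun _ _ => rfl, fun _ _ => rfl, fun y hy => Function.update_of_ne hy _ _,
      fun _ _ => rfl⟩
  | rwrite s a i e =>
    exact ⟨fun _ _ => rfl, fun _ _ => rfl, fun _ _ => rfl,
      fun y hy => Function.update_of_ne hy _ _⟩
  | seq _ _ ih ih' => exact ih.seq_left.trans ih'.seq_right
  | cond_true _ _ ih =>
    exact ih.mono (fun _ => .inl) (fun _ => .inl) (fun _ => .inl) (fun _ => .inl)
  | cond_false _ _ ih =>
    exact ih.mono (fun _ => .inr) (fun _ => .inr) (fun _ => .inr) (fun _ => .inr)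
  | loop_true _ _ _ ih ih' => exact ih.loop.trans ih'
  | loop_false _ => exact .refl _ _

/-- `p`, started in `s`, halts within `c` steps in a state that satisfies `Q`. -/
def Runs (W : ℕ) (p : Stmt) (s : State) (c : ℕ) (Q : State → Prop) : Prop :=
  ∃ s' T, Exec W p s s' T ∧ T ≤ c ∧ Q s'

/-- The rule of consequence, with the frame of the run at hand. -/
theorem Runs.mono {W : ℕ} {p : Stmt} {s : State} {c c' : ℕ} {Q Q' : State → Prop}
    (h : Runs W p s c Q) (hc : c ≤ c') (hQ : ∀ s', Frame p s s' → Q s' → Q' s') :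
    Runs W p s c' Q' :=
  let ⟨s', T, h1, h2, h3⟩ := h
  ⟨s', T, h1, h2.trans hc, hQ s' h1.frame h3⟩

theorem Runs.seq {W : ℕ} {p q : Stmt} {s : State} {c₁ c₂ : ℕ} {Q R : State → Prop}
    (h : Runs W p s c₁ Q) (h' : ∀ s', Frame p s s' → Q s' → Runs W q s' c₂ R) :
    Runs W (.seq p q) s (c₁ + c₂) R := by
  obtain ⟨s₁, T₁, h1, h2, h3⟩ := h
  obtain ⟨s₂, T₂, h4, h5, h6⟩ := h' s₁ h1.frame h3
  exact ⟨s₂, _, .seq h1 h4, Nat.add_le_add h2 h5, h6⟩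

/-- Weakest precondition of a loop-free program; a loop has precondition `False`. -/
def Stmt.wp (W : ℕ) : Stmt → (State → Prop) → State → Prop
  | .skip, Q, s => Q s
  | .iset x e, Q, s => Q { s with ivar := Function.update s.ivar x (e.eval W s) }
  | .rset x e, Q, s => Q { s with rvar := Function.update s.rvar x (e.eval W s) }
  | .iwrite a i e, Q, s =>
      Q { s with iarr := Function.update s.iarr a
                  (Function.update (s.iarr a) (i.eval W s) (e.eval W s)) }
  | .rwrite a i e, Q, s =>
      Q { s with rarr := Function.update s.rarr a
                  (Function.update (s.rarr a) (i.eval W s) (e.eval W s)) }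
  | .seq p q, Q, s => p.wp W (q.wp W Q) s
  | .cond b p q, Q, s => (b.Holds W s → p.wp W Q s) ∧ (¬ b.Holds W s → q.wp W Q s)
  | .loop _ _, _, _ => False

/-- An upper bound for the running time of a loop-free program. -/
def Stmt.flatCost : Stmt → ℕ
  | .skip => 1
  | .iset _ e => e.cost + 1
  | .rset _ e => e.cost + 1
  | .iwrite _ i e => i.cost + e.cost + 1
  | .rwrite _ i e => i.cost + e.cost + 1
  | .seq p q => p.flatCost + q.flatCost
  | .cond b p q => b.cost + 1 + (p.flatCost + q.flatCost)
  | .loop _ _ => 0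

theorem Runs.of_wp {W : ℕ} {p : Stmt} {s : State} {Q : State → Prop} (h : p.wp W Q s) :
    Runs W p s p.flatCost Q := by
  induction p generalizing s Q with
  | skip => exact ⟨_, _, .skip s, le_rfl, h⟩
  | iset x e => exact ⟨_, _, .iset s x e, le_rfl, h⟩
  | rset x e => exact ⟨_, _, .rset s x e, le_rfl, h⟩
  | iwrite a i e => exact ⟨_, _, .iwrite s a i e, le_rfl, h⟩
  | rwrite a i e => exact ⟨_, _, .rwrite s a i e, le_rfl, h⟩
  | seq p q ihp ihq =>
    obtain ⟨s₁, T₁, h1, h2, h3⟩ := ihp h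
    obtain ⟨s₂, T₂, h4, h5, h6⟩ := ihq h3
    exact ⟨s₂, _, .seq h1 h4, Nat.add_le_add h2 h5, h6⟩
  | cond b p q ihp ihq =>
    by_cases hb : b.Holds W s
    · obtain ⟨s₁, T₁, h1, h2, h3⟩ := ihp (h.1 hb)
      exact ⟨s₁, _, .cond_true hb h1, by simp only [Stmt.flatCost]; omega, h3⟩
    · obtain ⟨s₁, T₁, h1, h2, h3⟩ := ihq (h.2 hb)
      exact ⟨s₁, _, .cond_false hb h1, by simp only [Stmt.flatCost]; omega, h3⟩
  | loop b p ih => exact h.elim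

/-- Straight-line code in front of a program. -/
theorem Runs.wp_seq {W : ℕ} {p q : Stmt} {s : State} {c : ℕ} {R : State → Prop}
    (h : p.wp W (fun s' => Runs W q s' c R) s) : Runs W (.seq p q) s (p.flatCost + c) R :=
  (Runs.of_wp h).seq fun _ _ h' => h'

theorem Runs.cond {W : ℕ} {b : BExpr} {p q : Stmt} {s : State} {c : ℕ} {Q : State → Prop}
    (h : b.Holds W s → Runs W p s c Q) (h' : ¬ b.Holds W s → Runs W q s c Q) :
    Runs W (.cond b p q) s (b.cost + 1 + c) Q := by
  by_cases hb : b.Holds W s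
  · obtain ⟨s₁, T₁, h1, h2, h3⟩ := h hb
    exact ⟨s₁, _, .cond_true hb h1, by omega, h3⟩
  · obtain ⟨s₁, T₁, h1, h2, h3⟩ := h' hb
    exact ⟨s₁, _, .cond_false hb h1, by omega, h3⟩

/-- The program that runs `body` with the word variable `x` set to `0, 1, …, e - 1`. -/
def forUp (x : ℕ) (e : IExpr) (body : Stmt) : Stmt :=
  .seq (.iset x (.const 0))
    (.loop (.ilt (.var x) e) (.seq body (.iset x (.add (.var x) (.const 1)))))

theorem forUp_WI {x y : ℕ} {e : IExpr} {body : Stmt} :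
    (forUp x e body).WI y ↔ y = x ∨ body.WI y := by
  simp only [forUp, Stmt.WI]; tauto
theorem forUp_WR {x y : ℕ} {e : IExpr} {body : Stmt} :
    (forUp x e body).WR y ↔ body.WR y := by
  simp only [forUp, Stmt.WR, or_false, false_or]
theorem forUp_WA {x y : ℕ} {e : IExpr} {body : Stmt} :
    (forUp x e body).WA y ↔ body.WA y := by
  simp only [forUp, Stmt.WA, or_false, false_or]
theorem forUp_WB {x y : ℕ} {e : IExpr} {body : Stmt} :
    (forUp x e body).WB y ↔ body.WB y := by
  simp only [forUp, Stmt.WB, or_false, false_or]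

/-- Rule for counting loops. The invariant needs to mention only what the loop changes. -/
theorem Runs.forUp {W x : ℕ} {e : IExpr} {body : Stmt} {s : State} {c : ℕ} (N : ℕ)
    (Inv : ℕ → State → Prop) (hW : N < W) (hx : ¬ body.WI x)
    (he : ∀ s', Frame (forUp x e body) s s' → e.eval W s' = N)
    (h0 : Inv 0 { s with ivar := Function.update s.ivar x 0 })
    (hs : ∀ k < N, ∀ s', Frame (RealRAM.forUp x e body) s s' → s'.ivar x = k → Inv k s' →
      Runs W body s' c fun s'' =>
        Inv (k + 1) { s'' with ivar := Function.update s''.ivar x (k + 1) }) :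
    Runs W (RealRAM.forUp x e body) s ((N + 1) * (c + e.cost + 10)) (Inv N) := by
  have key : ∀ m k, k + m = N → ∀ s', Frame (RealRAM.forUp x e body) s s' → s'.ivar x = k →
      Inv k s' → Runs W (.loop (.ilt (.var x) e) (.seq body (.iset x (.add (.var x) (.const 1)))))
        s' (m * (c + e.cost + 7) + e.cost + 3) (Inv N) := by
    intro m
    induction m with
    | zero =>
      intro k hk s' hf hxk hi
      have hb : ¬ (BExpr.ilt (.var x) e).Holds W s' := by
        simp only [BExpr.Holds, IExpr.eval, he s' hf, hxk]; omega
      refine ⟨s', _, .loop_false hb, ?_, ?_⟩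
      · simp only [BExpr.cost, IExpr.cost]; omega
      · obtain rfl : k = N := by omega
        exact hi
    | succ m ih =>
      intro k hk s' hf hxk hi
      have hb : (BExpr.ilt (.var x) e).Holds W s' := by
        simp only [BExpr.Holds, IExpr.eval, he s' hf, hxk]; omega
      obtain ⟨s₁, T₁, h1, h2, h3⟩ := hs k (by omega) s' hf hxk hi
      have hx1 : s₁.ivar x = k := (h1.frame.ivar x hx).trans hxk
      have hev : (IExpr.add (.var x) (.const 1)).eval W s₁ = k + 1 := by
        simp only [IExpr.eval, hx1]
        rw [Nat.mod_eq_of_lt (a := 1) (by omega), Nat.mod_eq_of_lt (by omega)]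
      have h4 := Exec.iset (W := W) s₁ x (.add (.var x) (.const 1))
      rw [hev] at h4
      have h5 := Exec.seq h1 h4
      have hf5 : Frame (RealRAM.forUp x e body) s' _ := Frame.seq_right h5.frame.loop
      obtain ⟨s₂, T₂, h6, h7, h8⟩ := ih (k + 1) (by omega) _ (hf.trans hf5)
        (Function.update_self ..) h3
      refine ⟨s₂, _, .loop_true hb h5 h6, ?_, h8⟩
      simp only [BExpr.cost, IExpr.cost]
      rw [add_mul]; omega
  have h1 := Exec.iset (W := W) s x (.const 0)
  simp only [IExpr.eval, Nat.zero_mod] at h1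
  obtain ⟨s₂, T₂, h6, h7, h8⟩ := key N 0 (by omega) _ h1.frame.seq_left
    (Function.update_self ..) h0
  refine ⟨s₂, _, .seq h1 h6, ?_, h8⟩
  simp only [IExpr.cost]
  nlinarith

/-- Rule for loops that halve a measure: they run for at most `Nat.size` of it many rounds. -/
theorem Runs.loop_halving {W : ℕ} {b : BExpr} {p : Stmt} {s : State} {c : ℕ} (μ : State → ℕ)
    (Inv : State → Prop)
    (hs : ∀ s', Frame (.loop b p) s s' → Inv s' → b.Holds W s' →
      0 < μ s' ∧ Runs W p s' c fun s'' => μ s'' ≤ μ s' / 2 ∧ Inv s'')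
    (h0 : Inv s) :
    Runs W (.loop b p) s ((c + b.cost + 1) * ((μ s).size + 1))
      fun s' => ¬ b.Holds W s' ∧ Inv s' := by
  have key : ∀ m s', Frame (.loop b p) s s' → Inv s' → (μ s').size ≤ m →
      Runs W (.loop b p) s' ((c + b.cost + 1) * m + b.cost + 1)
        fun s' => ¬ b.Holds W s' ∧ Inv s' := by
    intro m
    induction m with
    | zero =>
      intro s' hf hi hm
      have hb : ¬ b.Holds W s' := by
        intro hb
        have := (hs s' hf hi hb).1
        have := Nat.size_pos.2 this
        omega
      exact ⟨s', _, .loop_false hb, by omega, hb, hi⟩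
    | succ m ih =>
      intro s' hf hi hm
      by_cases hb : b.Holds W s'
      · obtain ⟨hpos, s₁, T₁, h1, h2, h3, h4⟩ := hs s' hf hi hb
        have hm' : (μ s₁).size ≤ m := by
          rw [Nat.size_le] at hm ⊢
          rw [pow_succ] at hm
          omega
        obtain ⟨s₂, T₂, h6, h7, h8⟩ := ih s₁ (hf.trans h1.frame.loop) h4 hm'
        exact ⟨s₂, _, .loop_true hb h1 h6, by rw [mul_add]; omega, h8⟩
      · exact ⟨s', _, .loop_false hb, by rw [mul_add]; omega, hb, hi⟩
  refine (key _ s (.refl _ _) h0 le_rfl).mono ?_ fun _ _ h => h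
  rw [mul_add]; omega

/-- The sequence `f 0; f 1; …; f (m - 1)`, unrolled in the program text. -/
def seqN : ℕ → (ℕ → Stmt) → Stmt
  | 0, _ => .skip
  | m + 1, f => .seq (seqN m f) (f m)

theorem seqN_WI {m : ℕ} {f : ℕ → Stmt} {x : ℕ} : (seqN m f).WI x ↔ ∃ k < m, (f k).WI x := by
  induction m with
  | zero => simp [seqN, Stmt.WI]
  | succ m ih => rw [Nat.exists_lt_succ_right, ← ih]; rfl

theorem seqN_WR {m : ℕ} {f : ℕ → Stmt} {x : ℕ} : (seqN m f).WR x ↔ ∃ k < m, (f k).WR x := by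
  induction m with
  | zero => simp [seqN, Stmt.WR]
  | succ m ih => rw [Nat.exists_lt_succ_right, ← ih]; rfl

theorem seqN_WA {m : ℕ} {f : ℕ → Stmt} {x : ℕ} : (seqN m f).WA x ↔ ∃ k < m, (f k).WA x := by
  induction m with
  | zero => simp [seqN, Stmt.WA]
  | succ m ih => rw [Nat.exists_lt_succ_right, ← ih]; rfl

theorem seqN_WB {m : ℕ} {f : ℕ → Stmt} {x : ℕ} : (seqN m f).WB x ↔ ∃ k < m, (f k).WB x := by
  induction m with
  | zero => simp [seqN, Stmt.WB]
  | succ m ih => rw [Nat.exists_lt_succ_right, ← ih]; rfl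

theorem Runs.seqN {W m : ℕ} {f : ℕ → Stmt} {s : State} {c : ℕ} (Inv : ℕ → State → Prop)
    (h0 : Inv 0 s)
    (hs : ∀ k < m, ∀ s', Frame (seqN m f) s s' → Inv k s' → Runs W (f k) s' c (Inv (k + 1))) :
    Runs W (RealRAM.seqN m f) s (m * c + 1) (Inv m) := by
  induction m with
  | zero => exact ⟨s, 1, .skip s, by omega, h0⟩
  | succ m ih =>
    obtain ⟨s₁, T₁, h1, h2, h3⟩ := ih fun k hk s' hf => hs k (by omega) s' hf.seq_left
    obtain ⟨s₂, T₂, h4, h5, h6⟩ := hs m (by omega) s₁ h1.frame.seq_left h3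
    exact ⟨s₂, _, .seq h1 h4, by rw [add_mul]; omega, h6⟩

/-- Conjunction `f 0 ∧ … ∧ f (m - 1)` of tests. -/
def allB : ℕ → (ℕ → BExpr) → BExpr
  | 0, _ => .ilt (.const 0) (.const 1)
  | m + 1, f => .and (allB m f) (f m)

theorem allB_holds {W m : ℕ} {f : ℕ → BExpr} {s : State} (hW : 1 < W) :
    (allB m f).Holds W s ↔ ∀ k < m, (f k).Holds W s := by
  induction m with
  | zero => simp [allB, BExpr.Holds, IExpr.eval, Nat.mod_eq_of_lt hW]
  | succ m ih =>
    simp only [allB, BExpr.Holds, ih, Nat.lt_succ_iff_lt_or_eq]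
    constructor
    · rintro ⟨h, h'⟩ k (hk | rfl)
      exacts [h k hk, h']
    · exact fun h => ⟨fun k hk => h k (.inl hk), h m (.inr rfl)⟩

/-- The expression `e ^ m`, by repeated multiplication. -/
def powE (e : IExpr) : ℕ → IExpr
  | 0 => .const 1
  | m + 1 => .mul (powE e m) e

theorem powE_eval {W m : ℕ} {e : IExpr} {s : State} {v : ℕ} (he : e.eval W s = v)
    (hW : 1 < W) (hv : 1 ≤ v) (h : v ^ m < W) : (powE e m).eval W s = v ^ m := by
  induction m with
  | zero => simp [powE, IExpr.eval, Nat.mod_eq_of_lt hW]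
  | succ m ih =>
    have : v ^ m ≤ v ^ (m + 1) := Nat.pow_le_pow_right hv (by omega)
    simp only [powE, IExpr.eval, ih (by omega), he]
    rw [← pow_succ, Nat.mod_eq_of_lt h]

/-- The expression `f 0 + … + f (m - 1)`. -/
def sumE : ℕ → (ℕ → IExpr) → IExpr
  | 0, _ => .const 0
  | m + 1, f => .add (sumE m f) (f m)

theorem sumE_eval {W m : ℕ} {f : ℕ → IExpr} {s : State} {v : ℕ → ℕ}
    (hv : ∀ k < m, (f k).eval W s = v k) (h : ∑ k ∈ Finset.range m, v k < W) :
    (sumE m f).eval W s = ∑ k ∈ Finset.range m, v k := by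
  induction m with
  | zero => simp [sumE, IExpr.eval]
  | succ m ih =>
    rw [Finset.sum_range_succ] at h ⊢
    simp only [sumE, IExpr.eval, hv m (by omega)]
    rw [ih (fun k hk => hv k (by omega)) (by omega), Nat.mod_eq_of_lt h]

/-! ### Sorting by a tournament -/

/-- Node order of a tournament among the players `0, …, n - 1` with keys `x`: player `a` beats or
ties `b`. Every number `≥ n` stands for an absent player, who loses to everybody. -/
def Beats (n : ℕ) (x : ℕ → ℝ) (a b : ℕ) : Prop := n ≤ b ∨ (a < n ∧ x a ≤ x b)

theorem Beats.refl (n : ℕ) (x : ℕ → ℝ) (a : ℕ) : Beats n x a a := by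
  unfold Beats
  rcases le_or_gt n a with h | h
  exacts [.inl h, .inr ⟨h, le_rfl⟩]

theorem Beats.trans {n : ℕ} {x : ℕ → ℝ} {a b c : ℕ} (h : Beats n x a b) (h' : Beats n x b c) :
    Beats n x a c := by
  unfold Beats at *
  rcases h' with h' | ⟨hb, hx⟩
  · exact .inl h'
  · rcases h with h | ⟨ha, hx'⟩
    · omega
    · exact .inr ⟨ha, hx'.trans hx⟩

/-- Node `v` of the tournament tree `t` holds the winner of its two children `2 * v` and
`2 * v + 1`. The leaf of player `i` is node `n + i`. -/
def NodeOK (n : ℕ) (x : ℕ → ℝ) (t : ℕ → ℕ) (v : ℕ) : Prop :=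
  (t v = t (2 * v) ∨ t v = t (2 * v + 1)) ∧ Beats n x (t v) (t (2 * v)) ∧
    Beats n x (t v) (t (2 * v + 1))

/-- All inner nodes `1, …, n - 1` are correct. -/
def TreeOK (n : ℕ) (x : ℕ → ℝ) (t : ℕ → ℕ) : Prop := ∀ v, 1 ≤ v → v < n → NodeOK n x t v

theorem TreeOK.root_beats {n : ℕ} {x : ℕ → ℝ} {t : ℕ → ℕ} (h : TreeOK n x t) :
    ∀ v, 1 ≤ v → v < 2 * n → Beats n x (t 1) (t v) := by
  intro v
  induction v using Nat.strong_induction_on with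
  | _ v ih =>
    intro h1 h2
    rcases h1.eq_or_lt with rfl | h1
    · exact .refl _ _ _
    · have hp := ih (v / 2) (by omega) (by omega) (by omega)
      have hv := h (v / 2) (by omega) (by omega)
      rcases Nat.even_or_odd' v with ⟨k, rfl | rfl⟩
      · rw [Nat.mul_div_cancel_left _ (by omega)] at hp hv
        exact hp.trans hv.2.1
      · rw [show (2 * k + 1) / 2 = k by omega] at hp hv
        exact hp.trans hv.2.2

theorem TreeOK.exists_leaf {n : ℕ} {x : ℕ → ℝ} {t : ℕ → ℕ} (h : TreeOK n x t) :
    ∀ v, 1 ≤ v → v < 2 * n → ∃ i < n, t v = t (n + i) := by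
  -- descend from `v`; the distance `2 * n - v` shrinks
  have : ∀ m v, 2 * n - v ≤ m → 1 ≤ v → v < 2 * n → ∃ i < n, t v = t (n + i) := by
    intro m
    induction m with
    | zero => intro v _ _ _; omega
    | succ m ih =>
      intro v hm h1 h2
      rcases lt_or_ge v n with hv | hv
      · rcases (h v h1 hv).1 with h' | h' <;> rw [h'] <;> apply ih <;> omega
      · exact ⟨v - n, by omega, by congr 1; omega⟩
  exact fun v => this _ v le_rfl

/-- Replay the matches on the path from the node in word variable `7` to the root. -/
def replay (x tr : ℕ) : Stmt :=
  .loop (.ilt (.const 0) (.var 7))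
    (.seq
      (.cond
        (.and (.ilt (.read tr (.mul (.const 2) (.var 7))) (.var 0))
          (.not (.and (.ilt (.read tr (.add (.mul (.const 2) (.var 7)) (.const 1))) (.var 0))
            (.rlt (.read x (.read tr (.add (.mul (.const 2) (.var 7)) (.const 1))))
              (.read x (.read tr (.mul (.const 2) (.var 7))))))))
        (.iwrite tr (.var 7) (.read tr (.mul (.const 2) (.var 7))))
        (.iwrite tr (.var 7) (.read tr (.add (.mul (.const 2) (.var 7)) (.const 1)))))
      (.iset 7 (.div (.var 7) (.const 2))))

theorem replay_runs {W n tr x v : ℕ} {s : State} (hW : 2 * n + 2 < W) (hn : s.ivar 0 = n)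
    (hv : s.ivar 7 = v) (hvn : v < n)
    (hok : ∀ u, 1 ≤ u → u < n → u ≠ v → NodeOK n (s.rarr x) (s.iarr tr) u) :
    Runs W (replay x tr) s (60 * (n.size + 1)) fun s' =>
      TreeOK n (s.rarr x) (s'.iarr tr) ∧ ∀ u, n ≤ u → s'.iarr tr u = s.iarr tr u := by
  have h2 : 2 % W = 2 := Nat.mod_eq_of_lt (by omega)
  have h1 : 1 % W = 1 := Nat.mod_eq_of_lt (by omega)
  refine (Runs.loop_halving (c := 52) (fun s' => s'.ivar 7) (fun s' => s'.ivar 7 < n ∧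
    (∀ u, 1 ≤ u → u < n → u ≠ s'.ivar 7 → NodeOK n (s.rarr x) (s'.iarr tr) u) ∧
    ∀ u, n ≤ u → s'.iarr tr u = s.iarr tr u) ?_ ⟨by omega, by rwa [hv], fun _ _ => rfl⟩).mono
    ?_ ?_
  · rintro s' hf ⟨hlt, hok', hleaf⟩ hb
    simp only [BExpr.Holds, IExpr.eval, Nat.zero_mod] at hb
    have hn' : s'.ivar 0 = n := by rw [← hn]; exact hf.ivar 0 (by simp [Stmt.WI])
    have hx' : s'.rarr x = s.rarr x := hf.rarr x (by simp [Stmt.WB])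
    refine ⟨hb, (Runs.of_wp (?_ : Stmt.wp W _ _ s')).mono ?_ fun _ _ h => h⟩
    · have e2 : 2 * s'.ivar 7 % W = 2 * s'.ivar 7 := Nat.mod_eq_of_lt (by omega)
      have e3 : (2 * s'.ivar 7 + 1) % W = 2 * s'.ivar 7 + 1 := Nat.mod_eq_of_lt (by omega)
      -- writing the winner at the current node `w` repairs `w` and spoils at most its parent
      have upd : ∀ a w, s'.ivar 7 = w → (a = s'.iarr tr (2 * w) ∨ a = s'.iarr tr (2 * w + 1)) →
          Beats n (s.rarr x) a (s'.iarr tr (2 * w)) →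
          Beats n (s.rarr x) a (s'.iarr tr (2 * w + 1)) →
          w / 2 < n ∧ (∀ u, 1 ≤ u → u < n → u ≠ w / 2 →
            NodeOK n (s.rarr x) (Function.update (s'.iarr tr) w a) u) ∧
          ∀ u, n ≤ u → Function.update (s'.iarr tr) w a u = s.iarr tr u := by
        rintro a w rfl ha hb1 hb2
        refine ⟨by omega, fun u hu1 hu2 hu3 => ?_, fun u hu => ?_⟩
        · unfold NodeOK
          rw [Function.update_of_ne (a := 2 * u) (by omega),
            Function.update_of_ne (a := 2 * u + 1) (by omega)]
          by_cases huw : u = s'.ivar 7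
          · subst huw
            rw [Function.update_self]
            exact ⟨ha, hb1, hb2⟩
          · rw [Function.update_of_ne huw]
            exact hok' u hu1 hu2 huw
        · rw [Function.update_of_ne (by omega), hleaf u hu]
      simp only [Stmt.wp, BExpr.Holds, IExpr.eval, RExpr.eval, h1, h2, e2, e3, hn', hx',
        Function.update_self]
      constructor
      · rintro ⟨ha, hb'⟩
        refine ⟨le_rfl, upd _ _ rfl (.inl rfl) (.refl _ _ _) ?_⟩
        by_cases hc : s'.iarr tr (2 * s'.ivar 7 + 1) < n
        · exact .inr ⟨ha, not_lt.1 fun h => hb' ⟨hc, h⟩⟩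
        · exact .inl (not_lt.1 hc)
      · intro hh
        refine ⟨le_rfl, upd _ _ rfl (.inr rfl) ?_ (.refl _ _ _)⟩
        by_cases ha : s'.iarr tr (2 * s'.ivar 7) < n
        · have := not_not.1 fun h => hh ⟨ha, h⟩
          exact .inr ⟨this.1, this.2.le⟩
        · exact .inl (not_lt.1 ha)
    · simp [Stmt.flatCost, IExpr.cost, BExpr.cost, RExpr.cost]
  · have : v.size ≤ n.size := Nat.size_le_size hvn.le
    simp only [BExpr.cost, IExpr.cost, hv]
    nlinarith
  · rintro s' _ ⟨hb, -, h, h'⟩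
    simp only [BExpr.Holds, IExpr.eval, Nat.zero_mod] at hb
    exact ⟨fun u hu1 hu2 => h u hu1 hu2 (by omega), h'⟩

/-- Put the value of `e` into the leaf of player `i`, where `i` is the value of `idx`, and replay
the matches of that player. -/
def setLeaf (x tr : ℕ) (idx e : IExpr) : Stmt :=
  .seq (.seq (.iset 7 (.add (.var 0) idx)) (.seq (.iwrite tr (.var 7) e)
    (.iset 7 (.div (.var 7) (.const 2))))) (replay x tr)

theorem setLeaf_runs {W n tr x i a : ℕ} {idx e : IExpr} {s : State} (hW : 2 * n + 2 < W)
    (hn : s.ivar 0 = n) (hi : idx.eval W s = i) (hin : i < n)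
    (he : e.eval W { s with ivar := Function.update s.ivar 7 (n + i) } = a)
    (hok : TreeOK n (s.rarr x) (s.iarr tr)) :
    Runs W (setLeaf x tr idx e) s ((60 + (idx.cost + e.cost + 20)) * (n.size + 1)) fun s' =>
      TreeOK n (s.rarr x) (s'.iarr tr) ∧ s'.iarr tr (n + i) = a ∧
        ∀ u, n ≤ u → u ≠ n + i → s'.iarr tr u = s.iarr tr u := by
  have h2 : 2 % W = 2 := Nat.mod_eq_of_lt (by omega)
  have e1 : (n + i) % W = n + i := Nat.mod_eq_of_lt (by omega)
  refine (Runs.wp_seq (c := 60 * (n.size + 1)) ?_).mono ?_ fun _ _ h => h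
  · simp only [Stmt.wp, IExpr.eval, hn, hi, he, h2, e1, Function.update_self]
    refine (replay_runs hW (v := (n + i) / 2) ?_ ?_ (by omega) ?_).mono le_rfl ?_
    · simp [hn]
    · simp
    · intro u hu1 hu2 hu3
      have := hok u hu1 hu2
      unfold NodeOK at this ⊢
      simp only [Function.update_self]
      rwa [Function.update_of_ne (a := 2 * u) (by omega),
        Function.update_of_ne (a := 2 * u + 1) (by omega), Function.update_of_ne (by omega)]
    · rintro s' _ ⟨h, h'⟩
      refine ⟨h, ?_, fun u hu hu' => ?_⟩
      · rw [h' _ (by omega)]; simp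
      · rw [h' _ hu]; simp [hu']
  · simp only [Stmt.flatCost, IExpr.cost]
    nlinarith

/-- Sort the points `0, …, n - 1` by their keys in the real array `x`: fill a tournament tree,
then extract the winner `n` times. The order is written to the word array `o`. -/
def sortProg (x tr o : ℕ) : Stmt :=
  .seq (forUp 4 (.mul (.const 2) (.var 0)) (.iwrite tr (.var 4) (.var 0)))
    (.seq (forUp 4 (.var 0) (setLeaf x tr (.var 4) (.var 4)))
      (forUp 4 (.var 0) (.seq (.iwrite o (.var 4) (.read tr (.const 1)))
        (setLeaf x tr (.read tr (.const 1)) (.var 0)))))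

/-- `o` enumerates `0, …, n - 1` in the order of the keys `x`. -/
structure Sorted (n : ℕ) (x : ℕ → ℝ) (o : ℕ → ℕ) : Prop where
  lt : ∀ p < n, o p < n
  inj : ∀ p < n, ∀ p' < n, o p = o p' → p = p'
  mono : ∀ p p', p ≤ p' → p' < n → x (o p) ≤ x (o p')

theorem Sorted.surj {n : ℕ} {x : ℕ → ℝ} {o : ℕ → ℕ} (h : Sorted n x o) {i : ℕ} (hi : i < n) :
    ∃ p < n, o p = i := by
  have h1 : (Finset.range n).image o = Finset.range n := by
    apply Finset.eq_of_subset_of_card_le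
    · intro i hi
      obtain ⟨p, hp, rfl⟩ := Finset.mem_image.1 hi
      exact Finset.mem_range.2 (h.lt p (Finset.mem_range.1 hp))
    · rw [Finset.card_image_of_injOn fun p hp p' hp' =>
        h.inj p (by simpa using hp) p' (by simpa using hp')]
  have : i ∈ (Finset.range n).image o := by rw [h1]; simpa using hi
  simpa using this

/-- The state of the extraction after `k` rounds: the leaves of the players in `o 0, …, o (k - 1)`
are empty, and these players are sorted and have keys at most those of the others. -/
structure Extracted (n k : ℕ) (x : ℕ → ℝ) (t o : ℕ → ℕ) : Prop where
  tree : TreeOK n x t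
  lt : ∀ p < k, o p < n
  inj : ∀ p < k, ∀ p' < k, o p = o p' → p = p'
  out : ∀ p < k, t (n + o p) = n
  leaf : ∀ i < n, (∀ p < k, o p ≠ i) → t (n + i) = i
  mono : ∀ p p', p ≤ p' → p' < k → x (o p) ≤ x (o p')
  le_rest : ∀ p < k, ∀ i < n, (∀ p < k, o p ≠ i) → x (o p) ≤ x i

theorem Extracted.root {n k : ℕ} {x : ℕ → ℝ} {t o : ℕ → ℕ} (h : Extracted n k x t o)
    (hk : k < n) :
    t 1 < n ∧ (∀ p < k, o p ≠ t 1) ∧ ∀ i < n, (∀ p < k, o p ≠ i) → x (t 1) ≤ x i := by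
  have hr : ∀ i < n, (∀ p < k, o p ≠ i) → t 1 < n ∧ x (t 1) ≤ x i := by
    intro i hi hp
    have := h.tree.root_beats (n + i) (by omega) (by omega)
    rw [h.leaf i hi hp] at this
    exact this.resolve_left (by omega)
  -- fewer than `n` players are out, so somebody is left
  obtain ⟨i, hi, hp⟩ : ∃ i < n, ∀ p < k, o p ≠ i := by
    by_contra! hc
    have : Finset.range n ⊆ (Finset.range k).image o := fun i hi => by
      obtain ⟨p, hp, h⟩ := hc i (by simpa using hi)
      exact Finset.mem_image.2 ⟨p, by simpa using hp, h⟩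
    have := (Finset.card_le_card this).trans Finset.card_image_le
    simp at this
    omega
  have ht := (hr i hi hp).1
  refine ⟨ht, fun p hp h' => ?_, fun i hi hp => (hr i hi hp).2⟩
  obtain ⟨i', hi', h1⟩ := h.tree.exists_leaf 1 le_rfl (by omega)
  by_cases hc : ∀ p < k, o p ≠ i'
  · rw [h.leaf i' hi' hc] at h1
    exact hc p hp (h'.trans h1)
  · push Not at hc
    obtain ⟨p', hp', rfl⟩ := hc
    have := h.out p' hp'
    omega

theorem sortProg_runs {W n tr x o : ℕ} {s : State} (hW : 2 * n + 2 < W) (ho : tr ≠ o)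
    (hn : s.ivar 0 = n) :
    Runs W (sortProg x tr o) s (500 * ((n + 1) * (n.size + 1))) fun s' =>
      Sorted n (s.rarr x) (s'.iarr o) := by
  have h1 : 1 % W = 1 := Nat.mod_eq_of_lt (by omega)
  have h2 : 2 % W = 2 := Nat.mod_eq_of_lt (by omega)
  have e2 : 2 * n % W = 2 * n := Nat.mod_eq_of_lt (by omega)
  refine Runs.mono (c := (2 * n + 1) * 20 + ((n + 1) * (100 * (n.size + 1) + 11) +
    (n + 1) * ((100 * (n.size + 1) + 4) + 11))) (Runs.seq (Q := fun s' =>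
      ∀ v < 2 * n, s'.iarr tr v = n) ?_ fun s₁ hf₁ hQ₁ => Runs.seq (Q := fun s' =>
      TreeOK n (s.rarr x) (s'.iarr tr) ∧ ∀ i < n, s'.iarr tr (n + i) = i) ?_ ?_) ?_ ?_
    (Q := fun s' => Extracted n n (s.rarr x) (s'.iarr tr) (s'.iarr o))
  · refine Runs.mono (Runs.forUp (2 * n) (c := 3)
      (fun k s' => ∀ v < k, s'.iarr tr v = n) (by omega) (by simp [Stmt.WI]) ?_ ?_ ?_)
      (by simp [IExpr.cost]) fun _ _ h => h
    · intro s' hf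
      have : s'.ivar 0 = n := by rw [← hn]; exact hf.ivar 0 (by simp [forUp, Stmt.WI])
      simp [IExpr.eval, h2, this, e2]
    · intro v hv; omega
    · intro k hk s' hf hx hi
      have h0 : s'.ivar 0 = n := by rw [← hn]; exact hf.ivar 0 (by simp [forUp, Stmt.WI])
      refine Runs.of_wp (?_ : Stmt.wp W _ _ s')
      simp only [Stmt.wp, IExpr.eval, hx, h0, Function.update_self]
      intro v hv
      rcases Nat.lt_succ_iff_lt_or_eq.1 hv with hv | rfl
      · rw [Function.update_of_ne hv.ne, hi v hv]
      · simp
  · have hn₁ : s₁.ivar 0 = n := by rw [← hn]; exact hf₁.ivar 0 (by simp [forUp, Stmt.WI])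
    have hx₁ : s₁.rarr x = s.rarr x := hf₁.rarr x (by simp [forUp, Stmt.WB])
    refine Runs.mono (Runs.forUp n (c := 100 * (n.size + 1))
      (fun k s' => TreeOK n (s.rarr x) (s'.iarr tr) ∧
        (∀ i < k, s'.iarr tr (n + i) = i)) (by omega)
        (by simp [Stmt.WI, setLeaf, replay]) ?_ ?_ ?_)
      (by simp [IExpr.cost]) fun _ _ h => h
    · intro s' hf
      exact (hf.ivar 0 (by simp [forUp, Stmt.WI, setLeaf, replay])).trans hn₁
    · refine ⟨fun v hv hv' => ?_, fun i hi => by omega⟩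
      have : ∀ a ≤ 2 * v + 1, s₁.iarr tr a = n := fun a ha => hQ₁ a (by omega)
      simp only [NodeOK, this v (by omega), this (2 * v) (by omega), this (2 * v + 1) le_rfl]
      exact ⟨.inl trivial, .inl le_rfl, .inl le_rfl⟩
    · rintro k hk s' hf hx ⟨hi, hi'⟩
      have hn' : s'.ivar 0 = n :=
        (hf.ivar 0 (by simp [forUp, Stmt.WI, setLeaf, replay])).trans hn₁
      have hx' : s'.rarr x = s.rarr x :=
        (hf.rarr x (by simp [forUp, Stmt.WB, setLeaf, replay])).trans hx₁
      refine (setLeaf_runs hW hn' (i := k) (a := k) ?_ hk ?_ (by rwa [hx'])).mono ?_ ?_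
      · simp [IExpr.eval, hx]
      · simp [IExpr.eval, hx]
      · simp only [IExpr.cost]; omega
      · rintro s'' _ ⟨h3, h4, h5⟩
        rw [hx'] at h3
        refine ⟨h3, fun i hik => ?_⟩
        rcases Nat.lt_succ_iff_lt_or_eq.1 hik with hik | rfl
        · exact (h5 _ (by omega) (by omega)).trans (hi' i hik)
        · exact h4
  · rintro s₂ hf₂ ⟨ht, hl⟩
    have hn₁ : s₁.ivar 0 = n := by rw [← hn]; exact hf₁.ivar 0 (by simp [forUp, Stmt.WI])
    have hx₁ : s₁.rarr x = s.rarr x := hf₁.rarr x (by simp [forUp, Stmt.WB])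
    have hn₂ : s₂.ivar 0 = n :=
      (hf₂.ivar 0 (by simp [forUp, Stmt.WI, setLeaf, replay])).trans hn₁
    have hx₂ : s₂.rarr x = s.rarr x :=
      (hf₂.rarr x (by simp [forUp, Stmt.WB, setLeaf, replay])).trans hx₁
    refine Runs.mono (Runs.forUp n (c := 100 * (n.size + 1) + 4)
      (fun k s' => Extracted n k (s.rarr x) (s'.iarr tr) (s'.iarr o)) (by omega)
        (by simp [Stmt.WI, setLeaf, replay]) ?_ ?_ ?_)
      (by simp [IExpr.cost]) fun _ _ h => h
    · intro s' hf
      exact (hf.ivar 0 (by simp [forUp, Stmt.WI, setLeaf, replay])).trans hn₂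
    · constructor <;> first | exact ht | (intros; omega) | (intro i hi _; exact hl i hi)
    · rintro k hk s' hf hx hE
      have hn' : s'.ivar 0 = n :=
        (hf.ivar 0 (by simp [forUp, Stmt.WI, setLeaf, replay])).trans hn₂
      have hx' : s'.rarr x = s.rarr x :=
        (hf.rarr x (by simp [forUp, Stmt.WB, setLeaf, replay])).trans hx₂
      obtain ⟨hr1, hr2, hr3⟩ := hE.root hk
      refine (Runs.wp_seq (c := 100 * (n.size + 1)) ?_).mono
        (by simp [Stmt.flatCost, IExpr.cost]; omega) fun _ _ h => h
      simp only [Stmt.wp, IExpr.eval, h1, hx]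
      refine (setLeaf_runs hW (i := s'.iarr tr 1) (a := n) ?_ ?_ hr1 ?_ ?_).mono ?_ ?_
      · simpa using hn'
      · simp [IExpr.eval, h1, Function.update_of_ne ho]
      · simp [IExpr.eval, hn']
      · simpa [Function.update_of_ne ho, hx'] using hE.tree
      · simp only [IExpr.cost]; omega
      · rintro s'' hf'' ⟨h3, h4, h5⟩
        have ho'' := hf''.iarr o (by simp [Stmt.WA, setLeaf, replay, ho.symm])
        simp only [Function.update_self] at ho''
        simp only [Function.update_of_ne ho, hx'] at h3 h5
        have hok : s''.iarr o k = s'.iarr tr 1 := by rw [ho'']; simp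
        have hop : ∀ p < k, s''.iarr o p = s'.iarr o p := fun p hp => by
          rw [ho'', Function.update_of_ne hp.ne]
        have hall : ∀ i, (∀ p < k + 1, s''.iarr o p ≠ i) →
            (∀ p < k, s'.iarr o p ≠ i) ∧ s'.iarr tr 1 ≠ i := fun i h =>
          ⟨fun p hp => hop p hp ▸ h p (by omega), hok ▸ h k (by omega)⟩
        refine ⟨h3, fun p hp => ?_, fun p hp p' hp' h => ?_, fun p hp => ?_,
          fun i hi h => ?_, fun p p' hp hp' => ?_, fun p hp i hi h => ?_⟩
        · rcases Nat.lt_succ_iff_lt_or_eq.1 hp with hp | rfl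
          · rw [hop p hp]; exact hE.lt p hp
          · rw [hok]; exact hr1
        · rcases Nat.lt_succ_iff_lt_or_eq.1 hp with hp | rfl <;>
            rcases Nat.lt_succ_iff_lt_or_eq.1 hp' with hp' | rfl
          · rw [hop p hp, hop p' hp'] at h; exact hE.inj p hp p' hp' h
          · rw [hop p hp, hok] at h; exact (hr2 p hp h).elim
          · rw [hop p' hp', hok] at h; exact (hr2 p' hp' h.symm).elim
          · rfl
        · rcases Nat.lt_succ_iff_lt_or_eq.1 hp with hp | rfl
          · rw [hop p hp, h5 _ (by omega) (by have := hr2 p hp; omega)]; exact hE.out p hp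
          · rw [hok]; exact h4
        · obtain ⟨h6, h7⟩ := hall i h
          rw [h5 _ (by omega) (by omega)]
          exact hE.leaf i hi h6
        · rcases Nat.lt_succ_iff_lt_or_eq.1 hp' with hp' | rfl
          · rw [hop p (by omega), hop p' hp']; exact hE.mono p p' hp hp'
          · rcases hp.lt_or_eq with hp | rfl
            · rw [hop p hp, hok]; exact hE.le_rest p hp _ hr1 hr2
            · rfl
        · obtain ⟨h6, h7⟩ := hall i h
          rcases Nat.lt_succ_iff_lt_or_eq.1 hp with hp | rfl
          · rw [hop p hp]; exact hE.le_rest p hp i hi h6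
          · rw [hok]; exact hr3 i hi h6
  · nlinarith [Nat.zero_le n.size, Nat.zero_le (n * n.size)]
  · exact fun s' _ h => ⟨h.lt, h.inj, h.mono⟩

end RealRAM

/-! ### Colour statistics of a set of points -/

/-- Number of points of colour `u` in `Q`. -/
def mult (col : ℕ → ℕ) (Q : Finset ℕ) (u : ℕ) : ℕ := (Q.filter fun i => col i = u).card

/-- The sum of `f (number of points of colour u)` over the colours `u` of `Q`. -/
noncomputable def colorSum (f : ℕ → ℝ) (col : ℕ → ℕ) (Q : Finset ℕ) : ℝ :=
  ∑ u ∈ Q.image col, f (mult col Q u)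

theorem colorSum_eq_of_subset {f : ℕ → ℝ} {col : ℕ → ℕ} {Q : Finset ℕ} {U : Finset ℕ}
    (hf : f 0 = 0) (hU : Q.image col ⊆ U) : colorSum f col Q = ∑ u ∈ U, f (mult col Q u) := by
  refine Finset.sum_subset hU fun u _ hu => ?_
  have : mult col Q u = 0 := by
    rw [mult, Finset.card_eq_zero, Finset.filter_eq_empty_iff]
    rintro i hi rfl
    exact hu (Finset.mem_image_of_mem _ hi)
  rw [this, hf]

theorem mult_insert {col : ℕ → ℕ} {Q : Finset ℕ} {i u : ℕ} (hi : i ∉ Q) :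
    mult col (insert i Q) u = mult col Q u + if col i = u then 1 else 0 := by
  rw [mult, Finset.filter_insert]
  split_ifs with h
  · rw [Finset.card_insert_of_notMem (by simp [hi]), mult]
  · rfl

/-- Adding one point changes a single term of the sum. -/
theorem colorSum_insert {f : ℕ → ℝ} {col : ℕ → ℕ} {Q : Finset ℕ} {i : ℕ} (hf : f 0 = 0)
    (hi : i ∉ Q) : colorSum f col (insert i Q) =
      colorSum f col Q + (f (mult col Q (col i) + 1) - f (mult col Q (col i))) := by
  have hU : Q.image col ⊆ (insert i Q).image col :=
    Finset.image_subset_image (Finset.subset_insert _ _)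
  rw [colorSum_eq_of_subset hf hU, colorSum]
  have hmem : col i ∈ (insert i Q).image col :=
    Finset.mem_image_of_mem _ (Finset.mem_insert_self _ _)
  rw [← Finset.add_sum_erase _ _ hmem, ← Finset.add_sum_erase _ _ hmem, mult_insert hi, if_pos rfl]
  have : ∑ u ∈ ((insert i Q).image col).erase (col i), f (mult col (insert i Q) u) =
      ∑ u ∈ ((insert i Q).image col).erase (col i), f (mult col Q u) := by
    refine Finset.sum_congr rfl fun u hu => ?_
    rw [mult_insert hi, if_neg (Finset.ne_of_mem_erase hu).symm, add_zero]
  rw [this]; ring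

theorem mult_congr {col col' : ℕ → ℕ} {Q : Finset ℕ} (h : ∀ i ∈ Q, col i = col' i) (u : ℕ) :
    mult col Q u = mult col' Q u := by
  unfold mult
  congr 1
  exact Finset.filter_congr fun i hi => by rw [h i hi]

theorem colorSum_congr {f : ℕ → ℝ} {col col' : ℕ → ℕ} {Q : Finset ℕ}
    (h : ∀ i ∈ Q, col i = col' i) : colorSum f col Q = colorSum f col' Q := by
  unfold colorSum
  rw [Finset.image_congr (g := col') fun i hi => h i hi]
  exact Finset.sum_congr rfl fun u _ => by rw [mult_congr h]

/-- The three functions whose colour sums determine both entropies: `m` (the sum is the number of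
points), `m log m`, and `m ^ α`, the last in a form that is correct for `m = 0` as well. -/
noncomputable def statFun (α : ℝ) : ℕ → ℕ → ℝ
  | 0, m => m
  | 1, m => m * Real.logb 2 m
  | _, m => m * 2 ^ ((α - 1) * Real.logb 2 m)

theorem statFun_zero (α : ℝ) (k : ℕ) : statFun α k 0 = 0 := by
  rcases k with _ | _ | k <;> simp [statFun]

/-- The colour sum of `statFun α k`. -/
noncomputable def stat (α : ℝ) (col : ℕ → ℕ) (k : ℕ) (Q : Finset ℕ) : ℝ :=
  colorSum (statFun α k) col Q

theorem stat_empty (α : ℝ) (col : ℕ → ℕ) (k : ℕ) : stat α col k ∅ = 0 := by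
  simp [stat, colorSum]

/-! ### Boxes of buckets -/

/-- Digit `q` of `key` in base `b`. -/
def dig (b q key : ℕ) : ℕ := key / b ^ q % b

theorem dig_add_mul_of_lt {b q m key r : ℕ} (hb : 0 < b) (hq : q < m) :
    dig b q (key + b ^ m * r) = dig b q key := by
  obtain ⟨k, rfl⟩ := Nat.exists_eq_add_of_lt hq
  unfold dig
  rw [show b ^ (q + k + 1) * r = b ^ q * (b * (b ^ k * r)) by ring,
    Nat.add_mul_div_left _ _ (by positivity), Nat.add_mul_mod_self_left]

theorem dig_add_mul_self {b m key r : ℕ} (hb : 0 < b) (hk : key < b ^ m) (hr : r < b) :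
    dig b m (key + b ^ m * r) = r := by
  unfold dig
  rw [Nat.add_mul_div_left _ _ (by positivity), Nat.div_eq_of_lt hk, zero_add, Nat.mod_eq_of_lt hr]

theorem sum_digits_lt {b m : ℕ} {a : ℕ → ℕ} (ha : ∀ q < m, a q < b) :
    ∑ q ∈ Finset.range m, a q * b ^ q < b ^ m := by
  induction m with
  | zero => simp
  | succ m ih =>
    rw [Finset.sum_range_succ, pow_succ]
    have := ih fun q hq => ha q (by omega)
    have := ha m (by omega)
    have : (a m + 1) * b ^ m ≤ b * b ^ m := Nat.mul_le_mul_right _ this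
    nlinarith

theorem dig_sum_digits {b m : ℕ} {a : ℕ → ℕ} (ha : ∀ q < m, a q < b) :
    ∀ q < m, dig b q (∑ q ∈ Finset.range m, a q * b ^ q) = a q := by
  induction m with
  | zero => intro q hq; omega
  | succ m ih =>
    intro q hq
    have hb : 0 < b := (Nat.zero_le _).trans_lt (ha q hq)
    rw [Finset.sum_range_succ, mul_comm (a m)]
    rcases Nat.lt_succ_iff_lt_or_eq.1 hq with hq | rfl
    · rw [dig_add_mul_of_lt hb hq, ih (fun q hq => ha q (by omega)) q hq]
    · exact dig_add_mul_self hb (sum_digits_lt fun q hq => ha q (by omega)) (ha q (by omega))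

/-- The points whose bucket number in each coordinate `j` lies strictly between the digits `2 * j`
and `2 * j + 1` of `key`. -/
def bucketBox (d b n : ℕ) (β : ℕ → ℕ → ℕ) (key : ℕ) : Finset ℕ :=
  (Finset.range n).filter fun i =>
    ∀ j < d, dig b (2 * j) key < β j i ∧ β j i < dig b (2 * j + 1) key

/-- The same without the upper bound in the last coordinate. -/
def openBox (d b n : ℕ) (β : ℕ → ℕ → ℕ) (key : ℕ) : Finset ℕ :=
  (Finset.range n).filter fun i =>
    ∀ j < d, dig b (2 * j) key < β j i ∧ (j + 1 < d → β j i < dig b (2 * j + 1) key)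

theorem mem_bucketBox_iff {d b n : ℕ} {β : ℕ → ℕ → ℕ} {key r i : ℕ} (hd : 1 ≤ d) (hb : 0 < b)
    (hk : key < b ^ (2 * d - 1)) (hr : r < b) :
    i ∈ bucketBox d b n β (key + b ^ (2 * d - 1) * r) ↔
      i ∈ openBox d b n β key ∧ β (d - 1) i < r := by
  have h1 : ∀ q < 2 * d - 1, dig b q (key + b ^ (2 * d - 1) * r) = dig b q key :=
    fun q hq => dig_add_mul_of_lt hb hq
  have h2 := dig_add_mul_self hb hk hr
  simp only [bucketBox, openBox, Finset.mem_filter, and_assoc]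
  refine and_congr_right fun _ => ⟨fun h => ⟨fun j hj => ?_, ?_⟩, fun h j hj => ?_⟩
  · have := h j hj
    rw [h1 _ (by omega)] at this
    exact ⟨this.1, fun hj' => by rw [h1 _ (by omega)] at this; exact this.2⟩
  · have := (h (d - 1) (by omega)).2
    rwa [show 2 * (d - 1) + 1 = 2 * d - 1 by omega, h2] at this
  · have := h.1 j hj
    rw [h1 _ (by omega)]
    refine ⟨this.1, ?_⟩
    by_cases hj' : j + 1 < d
    · rw [h1 _ (by omega)]; exact this.2 hj'
    · obtain rfl : j = d - 1 := by omega
      rw [show 2 * (d - 1) + 1 = 2 * d - 1 by omega, h2]; exact h.2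

theorem bucketBox_eq_filter {d b n : ℕ} {β : ℕ → ℕ → ℕ} {key r : ℕ} (hd : 1 ≤ d) (hb : 0 < b)
    (hk : key < b ^ (2 * d - 1)) (hr : r < b) :
    bucketBox d b n β (key + b ^ (2 * d - 1) * r) =
      (openBox d b n β key).filter fun i => β (d - 1) i < r := by
  ext i
  rw [mem_bucketBox_iff hd hb hk hr, Finset.mem_filter]

namespace RealRAM

/-- `o` sorts the points by the key `x`, and `β` numbers the buckets of `S` consecutive points. -/
structure Buckets (n S : ℕ) (x : ℕ → ℝ) (o β : ℕ → ℕ) : Prop extends Sorted n x o where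
  bucket : ∀ p < n, β (o p) = p / S

/-! ### Inserting a point into the running statistics -/

/-- The test that the point in word variable `5` lies in the box of buckets with the key in word
variable `8`. Word variable `2` holds the base, word array `4 + 2 * j` the bucket numbers. -/
def inBoxTest (d : ℕ) : BExpr :=
  allB d fun j => .and
    (.ilt (.mod (.div (.var 8) (powE (.var 2) (2 * j))) (.var 2)) (.read (4 + 2 * j) (.var 5)))
    (.ilt (.read (4 + 2 * j) (.var 5))
      (.mod (.div (.var 8) (powE (.var 2) (2 * j + 1))) (.var 2)))

theorem inBoxTest_holds {W d b n i key : ℕ} {s : State} {β : ℕ → ℕ → ℕ} (hW : b ^ (2 * d) < W)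
    (hb : 2 ≤ b) (hd : 1 ≤ d) (h2 : s.ivar 2 = b) (h5 : s.ivar 5 = i) (h8 : s.ivar 8 = key)
    (hi : i < n) (hβ : ∀ j < d, s.iarr (4 + 2 * j) i = β j i) :
    (inBoxTest d).Holds W s ↔ i ∈ bucketBox d b n β key := by
  have hpow : ∀ q ≤ 2 * d, b ^ q < W := fun q hq =>
    (Nat.pow_le_pow_right (by omega) hq).trans_lt hW
  have hW1 : 1 < W := by
    have := hpow 1 (by omega)
    rw [pow_one] at this
    omega
  simp only [inBoxTest, allB_holds hW1, bucketBox, Finset.mem_filter, Finset.mem_range, hi,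
    true_and]
  refine forall₂_congr fun j hj => ?_
  simp only [BExpr.Holds, IExpr.eval]
  rw [powE_eval (v := b) (by simpa [IExpr.eval] using h2) hW1 (by omega) (hpow _ (by omega)),
    powE_eval (v := b) (by simpa [IExpr.eval] using h2) hW1 (by omega) (hpow _ (by omega)),
    h5, hβ j hj, h2, h8]
  rfl

/-- The running statistics of `Q`, in the real variables `2 * d`, `2 * d + 1`, `2 * d + 2`, and its
colour counts, in word array `2 * d + 4`; the counts are right for the colours of the points in
`Cand`. -/
structure Acc (d : ℕ) (α : ℝ) (col : ℕ → ℕ) (Cand : Set ℕ) (Q : Finset ℕ) (s : State) : Prop where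
  stat : ∀ k < 3, s.rvar (2 * d + k) = stat α col k Q
  cnt : ∀ i ∈ Cand, s.iarr (2 * d + 4) (col i) = mult col Q (col i)

/-- `statFun` as an expression; `α` is in the real variable `2 * d + 3`. -/
def statE (d : ℕ) : ℕ → IExpr → RExpr
  | 0, e => .ofInt e
  | 1, e => .mul (.ofInt e) (.log2 (.ofInt e))
  | _, e => .mul (.ofInt e)
      (.exp2 (.mul (.sub (.var (2 * d + 3)) (.ofInt (.const 1))) (.log2 (.ofInt e))))

theorem ite_logb_natCast (m : ℕ) :
    (open Classical in if 0 < (m : ℝ) then Real.logb 2 m else 0) = Real.logb 2 m := by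
  split_ifs with h
  · rfl
  · have : m = 0 := by simpa using h
    simp [this]

theorem statE_eval {W d k m : ℕ} {α : ℝ} {e : IExpr} {s : State} (hW : 1 < W)
    (he : e.eval W s = m) (hα : s.rvar (2 * d + 3) = α) :
    (statE d k e).eval W s = statFun α k m := by
  rcases k with _ | _ | k <;>
    simp only [statE, statFun, RExpr.eval, IExpr.eval, he, hα, Nat.mod_eq_of_lt hW,
      ite_logb_natCast, Nat.cast_one]

/-- Insert the point in word variable `5` into the running statistics. -/
def insertProg (d : ℕ) : Stmt :=
  .seq (.iset 6 (.read (2 * d + 4) (.read 0 (.var 5))))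
    (.seq (seqN 3 fun k => .rset (2 * d + k) (.add (.var (2 * d + k))
        (.sub (statE d k (.add (.var 6) (.const 1))) (statE d k (.var 6)))))
      (.iwrite (2 * d + 4) (.read 0 (.var 5)) (.add (.var 6) (.const 1))))

theorem insertProg_runs {W d i : ℕ} {α : ℝ} {col : ℕ → ℕ} {Cand : Set ℕ} {Q : Finset ℕ}
    {s : State} (hW : Q.card + 1 < W) (h0 : s.iarr 0 = col) (hα : s.rvar (2 * d + 3) = α)
    (h5 : s.ivar 5 = i) (hi : i ∈ Cand) (hiQ : i ∉ Q) (h : Acc d α col Cand Q s) :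
    Runs W (insertProg d) s (insertProg d).flatCost (Acc d α col Cand (insert i Q)) := by
  have h1 : 1 % W = 1 := Nat.mod_eq_of_lt (by omega)
  have hm : mult col Q (col i) + 1 < W :=
    lt_of_le_of_lt (Nat.succ_le_succ (Finset.card_filter_le _ _)) hW
  refine Runs.of_wp ?_
  have e1 := fun (k : ℕ) (s : State) (m : ℕ) (h6 : s.ivar 6 = m)
    (hα : s.rvar (2 * d + 3) = α) => statE_eval (k := k) (e := .var 6) (show 1 < W by omega) h6 hα
  have e2 := fun (k : ℕ) (s : State) (m : ℕ) (h6 : s.ivar 6 = m) (hm : m + 1 < W)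
    (hα : s.rvar (2 * d + 3) = α) =>
    statE_eval (k := k) (e := .add (.var 6) (.const 1)) (m := m + 1) (show 1 < W by omega)
      (by simp [IExpr.eval, h6, h1, Nat.mod_eq_of_lt hm]) hα
  simp only [insertProg, seqN, Stmt.wp, IExpr.eval, RExpr.eval, h0, h5, h.cnt i hi]
  rw [e1 0 _ (mult col Q (col i)) (by simp) (by simp [hα]),
    e2 0 _ (mult col Q (col i)) (by simp) hm (by simp [hα]),
    e1 1 _ (mult col Q (col i)) (by simp) (by simp [hα]),
    e2 1 _ (mult col Q (col i)) (by simp) hm (by simp [hα]),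
    e1 2 _ (mult col Q (col i)) (by simp) (by simp [hα]),
    e2 2 _ (mult col Q (col i)) (by simp) hm (by simp [hα])]
  constructor
  · intro k hk
    have := h.stat k hk
    unfold _root_.stat at this ⊢
    rw [colorSum_insert (statFun_zero α k) hiQ, ← this]
    interval_cases k <;> simp
  · intro i' hi'
    have h5' : Function.update s.ivar 6 (mult col Q (col i)) 5 = i := by simp [h5]
    simp only [Function.update_self, h1, h5']
    rw [mult_insert hiQ]
    by_cases hc : col i = col i'
    · rw [if_pos hc, hc, Function.update_self, ← hc, Nat.mod_eq_of_lt hm]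
    · rw [if_neg hc, Function.update_of_ne (Ne.symm hc), h.cnt i' hi', add_zero]

theorem insertProg_WI {d x : ℕ} : (insertProg d).WI x ↔ x = 6 := by
  simp [insertProg, Stmt.WI, seqN]
theorem insertProg_WR {d x : ℕ} :
    (insertProg d).WR x ↔ x = 2 * d ∨ x = 2 * d + 1 ∨ x = 2 * d + 2 := by
  simp [insertProg, Stmt.WR, seqN, or_assoc]
theorem insertProg_WA {d x : ℕ} : (insertProg d).WA x ↔ x = 2 * d + 4 := by
  simp [insertProg, Stmt.WA, seqN]
theorem insertProg_WB {d x : ℕ} : ¬ (insertProg d).WB x := by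
  simp [insertProg, Stmt.WB, seqN]

/-! ### Tabulating the statistics of all boxes of buckets -/

/-- The parameters of the data structure: `n` points with coordinates `x j` and colours `col`,
`b - 1` buckets of `S` points in each coordinate, bucket numbers `β j`, sorted orders `o j`. -/
structure Params (W d n S b : ℕ) (x : ℕ → ℕ → ℝ) (o β : ℕ → ℕ → ℕ) : Prop where
  hd : 1 ≤ d
  hb : 2 ≤ b
  hS : n < S * (b - 1)
  hW : (n + 3) * b ^ (2 * d) < W
  buckets : ∀ j < d, Buckets n S (x j) (o j) (β j)

namespace Params

variable {W d n S b : ℕ} {x : ℕ → ℕ → ℝ} {o β : ℕ → ℕ → ℕ}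

theorem pow_eq (h : Params W d n S b x o β) : b ^ (2 * d) = b ^ (2 * d - 1) * b := by
  have := h.hd
  rw [← pow_succ]; congr 1; omega

theorem pow_lt (h : Params W d n S b x o β) {q : ℕ} (hq : q ≤ 2 * d) : b ^ q < W := by
  have h1 : b ^ q ≤ b ^ (2 * d) := Nat.pow_le_pow_right (by have := h.hb; omega) hq
  have := h.hW
  nlinarith

theorem lt_W (h : Params W d n S b x o β) : n + 3 < W := by
  have h1 : 2 ≤ b ^ (2 * d) := h.hb.trans (Nat.le_self_pow (by have := h.hd; omega) b)
  have := h.hW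
  nlinarith

theorem mul_pow_lt (h : Params W d n S b x o β) : b ^ (2 * d - 1) * (n + 3) < W := by
  have h1 : b ^ (2 * d - 1) ≤ b ^ (2 * d) :=
    Nat.pow_le_pow_right (by have := h.hb; omega) (by omega)
  have := h.hW
  nlinarith

theorem S_pos (h : Params W d n S b x o β) : 0 < S := by
  have := h.hS
  rcases Nat.eq_zero_or_pos S with rfl | h
  · simp at this
  · exact h

theorem div_lt (h : Params W d n S b x o β) {p : ℕ} (hp : p ≤ n) : p / S + 1 < b := by
  have h1 : p / S < b - 1 := by
    rw [Nat.div_lt_iff_lt_mul h.S_pos, mul_comm]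
    exact hp.trans_lt h.hS
  exact Nat.lt_sub_iff_add_lt.1 h1

theorem key_lt (h : Params W d n S b x o β) {key r : ℕ} (hk : key < b ^ (2 * d - 1))
    (hr : r < b) : key + b ^ (2 * d - 1) * r < b ^ (2 * d) := by
  rw [h.pow_eq]
  have : b ^ (2 * d - 1) * (r + 1) ≤ b ^ (2 * d - 1) * b := Nat.mul_le_mul_left _ hr
  rw [mul_add] at this
  omega

end Params

/-- The registers and arrays of `s` hold the parameters of the data structure. -/
structure Holds (d n S b : ℕ) (α : ℝ) (x : ℕ → ℕ → ℝ) (o β : ℕ → ℕ → ℕ) (col : ℕ → ℕ)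
    (s : State) : Prop where
  n : s.ivar 0 = n
  S : s.ivar 1 = S
  b : s.ivar 2 = b
  α : s.rvar (2 * d + 3) = α
  col : s.iarr 0 = col
  pts : ∀ j < d, s.rarr j = x j
  ord : ∀ j < d, s.iarr (3 + 2 * j) = o j
  bucket : ∀ j < d, s.iarr (4 + 2 * j) = β j

theorem Holds.of_frame {d n S b : ℕ} {α : ℝ} {x : ℕ → ℕ → ℝ} {o β : ℕ → ℕ → ℕ} {col : ℕ → ℕ}
    {p : Stmt} {s s' : State} (h : Holds d n S b α x o β col s) (hf : Frame p s s')
    (hI : ∀ y < 3, ¬ p.WI y) (hR : ¬ p.WR (2 * d + 3))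
    (hA : ∀ a < 2 * d + 4, a ≠ 2 → ¬ p.WA a) (hB : ∀ a < d, ¬ p.WB a) :
    Holds d n S b α x o β col s' where
  n := (hf.ivar 0 (hI _ (by omega))).trans h.n
  S := (hf.ivar 1 (hI _ (by omega))).trans h.S
  b := (hf.ivar 2 (hI _ (by omega))).trans h.b
  α := (hf.rvar _ hR).trans h.α
  col := (hf.iarr 0 (hA _ (by omega) (by omega))).trans h.col
  pts j hj := (hf.rarr j (hB j hj)).trans (h.pts j hj)
  ord j hj := (hf.iarr _ (hA _ (by omega) (by omega))).trans (h.ord j hj)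
  bucket j hj := (hf.iarr _ (hA _ (by omega) (by omega))).trans (h.bucket j hj)

/-- One step of the sweep over the points in the order of the last coordinate: insert the point at
position `k` (word variable `4`) if it passes the test for the current key (word variable `3`), and
save the running statistics as those of the first `k / S + 1` buckets. The value saved last for a
number of buckets is the right one. -/
def sweepBody (d : ℕ) : Stmt :=
  .seq (.seq (.iset 5 (.read (3 + 2 * (d - 1)) (.var 4)))
      (.iset 8 (.add (.var 3)
        (.mul (powE (.var 2) (2 * d - 1)) (.add (.div (.var 4) (.var 1)) (.const 1))))))
    (.seq (.cond (inBoxTest d) (insertProg d) .skip)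
      (seqN 3 fun k => .rwrite (d + k) (.var 8) (.var (2 * d + k))))

/-- The points of the open box among the first `k` points of the order `o`. -/
def swept (B : Finset ℕ) (o : ℕ → ℕ) (k : ℕ) : Finset ℕ :=
  B.filter fun i => i ∈ (Finset.range k).image o

theorem swept_succ {n k : ℕ} {B : Finset ℕ} {x : ℕ → ℝ} {o : ℕ → ℕ} (h : Sorted n x o)
    (hk : k < n) : (o k ∉ swept B o k) ∧
      swept B o (k + 1) = if o k ∈ B then insert (o k) (swept B o k) else swept B o k := by
  constructor
  · simp only [swept, Finset.mem_filter, Finset.mem_image, Finset.mem_range]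
    rintro ⟨-, p, hp, hop⟩
    have := h.inj p (by omega) k hk hop
    omega
  · ext i
    split_ifs with hB <;>
      simp only [swept, Finset.mem_filter, Finset.mem_image, Finset.mem_range, Finset.mem_insert,
        Nat.exists_lt_succ_right]
    · constructor
      · rintro ⟨h1, h2 | h2⟩
        exacts [.inr ⟨h1, h2⟩, .inl h2.symm]
      · rintro (rfl | ⟨h1, h2⟩)
        exacts [⟨hB, .inr rfl⟩, ⟨h1, .inl h2⟩]
    · refine and_congr_right fun hi => or_iff_left ?_
      rintro rfl
      exact hB hi

theorem swept_eq {n S r : ℕ} {B : Finset ℕ} {x : ℕ → ℝ} {o β : ℕ → ℕ} (h : Buckets n S x o β)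
    (hS : 0 < S) (hB : B ⊆ Finset.range n) (hr : r * S ≤ n) :
    swept B o (r * S) = B.filter fun i => β i < r := by
  refine Finset.filter_congr fun i hi => ?_
  obtain ⟨p, hp, rfl⟩ := h.surj (Finset.mem_range.1 (hB hi))
  rw [h.bucket p hp, Nat.div_lt_iff_lt_mul hS, Finset.mem_image]
  constructor
  · rintro ⟨p', hp', h'⟩
    rw [Finset.mem_range] at hp'
    rwa [← h.inj p' (by omega) p hp h']
  · exact fun h' => ⟨p, Finset.mem_range.2 h', rfl⟩

theorem swept_all {n : ℕ} {B : Finset ℕ} {x : ℕ → ℝ} {o : ℕ → ℕ} (h : Sorted n x o)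
    (hB : B ⊆ Finset.range n) : swept B o n = B := by
  refine Finset.filter_true_of_mem fun i hi => ?_
  obtain ⟨p, hp, rfl⟩ := h.surj (Finset.mem_range.1 (hB hi))
  exact Finset.mem_image_of_mem _ (Finset.mem_range.2 hp)

theorem openBox_subset {d b n key : ℕ} {β : ℕ → ℕ → ℕ} :
    openBox d b n β key ⊆ Finset.range n := Finset.filter_subset _ _

/-- The invariant of the sweep: the statistics of the swept points are at hand; those of the first
`r` buckets are in the tables as far as these buckets have been swept; entries of other keys are
as in the state `s₀`. -/
structure SweepInv (d n S b : ℕ) (α : ℝ) (col : ℕ → ℕ) (B : Finset ℕ) (o : ℕ → ℕ) (key : ℕ)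
    (s₀ : State) (k : ℕ) (s : State) : Prop where
  acc : Acc d α col {i | i < n} (swept B o k) s
  ent : ∀ m < 3, ∀ r < b, (r = 0 ∨ (r - 1) * S < k) →
    s.rarr (d + m) (key + b ^ (2 * d - 1) * r) = stat α col m (swept B o (min (r * S) k))
  other : ∀ m < 3, ∀ idx, idx % b ^ (2 * d - 1) ≠ key →
    s.rarr (d + m) idx = s₀.rarr (d + m) idx

theorem sweepBody_runs {W d n S b key k : ℕ} {α : ℝ} {x : ℕ → ℕ → ℝ} {o β : ℕ → ℕ → ℕ}
    {col : ℕ → ℕ} {s₀ s : State} (hp : Params W d n S b x o β) (hk : key < b ^ (2 * d - 1))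
    (hkn : k < n) (hh : Holds d n S b α x o β col s) (h3 : s.ivar 3 = key) (h4 : s.ivar 4 = k)
    (hi : SweepInv d n S b α col (openBox d b n β key) (o (d - 1)) key s₀ k s) :
    Runs W (sweepBody d) s (sweepBody d).flatCost
      (SweepInv d n S b α col (openBox d b n β key) (o (d - 1)) key s₀ (k + 1)) := by
  have hd := hp.hd
  have hb := hp.hb
  have hW := hp.lt_W
  have hS := hp.S_pos
  have hB := hp.buckets (d - 1) (by omega)
  set P := b ^ (2 * d - 1) with hP
  have hr0 := hp.div_lt hkn.le
  have hPpos : 0 < P := by positivity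
  have hfull := hp.key_lt hk hr0
  rw [← hP] at hfull
  have hpl := hp.pow_lt le_rfl
  have e1 : (k / S + 1) % W = k / S + 1 :=
    Nat.mod_eq_of_lt (lt_of_le_of_lt (Nat.succ_le_succ (Nat.div_le_self _ _)) (by omega))
  have e2 : P * (k / S + 1) % W = P * (k / S + 1) := Nat.mod_eq_of_lt (by omega)
  have e3 : (key + P * (k / S + 1)) % W = key + P * (k / S + 1) := Nat.mod_eq_of_lt (by omega)
  obtain ⟨hsw1, hsw2⟩ := swept_succ (B := openBox d b n β key) hB.toSorted hkn
  refine Runs.mono (Runs.seq (Q := fun s' => s'.ivar 5 = o (d - 1) k ∧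
    s'.ivar 8 = key + P * (k / S + 1) ∧
    SweepInv d n S b α col (openBox d b n β key) (o (d - 1)) key s₀ k s')
    (Runs.of_wp ?_) fun s₁ hf₁ hQ₁ => Runs.seq (c₁ := (inBoxTest d).cost + 1 +
      ((insertProg d).flatCost + 1)) (c₂ := _) (Q := fun s' => s'.ivar 8 = key + P * (k / S + 1) ∧
      Acc d α col {i | i < n} (swept (openBox d b n β key) (o (d - 1)) (k + 1)) s' ∧
      s'.rarr = s₁.rarr) ?_ fun s₂ hf₂ hQ₂ => Runs.of_wp ?_) ?_ fun _ _ h => h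
  · simp only [Stmt.wp, IExpr.eval]
    rw [powE_eval (v := b) (by simpa [IExpr.eval] using hh.b) (by omega) (by omega)
      (hp.pow_lt (by omega))]
    have h5 : ∀ v, Function.update s.ivar 5 v 3 = key := fun v => by simp [h3]
    have h6 : ∀ v, Function.update s.ivar 5 v 4 = k := fun v => by simp [h4]
    have h7 : ∀ v, Function.update s.ivar 5 v 1 = S := fun v => by simp [hh.S]
    simp only [hh.ord (d - 1) (by omega), h5, h6, h7, h4, Nat.mod_eq_of_lt (show 1 < W by omega),
      ← hP, e1, e2, e3]
    exact ⟨by simp, by simp, ⟨hi.acc.stat, hi.acc.cnt⟩, hi.ent, hi.other⟩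
  · obtain ⟨h5, h8, hi₁⟩ := hQ₁
    have hh₁ : Holds d n S b α x o β col s₁ := by
      apply hh.of_frame hf₁ <;> simp [Stmt.WI, Stmt.WR, Stmt.WA, Stmt.WB]
      omega
    have hlt := hB.lt k hkn
    have htest := inBoxTest_holds hpl hb hd hh₁.b h5 h8 hlt
      fun j hj => congrFun (hh₁.bucket j hj) _
    have hmem : o (d - 1) k ∈ bucketBox d b n β (key + P * (k / S + 1)) ↔
        o (d - 1) k ∈ openBox d b n β key := by
      rw [mem_bucketBox_iff hd (by omega) hk hr0, hB.bucket k hkn]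
      simp
    rw [hmem] at htest
    refine Runs.cond (fun hb => ?_) fun hb => ?_
    · refine (insertProg_runs ?_ hh₁.col hh₁.α h5 hlt hsw1 hi₁.acc).mono (by omega)
        fun s' hf h => ⟨?_, ?_, ?_⟩
      · have : (swept (openBox d b n β key) (o (d - 1)) k).card ≤ n :=
          (Finset.card_le_card ((Finset.filter_subset _ _).trans openBox_subset)).trans_eq
            (Finset.card_range n)
        omega
      · rw [← h8]; exact hf.ivar 8 (by simp [insertProg_WI])
      · rw [hsw2, if_pos (htest.1 hb)]; exact h
      · funext a; exact hf.rarr a insertProg_WB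
    · refine Runs.mono (Runs.of_wp (Q := fun s' => s' = s₁) ?_) (c := 1) ?_ ?_
      · rfl
      · omega
      · rintro s' - rfl
        refine ⟨h8, ?_, rfl⟩
        rw [hsw2, if_neg (fun h => hb (htest.2 h))]; exact hi₁.acc
  · obtain ⟨h8, hacc, hra⟩ := hQ₂
    have hi₁ := hQ₁.2.2
    have hw : ∀ {Q : State → Prop}, (∀ s', s'.ivar = s₂.ivar → s'.rvar = s₂.rvar →
        s'.iarr = s₂.iarr → (∀ m < 3, s'.rarr (d + m) = Function.update (s₂.rarr (d + m))
          (key + P * (k / S + 1)) (s₂.rvar (2 * d + m))) → Q s') →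
        (seqN 3 fun k => .rwrite (d + k) (.var 8) (.var (2 * d + k))).wp W Q s₂ := by
      intro Q h
      simp only [seqN, Stmt.wp, IExpr.eval, RExpr.eval, h8]
      refine h _ rfl rfl rfl fun m hm => ?_
      interval_cases m <;> simp
    apply hw
    rintro s' hs1 hs2 hs3 hs4
    refine ⟨⟨by rw [hs2]; exact hacc.stat, by rw [hs3]; exact hacc.cnt⟩,
      fun m hm r hr hrk => ?_, fun m hm idx hidx => ?_⟩
    · rw [hs4 m hm, hacc.stat m hm]
      by_cases hrr : r = k / S + 1
      · subst hrr
        rw [Function.update_self, min_eq_right]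
        rw [add_mul, one_mul]
        have := Nat.lt_div_mul_add hS (a := k)
        omega
      · have hne : key + P * r ≠ key + P * (k / S + 1) := by
          intro h
          exact hrr (Nat.eq_of_mul_eq_mul_left hPpos (by omega))
        rw [Function.update_of_ne hne, hra]
        rcases Nat.eq_zero_or_pos r with rfl | hrpos
        · rw [hi₁.ent m hm 0 hr (.inl rfl)]; simp
        · have h1 : (r - 1) * S ≤ k := by omega
          have h2 : r - 1 ≤ k / S := (Nat.le_div_iff_mul_le hS).2 h1
          have h3 : r ≤ k / S := by omega
          have h4 : r * S ≤ k := (Nat.le_div_iff_mul_le hS).1 h3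
          rw [hi₁.ent m hm r hr (.inr ?_), min_eq_left h4, min_eq_left (by omega)]
          have : (r - 1) * S < r * S := Nat.mul_lt_mul_of_pos_right (by omega) hS
          omega
    · rw [hs4 m hm, Function.update_of_ne, hra, hi₁.other m hm idx hidx]
      rintro rfl
      exact hidx (by rw [Nat.add_mul_mod_self_left, Nat.mod_eq_of_lt hk])
  · simp only [sweepBody, Stmt.flatCost]; omega

/-- Fill in all table entries for the key in word variable `3`. -/
def keyBody (d : ℕ) : Stmt :=
  .seq (seqN 3 fun k => .seq (.rset (2 * d + k) (.ofInt (.const 0)))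
      (.rwrite (d + k) (.var 3) (.ofInt (.const 0))))
    (.seq (forUp 5 (.var 0) (.iwrite (2 * d + 4) (.read 0 (.var 5)) (.const 0)))
      (.seq (forUp 4 (.var 0) (sweepBody d))
        (forUp 5 (.var 0) (.iwrite 2 (.add (.mul (.var 3) (.var 0)) (.var 5))
          (.read (2 * d + 4) (.read 0 (.var 5)))))))

theorem sweepBody_WI {d y : ℕ} : (sweepBody d).WI y ↔ y = 5 ∨ y = 8 ∨ y = 6 := by
  simp [sweepBody, Stmt.WI, insertProg_WI, seqN, or_assoc]
theorem sweepBody_WR {d y : ℕ} :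
    (sweepBody d).WR y ↔ y = 2 * d ∨ y = 2 * d + 1 ∨ y = 2 * d + 2 := by
  simp [sweepBody, Stmt.WR, insertProg_WR, seqN]
theorem sweepBody_WA {d y : ℕ} : (sweepBody d).WA y ↔ y = 2 * d + 4 := by
  simp [sweepBody, Stmt.WA, insertProg_WA, seqN]
theorem sweepBody_WB {d y : ℕ} :
    (sweepBody d).WB y ↔ y = d ∨ y = d + 1 ∨ y = d + 2 := by
  simp [sweepBody, Stmt.WB, insertProg_WB, seqN]; tauto

theorem keyBody_WI {d y : ℕ} : (keyBody d).WI y ↔ y = 4 ∨ y = 5 ∨ y = 8 ∨ y = 6 := by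
  simp [keyBody, Stmt.WI, sweepBody_WI, seqN, forUp]; omega
theorem keyBody_WR {d y : ℕ} :
    (keyBody d).WR y ↔ y = 2 * d ∨ y = 2 * d + 1 ∨ y = 2 * d + 2 := by
  simp [keyBody, Stmt.WR, sweepBody_WR, seqN, forUp]; omega
theorem keyBody_WA {d y : ℕ} : (keyBody d).WA y ↔ y = 2 * d + 4 ∨ y = 2 := by
  simp [keyBody, Stmt.WA, sweepBody_WA, seqN, forUp]
theorem keyBody_WB {d y : ℕ} :
    (keyBody d).WB y ↔ y = d ∨ y = d + 1 ∨ y = d + 2 := by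
  simp [keyBody, Stmt.WB, sweepBody_WB, seqN, forUp]; tauto

/-- The table entries of the keys below `k`: colour counts of the open boxes in word array `2`,
statistics of the boxes in the real arrays `d`, `d + 1`, `d + 2`. -/
structure Tables (d n S b : ℕ) (α : ℝ) (col : ℕ → ℕ) (β : ℕ → ℕ → ℕ) (k : ℕ) (s : State) :
    Prop where
  count : ∀ key < k, ∀ i < n,
    s.iarr 2 (key * n + i) = mult col (openBox d b n β key) (col i)
  stat : ∀ m < 3, ∀ key < k, ∀ r ≤ n / S, s.rarr (d + m) (key + b ^ (2 * d - 1) * r) =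
    stat α col m ((openBox d b n β key).filter fun i => β (d - 1) i < r)

theorem keyBody_runs (d : ℕ) : ∃ K : ℕ, ∀ {W n S b key : ℕ} {α : ℝ} {x : ℕ → ℕ → ℝ}
    {o β : ℕ → ℕ → ℕ} {col : ℕ → ℕ} {s : State}, Params W d n S b x o β →
    key < b ^ (2 * d - 1) → Holds d n S b α x o β col s → s.ivar 3 = key →
    Tables d n S b α col β key s →
    Runs W (keyBody d) s (K * (n + 1)) (Tables d n S b α col β (key + 1)) := by
  refine ⟨100 + (sweepBody d).flatCost, fun {W n S b key α x o β col s} hp hk hh h3 ht => ?_⟩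
  have hd := hp.hd
  have hb := hp.hb
  have hW := hp.lt_W
  have hS := hp.S_pos
  have hB := hp.buckets (d - 1) (by omega)
  have hPn := hp.mul_pow_lt
  set P := b ^ (2 * d - 1) with hP
  have hPpos : 0 < P := by positivity
  have hkn : (key + 1) * n ≤ P * n := Nat.mul_le_mul_right _ hk
  rw [add_mul, one_mul] at hkn
  have hs0 : ∀ B o, swept B o 0 = ∅ := fun B o => by simp [swept]
  refine Runs.mono (Runs.seq (c₁ := 22) (c₂ := (n + 1) * (4 + 11) +
      ((n + 1) * ((sweepBody d).flatCost + 11) + (n + 1) * (9 + 11)))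
      (Q := fun s' => ∀ m < 3, s'.rvar (2 * d + m) = 0 ∧
        s'.rarr (d + m) = Function.update (s.rarr (d + m)) key 0)
    (Runs.mono (Runs.of_wp ?_) ?_ fun _ _ h => h) fun s₁ hf₁ hQ₁ => Runs.seq
      (Q := fun s' => ∀ i < n, s'.iarr (2 * d + 4) (col i) = 0) ?_ fun s₂ hf₂ hQ₂ => Runs.seq
      (Q := SweepInv d n S b α col (openBox d b n β key) (o (d - 1)) key s n) ?_
      fun s₃ hf₃ hQ₃ => Runs.mono (c' := (n + 1) * (9 + 11))
        (Q' := Tables d n S b α col β (key + 1)) (Runs.forUp (c := 9) n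
        (fun k s' => (∀ i < k, s'.iarr 2 (key * n + i) =
          mult col (openBox d b n β key) (col i)) ∧ ∀ i < key * n, s'.iarr 2 i = s.iarr 2 i)
        (by omega) (by simp [Stmt.WI]) ?_ ?_ ?_) ?_ ?_) ?_ fun _ _ h => h
  · simp only [seqN, Stmt.wp, IExpr.eval, RExpr.eval, Nat.zero_mod, Nat.cast_zero, h3]
    intro m hm
    interval_cases m <;> simp
  · simp [seqN, Stmt.flatCost, IExpr.cost, RExpr.cost]
  · have hh₁ : Holds d n S b α x o β col s₁ := by
      apply hh.of_frame hf₁ <;> simp [seqN, Stmt.WI, Stmt.WR, Stmt.WA, Stmt.WB]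
      omega
    refine Runs.mono (Runs.forUp (c := 4) n
      (fun k s' => ∀ i < k, s'.iarr (2 * d + 4) (col i) = 0)
      (by omega) (by simp [Stmt.WI]) ?_ ?_ ?_) (by simp [IExpr.cost]) fun _ _ h => h
    · intro s' hf
      exact (hf.ivar 0 (by simp [forUp, Stmt.WI])).trans hh₁.n
    · intro i hi; omega
    · intro k hk s' hf hx hi
      have h0 : s'.iarr 0 = col := (hf.iarr 0 (by simp [forUp, Stmt.WA])).trans hh₁.col
      refine (Runs.of_wp ?_).mono (by simp [Stmt.flatCost, IExpr.cost]) fun _ _ h => h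
      simp only [Stmt.wp, IExpr.eval, hx, h0, Nat.zero_mod, Function.update_self]
      intro i hik
      by_cases hc : col i = col k
      · rw [hc, Function.update_self]
      · rw [Function.update_of_ne hc]
        refine hi i (lt_of_le_of_ne (by omega) ?_)
        rintro rfl
        exact hc rfl
  · have hf12 : Frame (keyBody d) s s₂ := hf₁.seq_left.trans hf₂.seq_left.seq_right
    have hh₂ : Holds d n S b α x o β col s₂ := by
      apply hh.of_frame hf12 <;> simp only [keyBody_WI, keyBody_WR, keyBody_WA, keyBody_WB] <;>
        omega
    have h3₂ : s₂.ivar 3 = key := (hf12.ivar 3 (by simp [keyBody_WI])).trans h3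
    have hr₂ : s₂.rarr = s₁.rarr := by
      funext a; exact hf₂.rarr a (by simp [forUp, Stmt.WB])
    have hv₂ : s₂.rvar = s₁.rvar := by
      funext a; exact hf₂.rvar a (by simp [forUp, Stmt.WR])
    refine Runs.mono (Runs.forUp (c := (sweepBody d).flatCost) n
      (SweepInv d n S b α col (openBox d b n β key) (o (d - 1)) key s)
      (by omega) (by simp [sweepBody_WI]) ?_ ?_ ?_) (by simp [IExpr.cost]) fun _ _ h => h
    · intro s' hf
      exact (hf.ivar 0 (by simp [forUp, Stmt.WI, sweepBody_WI])).trans hh₂.n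
    · refine ⟨⟨fun m hm => ?_, fun i hi => ?_⟩, fun m hm r hr hrk => ?_, fun m hm idx hidx => ?_⟩
      · rw [hs0, stat_empty]
        exact (congrFun hv₂ _).trans (hQ₁ m hm).1
      · rw [hs0]
        simpa [mult] using hQ₂ i hi
      · obtain rfl : r = 0 := by omega
        simp only [hr₂, (hQ₁ m hm).2]
        simp [hs0, stat_empty]
      · simp only [hr₂, (hQ₁ m hm).2]
        rw [Function.update_of_ne]
        rintro rfl
        exact hidx (Nat.mod_eq_of_lt hk)
    · intro k hkn' s' hf hx hi
      have hh' : Holds d n S b α x o β col s' := by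
        apply hh₂.of_frame hf <;>
          simp only [forUp_WI, forUp_WR, forUp_WA, forUp_WB, sweepBody_WI, sweepBody_WR,
            sweepBody_WA, sweepBody_WB] <;> omega
      have h3' : s'.ivar 3 = key :=
        (hf.ivar 3 (by simp [forUp, Stmt.WI, sweepBody_WI])).trans h3₂
      exact (sweepBody_runs hp hk hkn' hh' h3' hx hi).mono le_rfl fun s'' _ h =>
        ⟨⟨h.acc.stat, h.acc.cnt⟩, h.ent, h.other⟩
  · have hf13 : Frame (keyBody d) s s₃ :=
      hf₁.seq_left.trans (hf₂.seq_left.trans hf₃.seq_left.seq_right).seq_right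
    have hh₃ : Holds d n S b α x o β col s₃ := by
      apply hh.of_frame hf13 <;> simp only [keyBody_WI, keyBody_WR, keyBody_WA, keyBody_WB] <;>
        omega
    exact fun s' hf => (hf.ivar 0 (by simp [forUp, Stmt.WI])).trans hh₃.n
  · refine ⟨fun i hi => by omega, fun i _ => ?_⟩
    simp only
    rw [hf₃.iarr 2 (by simp [forUp, Stmt.WA, sweepBody_WA]),
      hf₂.iarr 2 (by simp [forUp, Stmt.WA]),
      hf₁.iarr 2 (by simp [seqN, Stmt.WA])]
  · rintro k hkn' s' hf hx ⟨hi, hi'⟩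
    have hf13 : Frame (keyBody d) s s' :=
      hf₁.seq_left.trans (hf₂.seq_left.trans (hf₃.seq_left.trans hf.seq_right).seq_right).seq_right
    have hh' : Holds d n S b α x o β col s' := by
      apply hh.of_frame hf13 <;> simp only [keyBody_WI, keyBody_WR, keyBody_WA, keyBody_WB] <;>
        omega
    have h3' : s'.ivar 3 = key := (hf13.ivar 3 (by simp [keyBody_WI])).trans h3
    have hcnt : s'.iarr (2 * d + 4) (col k) = mult col (openBox d b n β key) (col k) := by
      rw [hf.iarr _ (by simp [forUp, Stmt.WA])]
      have := hQ₃.acc.cnt k hkn'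
      rwa [swept_all hB.toSorted openBox_subset] at this
    refine (Runs.of_wp ?_).mono (by simp [Stmt.flatCost, IExpr.cost]) fun _ _ h => h
    simp only [Stmt.wp, IExpr.eval, hx, h3', hh'.n, hh'.col, Function.update_self, hcnt]
    rw [Nat.mod_eq_of_lt (a := key * n) (by nlinarith), Nat.mod_eq_of_lt (by nlinarith)]
    constructor
    · intro i hik
      rcases Nat.lt_succ_iff_lt_or_eq.1 hik with hik | rfl
      · rw [Function.update_of_ne (by omega), hi i hik]
      · rw [Function.update_self]
    · intro i hik
      rw [Function.update_of_ne (by omega), hi' i hik]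
  · simp [IExpr.cost]
  · rintro s' hf ⟨h1, h2⟩
    have hr' : s'.rarr = s₃.rarr := by
      funext a; exact hf.rarr a (by simp [forUp, Stmt.WB])
    refine ⟨fun key' hk' i hi => ?_, fun m hm key' hk' r hr => ?_⟩
    · rcases Nat.lt_succ_iff_lt_or_eq.1 hk' with hk' | rfl
      · rw [h2, ht.count key' hk' i hi]
        have : (key' + 1) * n ≤ key * n := Nat.mul_le_mul_right _ hk'
        rw [add_mul] at this
        omega
      · exact h1 i hi
    · rw [hr']
      rcases Nat.lt_succ_iff_lt_or_eq.1 hk' with hk' | rfl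
      · rw [hQ₃.other m hm, ht.stat m hm key' hk' r hr]
        rw [Nat.add_mul_mod_self_left, Nat.mod_eq_of_lt (by omega)]
        omega
      · have hrS : r * S ≤ n := (Nat.le_div_iff_mul_le hS).1 hr
        rw [hQ₃.ent m hm r (by have := hp.div_lt le_rfl; omega), min_eq_left hrS,
          swept_eq hB hS openBox_subset hrS]
        rcases Nat.eq_zero_or_pos r with h | h
        · exact .inl h
        · right
          have : (r - 1) * S < r * S := Nat.mul_lt_mul_of_pos_right (by omega) hS
          omega
  · nlinarith

/-- Fill in the tables, one key after another. -/
def tabulate (d : ℕ) : Stmt := forUp 3 (powE (.var 2) (2 * d - 1)) (keyBody d)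

theorem tabulate_runs (d : ℕ) : ∃ K : ℕ, ∀ {W n S b : ℕ} {α : ℝ} {x : ℕ → ℕ → ℝ}
    {o β : ℕ → ℕ → ℕ} {col : ℕ → ℕ} {s : State}, Params W d n S b x o β →
    Holds d n S b α x o β col s →
    Runs W (tabulate d) s (K * (b ^ (2 * d - 1) * (n + 1)))
      (Tables d n S b α col β (b ^ (2 * d - 1))) := by
  obtain ⟨K, hK⟩ := keyBody_runs d
  refine ⟨2 * (K + ((powE (.var 2) (2 * d - 1)).cost + 10)),
    fun {W n S b α x o β col s} hp hh => ?_⟩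
  have hb := hp.hb
  have hW := hp.lt_W
  have hPpos : 0 < b ^ (2 * d - 1) := by positivity
  have hholds : ∀ s', Frame (tabulate d) s s' → Holds d n S b α x o β col s' := fun s' hf => by
    apply hh.of_frame hf <;> simp only [tabulate, forUp_WI, forUp_WR, forUp_WA, forUp_WB,
      keyBody_WI, keyBody_WR, keyBody_WA, keyBody_WB] <;> omega
  refine (Runs.forUp (c := K * (n + 1)) (b ^ (2 * d - 1)) (Tables d n S b α col β)
    (hp.pow_lt (by omega)) (by simp [keyBody_WI]) ?_ ?_ ?_).mono ?_ fun _ _ h => h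
  · intro s' hf
    exact powE_eval (by simpa [IExpr.eval] using (hholds s' hf).b) (by omega) (by omega)
      (hp.pow_lt (by omega))
  · constructor <;> intros <;> omega
  · intro k hk s' hf hx hi
    exact (hK hp hk (hholds s' hf) hx hi).mono le_rfl fun s'' _ h => ⟨h.count, h.stat⟩
  · generalize (powE (IExpr.var 2) (2 * d - 1)).cost = e
    generalize b ^ (2 * d - 1) = P at *
    have h1 : (P + 1) * (K * (n + 1) + e + 10) ≤ (2 * P) * (K * (n + 1) + (e + 10) * (n + 1)) :=
      Nat.mul_le_mul (by omega) (by nlinarith)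
    calc _ ≤ _ := h1
      _ = _ := by ring

/-! ### The construction program -/

/-- The base of the keys, one more than the number `⌈n ^ t⌉` of buckets. -/
noncomputable def keyBase (n : ℕ) (t : ℝ) : ℕ := max 2 (⌈(2 : ℝ) ^ (t * Real.logb 2 n)⌉₊ + 1)

/-- The number of points in a bucket. -/
noncomputable def bucketSize (n : ℕ) (t : ℝ) : ℕ := n / (keyBase n t - 1) + 1

theorem two_le_keyBase (n : ℕ) (t : ℝ) : 2 ≤ keyBase n t := le_max_left _ _

theorem two_rpow_mul_logb {n : ℕ} (hn : 1 ≤ n) (t : ℝ) :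
    (2 : ℝ) ^ (t * Real.logb 2 n) = (n : ℝ) ^ t := by
  rw [mul_comm, Real.rpow_mul (by norm_num), Real.rpow_logb (by norm_num) (by norm_num)]
  exact_mod_cast hn

theorem keyBase_le {n : ℕ} {t : ℝ} (ht : t ≤ 1) : keyBase n t ≤ n + 2 := by
  have : ⌈(2 : ℝ) ^ (t * Real.logb 2 n)⌉₊ ≤ n + 1 := by
    rw [Nat.ceil_le]
    rcases Nat.eq_zero_or_pos n with rfl | hn
    · simp
    · rw [two_rpow_mul_logb hn]
      have h1 : (1 : ℝ) ≤ n := by exact_mod_cast hn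
      have := Real.rpow_le_rpow_of_exponent_le h1 ht
      rw [Real.rpow_one] at this
      push_cast
      linarith
  unfold keyBase
  omega

theorem lt_bucketSize_mul (n : ℕ) (t : ℝ) : n < bucketSize n t * (keyBase n t - 1) := by
  have h := two_le_keyBase n t
  have h1 := Nat.div_add_mod n (keyBase n t - 1)
  have h2 := Nat.mod_lt n (show 0 < keyBase n t - 1 by omega)
  rw [bucketSize, add_mul, mul_comm]
  omega

/-- Compute the key base by counting up, compute the bucket size, and store the parameters. -/
def setup (d : ℕ) : Stmt :=
  .seq (.seq (.rset (2 * d + 3) (.var 0))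
      (.seq (.rset (2 * d) (.exp2 (.mul (.var 1) (.log2 (.ofInt (.var 0)))))) (.iset 2 (.const 2))))
    (.seq (forUp 4 (.var 0)
        (.cond (.rlt (.sub (.ofInt (.var 2)) (.ofInt (.const 1))) (.var (2 * d)))
          (.iset 2 (.add (.var 2) (.const 1))) .skip))
      (.seq (.iset 1 (.add (.div (.var 0) (.sub (.var 2) (.const 1))) (.const 1)))
        (.seq (.iwrite 1 (.const 0) (.var 0)) (.seq (.iwrite 1 (.const 1) (.var 1))
          (.seq (.iwrite 1 (.const 2) (.var 2)) (.rwrite (d + 3) (.const 0) (.var (2 * d + 3))))))))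

theorem setup_runs {W d n : ℕ} {α t : ℝ} {s : State} (hd : 1 ≤ d) (hW : n + 3 < W) (ht : t ≤ 1)
    (h0 : s.ivar 0 = n) (hα : s.rvar 0 = α) (h1 : s.rvar 1 = t) :
    Runs W (setup d) s (100 * (n + 1)) fun s' =>
      s'.ivar 1 = bucketSize n t ∧ s'.ivar 2 = keyBase n t ∧ s'.rvar (2 * d + 3) = α ∧
      s'.iarr 1 0 = n ∧ s'.iarr 1 1 = bucketSize n t ∧ s'.iarr 1 2 = keyBase n t ∧
      s'.rarr (d + 3) 0 = α := by
  have e1 : 1 % W = 1 := Nat.mod_eq_of_lt (by omega)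
  have e2 : 2 % W = 2 := Nat.mod_eq_of_lt (by omega)
  set ν : ℝ := (2 : ℝ) ^ (t * Real.logb 2 n) with hν
  have hb := keyBase_le (n := n) ht
  have hb2 := two_le_keyBase n t
  refine Runs.mono (Runs.seq (Q := fun s' => s'.ivar 0 = n ∧ s'.ivar 2 = 2 ∧
    s'.rvar (2 * d) = ν ∧ s'.rvar (2 * d + 3) = α) (Runs.of_wp ?_) fun s₁ hf₁ hQ₁ => Runs.seq
    (Runs.forUp (c := 13) n (fun k s' => s'.ivar 2 = min (k + 2) (keyBase n t)) (by omega)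
      (by simp [Stmt.WI]) ?_ ?_ ?_) fun s₂ hf₂ hQ₂ => Runs.of_wp ?_) ?_ fun _ _ h => h
  · simp only [Stmt.wp, IExpr.eval, RExpr.eval, e2]
    have hne : (1 : ℕ) ≠ 2 * d + 3 := by omega
    simp only [Function.update_of_ne hne, h1, h0, hα, ite_logb_natCast]
    simp [h0, hν]
  · intro s' hf
    exact (hf.ivar 0 (by simp [forUp_WI, Stmt.WI])).trans hQ₁.1
  · simp only [Function.update_of_ne (show (2 : ℕ) ≠ 4 by omega), hQ₁.2.1]
    omega
  · intro k hk s' hf hx hi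
    have hr : s'.rvar (2 * d) = ν :=
      (hf.rvar _ (by simp [forUp_WR, Stmt.WR])).trans hQ₁.2.2.1
    refine (Runs.of_wp ?_).mono
      (by simp [Stmt.flatCost, IExpr.cost, RExpr.cost, BExpr.cost]) fun _ _ h => h
    have htest : ((s'.ivar 2 : ℝ) - 1 < ν) ↔ s'.ivar 2 < keyBase n t := by
      obtain ⟨c, hc⟩ : ∃ c, s'.ivar 2 = c + 1 := ⟨s'.ivar 2 - 1, by omega⟩
      have hc1 : 1 ≤ c := by omega
      rw [hc, Nat.cast_succ, add_sub_cancel_right, ← Nat.lt_ceil, keyBase, ← hν]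
      omega
    simp only [Stmt.wp, BExpr.Holds, IExpr.eval, RExpr.eval, e1, hr, Nat.cast_one, htest,
      Function.update_of_ne (show (2 : ℕ) ≠ 4 by omega), Function.update_self]
    constructor
    · intro h
      rw [Nat.mod_eq_of_lt (by omega)]
      omega
    · intro h
      omega
  · have h20 : s₂.ivar 0 = n := (hf₂.ivar 0 (by simp [forUp_WI, Stmt.WI])).trans hQ₁.1
    have h2α : s₂.rvar (2 * d + 3) = α :=
      (hf₂.rvar _ (by simp [forUp_WR, Stmt.WR])).trans hQ₁.2.2.2
    have h22 : s₂.ivar 2 = keyBase n t := by rw [hQ₂]; omega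
    have hS : (n / (keyBase n t - 1) + 1) % W = bucketSize n t :=
      Nat.mod_eq_of_lt (lt_of_le_of_lt (Nat.succ_le_succ (Nat.div_le_self _ _)) (by omega))
    simp only [Stmt.wp, IExpr.eval, RExpr.eval, h20, h22, h2α, e1, e2, hS, Nat.zero_mod]
    simp [h20, h22]
  · simp [Stmt.flatCost, IExpr.cost, RExpr.cost]
    omega

/-- Sort by coordinate `j` and number the buckets. -/
def bucketProg (d j : ℕ) : Stmt :=
  .seq (sortProg j (2 * d + 5) (3 + 2 * j))
    (forUp 4 (.var 0) (.iwrite (4 + 2 * j) (.read (3 + 2 * j) (.var 4)) (.div (.var 4) (.var 1))))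

theorem sortProg_WI {x tr o y : ℕ} : (sortProg x tr o).WI y ↔ y = 4 ∨ y = 7 := by
  simp [sortProg, forUp_WI, Stmt.WI, setLeaf, replay]
theorem sortProg_WR {x tr o y : ℕ} : ¬ (sortProg x tr o).WR y := by
  simp [sortProg, forUp_WR, Stmt.WR, setLeaf, replay]
theorem sortProg_WA {x tr o y : ℕ} : (sortProg x tr o).WA y ↔ y = tr ∨ y = o := by
  simp [sortProg, forUp_WA, Stmt.WA, setLeaf, replay]; tauto
theorem sortProg_WB {x tr o y : ℕ} : ¬ (sortProg x tr o).WB y := by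
  simp [sortProg, forUp_WB, Stmt.WB, setLeaf, replay]

theorem bucketProg_WI {d j y : ℕ} : (bucketProg d j).WI y ↔ y = 4 ∨ y = 7 := by
  simp [bucketProg, sortProg_WI, Stmt.WI, forUp_WI]; omega
theorem bucketProg_WR {d j y : ℕ} : ¬ (bucketProg d j).WR y := by
  simp [bucketProg, sortProg_WR, Stmt.WR, forUp_WR]
theorem bucketProg_WA {d j y : ℕ} :
    (bucketProg d j).WA y ↔ y = 2 * d + 5 ∨ y = 3 + 2 * j ∨ y = 4 + 2 * j := by
  simp [bucketProg, sortProg_WA, Stmt.WA, forUp_WA, or_assoc]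
theorem bucketProg_WB {d j y : ℕ} : ¬ (bucketProg d j).WB y := by
  simp [bucketProg, sortProg_WB, Stmt.WB, forUp_WB]

theorem bucketProg_runs {W d n S j : ℕ} {s : State} (hW : 2 * n + 2 < W) (hj : j < d)
    (hn : s.ivar 0 = n) (hS : s.ivar 1 = S) :
    Runs W (bucketProg d j) s (600 * ((n + 1) * (n.size + 1))) fun s' =>
      Buckets n S (s.rarr j) (s'.iarr (3 + 2 * j)) (s'.iarr (4 + 2 * j)) := by
  refine Runs.mono (Runs.seq (sortProg_runs hW (show 2 * d + 5 ≠ 3 + 2 * j by omega) hn)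
    fun s₁ hf₁ hQ₁ => Runs.mono (c' := 20 * (n + 1))
      (Q' := fun s' => Buckets n S (s.rarr j) (s'.iarr (3 + 2 * j)) (s'.iarr (4 + 2 * j)))
      (Runs.forUp (c := 7) n (fun k s' => ∀ p < k,
        s'.iarr (4 + 2 * j) (s₁.iarr (3 + 2 * j) p) = p / S) (by omega) (by simp [Stmt.WI])
        ?_ ?_ ?_) ?_ ?_) ?_ fun _ _ h => h
  · exact fun s' hf => (hf.ivar 0 (by simp [forUp_WI, Stmt.WI])).trans
      ((hf₁.ivar 0 (by simp [sortProg_WI])).trans hn)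
  · intro p hp; omega
  · intro k hk s' hf hx hi
    have hS' : s'.ivar 1 = S := (hf.ivar 1 (by simp [forUp_WI, Stmt.WI])).trans
      ((hf₁.ivar 1 (by simp [sortProg_WI])).trans hS)
    have ho' : s'.iarr (3 + 2 * j) = s₁.iarr (3 + 2 * j) :=
      hf.iarr _ (by simp [forUp_WA, Stmt.WA])
    refine (Runs.of_wp ?_).mono (by simp [Stmt.flatCost, IExpr.cost]) fun _ _ h => h
    simp only [Stmt.wp, IExpr.eval, hx, hS', ho', Function.update_self]
    intro p hp
    rcases Nat.lt_succ_iff_lt_or_eq.1 hp with hp | rfl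
    · rw [Function.update_of_ne, hi p hp]
      intro h
      have := hQ₁.inj p (by omega) k hk h
      omega
    · rw [Function.update_self]
  · simp only [IExpr.cost]; omega
  · intro s' hf h
    have ho' : s'.iarr (3 + 2 * j) = s₁.iarr (3 + 2 * j) :=
      hf.iarr _ (by simp [forUp_WA, Stmt.WA])
    rw [ho']
    exact ⟨hQ₁, h⟩
  · nlinarith [Nat.zero_le n.size, Nat.zero_le (n * n.size)]

/-- The contents of a block that holds the data structure. -/
structure Stored (d n S b : ℕ) (α : ℝ) (x : ℕ → ℕ → ℝ) (o β : ℕ → ℕ → ℕ) (col : ℕ → ℕ)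
    (s : State) : Prop extends Tables d n S b α col β (b ^ (2 * d - 1)) s where
  col : ∀ i < n, s.iarr 0 i = col i
  pts : ∀ j < d, ∀ i < n, s.rarr j i = x j i
  ord : ∀ j < d, ∀ i < n, s.iarr (3 + 2 * j) i = o j i
  bucket : ∀ j < d, ∀ i < n, s.iarr (4 + 2 * j) i = β j i
  n : s.iarr 1 0 = n
  S : s.iarr 1 1 = S
  b : s.iarr 1 2 = b
  α : s.rarr (d + 3) 0 = α

/-- The construction program. -/
def buildProg (d : ℕ) : Stmt :=
  .seq (setup d) (.seq (seqN d (bucketProg d)) (tabulate d))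

theorem buildProg_runs {d : ℕ} (hd : 1 ≤ d) : ∃ K : ℕ, ∀ {W n : ℕ} {α t : ℝ} {s : State},
    (n + 3) * (n + 2) ^ (2 * d) < W → t ≤ 1 → s.ivar 0 = n → s.rvar 0 = α → s.rvar 1 = t →
    Runs W (buildProg d) s
      (K * ((n + 1) * (n.size + 1) + keyBase n t ^ (2 * d - 1) * (n + 1))) fun s' =>
      ∃ o β, Params W d n (bucketSize n t) (keyBase n t) s.rarr o β ∧
        Stored d n (bucketSize n t) (keyBase n t) α s.rarr o β (s.iarr 0) s' := by
  obtain ⟨K, hK⟩ := tabulate_runs d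
  refine ⟨d * 600 + 101 + K, fun {W n α t s} hW ht h0 hα h1 => ?_⟩
  have hW2 : 2 * n + 2 < W ∧ n + 3 < W := by
    have : (n + 2) ^ 1 ≤ (n + 2) ^ (2 * d) := Nat.pow_le_pow_right (by omega) (by omega)
    constructor <;> nlinarith
  have hbW : (n + 3) * keyBase n t ^ (2 * d) < W :=
    lt_of_le_of_lt (Nat.mul_le_mul_left _ (Nat.pow_le_pow_left (keyBase_le ht) _)) hW
  refine Runs.mono (Runs.seq (setup_runs hd hW2.2 ht h0 hα h1) fun s₁ hf₁ hQ₁ => Runs.seq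
    (Runs.seqN (c := 600 * ((n + 1) * (n.size + 1)))
      (fun k s' => ∀ j < k, Buckets n (bucketSize n t) (s.rarr j) (s'.iarr (3 + 2 * j))
        (s'.iarr (4 + 2 * j))) ?_ ?_)
    fun s₂ hf₂ hQ₂ => Runs.mono
      (hK (W := W) (n := n) (S := bucketSize n t) (b := keyBase n t) (α := α)
        (x := s₂.rarr) (o := fun j => s₂.iarr (3 + 2 * j)) (β := fun j => s₂.iarr (4 + 2 * j))
        (col := s.iarr 0) ?_ ?_) le_rfl fun s₃ hf₃ hQ₃ => ?_) ?_ fun _ _ h => h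
  · intro j hj; omega
  · intro k hk s' hf hi
    have hn' : s'.ivar 0 = n := (hf.ivar 0 (by simp [seqN_WI, bucketProg_WI])).trans
      ((hf₁.ivar 0 (by simp [setup, forUp_WI, Stmt.WI])).trans h0)
    have hS' : s'.ivar 1 = bucketSize n t :=
      (hf.ivar 1 (by simp [seqN_WI, bucketProg_WI])).trans hQ₁.1
    have hx' : s'.rarr k = s.rarr k := (hf.rarr k (by simp [seqN_WB, bucketProg_WB])).trans
      (hf₁.rarr k (by simp [setup, forUp_WB, Stmt.WB]; omega))
    refine (bucketProg_runs hW2.1 hk hn' hS').mono le_rfl fun s'' hf'' h j hj => ?_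
    rcases Nat.lt_succ_iff_lt_or_eq.1 hj with hj | rfl
    · rw [hf''.iarr (3 + 2 * j) (by rw [bucketProg_WA]; omega),
        hf''.iarr (4 + 2 * j) (by rw [bucketProg_WA]; omega)]
      exact hi j hj
    · rwa [← hx']
  pick_goal 4
  · have h1 : n + 1 ≤ (n + 1) * (n.size + 1) := Nat.le_mul_of_pos_right _ (by omega)
    have h2 : 0 < (n + 1) * (n.size + 1) := by positivity
    generalize (n + 1) * (n.size + 1) = Z at *
    generalize keyBase n t ^ (2 * d - 1) * (n + 1) = Y at *
    nlinarith [Nat.zero_le (d * Y)]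
  all_goals
    have hn₂ : s₂.ivar 0 = n := (hf₂.ivar 0 (by simp [seqN_WI, bucketProg_WI])).trans
      ((hf₁.ivar 0 (by simp [setup, forUp_WI, Stmt.WI])).trans h0)
    have hx₂ : ∀ j < d, s₂.rarr j = s.rarr j := fun j hj =>
      (hf₂.rarr j (by simp [seqN_WB, bucketProg_WB])).trans
        (hf₁.rarr j (by simp [setup, forUp_WB, Stmt.WB]; omega))
    have hc₂ : s₂.iarr 0 = s.iarr 0 :=
      (hf₂.iarr 0 (by simp only [seqN_WA, bucketProg_WA]; omega)).trans
        (hf₁.iarr 0 (by simp [setup, forUp_WA, Stmt.WA]))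
    have hh₂ : s₂.iarr 1 = s₁.iarr 1 :=
      hf₂.iarr 1 (by simp only [seqN_WA, bucketProg_WA]; omega)
    have hp : Params W d n (bucketSize n t) (keyBase n t) s₂.rarr
        (fun j => s₂.iarr (3 + 2 * j)) (fun j => s₂.iarr (4 + 2 * j)) :=
      ⟨hd, two_le_keyBase n t, lt_bucketSize_mul n t, hbW, fun j hj => by
        rw [hx₂ j hj]; exact hQ₂ j hj⟩
  · exact hp
  · exact ⟨hn₂, (hf₂.ivar 1 (by simp [seqN_WI, bucketProg_WI])).trans hQ₁.1,
      (hf₂.ivar 2 (by simp [seqN_WI, bucketProg_WI])).trans hQ₁.2.1,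
      (hf₂.rvar _ (by simp [seqN_WR, bucketProg_WR])).trans hQ₁.2.2.1, hc₂,
      fun _ _ => rfl, fun _ _ => rfl, fun _ _ => rfl⟩
  · have hA : ∀ a < 2 * d + 4, a ≠ 2 → s₃.iarr a = s₂.iarr a := fun a ha ha' =>
      hf₃.iarr a (by simp only [tabulate, forUp_WA, keyBody_WA]; omega)
    have hB : ∀ a, a < d ∨ a = d + 3 → s₃.rarr a = s₂.rarr a := fun a ha =>
      hf₃.rarr a (by simp only [tabulate, forUp_WB, keyBody_WB]; omega)
    refine ⟨fun j => s₂.iarr (3 + 2 * j), fun j => s₂.iarr (4 + 2 * j),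
      ⟨hd, two_le_keyBase n t, lt_bucketSize_mul n t, hbW, hQ₂⟩, hQ₃, ?_, ?_, ?_, ?_, ?_, ?_,
      ?_, ?_⟩
    · intro i _; rw [hA 0 (by omega) (by omega), hc₂]
    · intro j hj i _; rw [hB j (.inl hj), hx₂ j hj]
    · intro j hj i _; rw [hA _ (by omega) (by omega)]
    · intro j hj i _; rw [hA _ (by omega) (by omega)]
    · rw [hA 1 (by omega) (by omega), hh₂]; exact hQ₁.2.2.2.1
    · rw [hA 1 (by omega) (by omega), hh₂]; exact hQ₁.2.2.2.2.1
    · rw [hA 1 (by omega) (by omega), hh₂]; exact hQ₁.2.2.2.2.2.1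
    · rw [hB _ (.inr rfl), hf₂.rarr _ (by simp [seqN_WB, bucketProg_WB])]
      exact hQ₁.2.2.2.2.2.2

end RealRAM

/-! ### Inner boxes and their colour counts -/

theorem mem_bucketBox_digits {d b n i : ℕ} {β : ℕ → ℕ → ℕ} {a : ℕ → ℕ}
    (ha : ∀ q < 2 * d, a q < b) :
    i ∈ bucketBox d b n β (∑ q ∈ Finset.range (2 * d), a q * b ^ q) ↔
      i < n ∧ ∀ j < d, a (2 * j) < β j i ∧ β j i < a (2 * j + 1) := by
  simp only [bucketBox, Finset.mem_filter, Finset.mem_range]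
  refine and_congr_right fun _ => forall₂_congr fun j hj => ?_
  rw [dig_sum_digits ha _ (by omega), dig_sum_digits ha _ (by omega)]

theorem mem_openBox_digits {d b n i : ℕ} {β : ℕ → ℕ → ℕ} {a : ℕ → ℕ}
    (ha : ∀ q < 2 * d - 1, a q < b) :
    i ∈ openBox d b n β (∑ q ∈ Finset.range (2 * d - 1), a q * b ^ q) ↔
      i < n ∧ ∀ j < d, a (2 * j) < β j i ∧ (j + 1 < d → β j i < a (2 * j + 1)) := by
  simp only [openBox, Finset.mem_filter, Finset.mem_range]
  refine and_congr_right fun _ => forall₂_congr fun j hj => ?_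
  rw [dig_sum_digits ha _ (by omega)]
  refine and_congr_right fun _ => forall_congr' fun hj' => ?_
  rw [dig_sum_digits ha _ (by omega)]

/-- The digits of the open box that has to be subtracted: the lower bound in the last coordinate is
replaced by the upper bound less one. -/
def upperDigits (d : ℕ) (a : ℕ → ℕ) : ℕ → ℕ :=
  Function.update a (2 * d - 2) (a (2 * d - 1) - 1)

theorem upperDigits_lt {d b : ℕ} {a : ℕ → ℕ} (hd : 1 ≤ d) (ha : ∀ q < 2 * d, a q < b) :
    ∀ q < 2 * d - 1, upperDigits d a q < b := fun q hq => by
  unfold upperDigits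
  by_cases h : q = 2 * d - 2
  · subst h
    rw [Function.update_self]
    have := ha (2 * d - 1) (by omega)
    omega
  · rw [Function.update_of_ne h]; exact ha q (by omega)

/-- The colour counts of a box are differences of those of two open boxes. The subtraction is
truncated, which gives the right value `0` when the box is empty because its bounds cross. -/
theorem mult_bucketBox {d b n : ℕ} {β : ℕ → ℕ → ℕ} {a : ℕ → ℕ} {col : ℕ → ℕ} (hd : 1 ≤ d)
    (ha : ∀ q < 2 * d, a q < b) (u : ℕ) :
    mult col (bucketBox d b n β (∑ q ∈ Finset.range (2 * d), a q * b ^ q)) u =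
      mult col (openBox d b n β (∑ q ∈ Finset.range (2 * d - 1), a q * b ^ q)) u -
      mult col (openBox d b n β
        (∑ q ∈ Finset.range (2 * d - 1), upperDigits d a q * b ^ q)) u := by
  have ha' := upperDigits_lt hd ha
  have hI := fun i => mem_bucketBox_digits (i := i) (n := n) (β := β) ha
  have hL := fun i => mem_openBox_digits (i := i) (n := n) (β := β)
    (fun q (hq : q < 2 * d - 1) => ha q (by omega))
  have hU := fun i => mem_openBox_digits (i := i) (n := n) (β := β) ha'
  have hu1 : ∀ j, j + 1 < d → upperDigits d a (2 * j) = a (2 * j) ∧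
      upperDigits d a (2 * j + 1) = a (2 * j + 1) := fun j hj =>
    ⟨Function.update_of_ne (by omega) _ _, Function.update_of_ne (by omega) _ _⟩
  have hu2 : upperDigits d a (2 * (d - 1)) = a (2 * d - 1) - 1 := by
    rw [show 2 * (d - 1) = 2 * d - 2 by omega]; exact Function.update_self ..
  -- the condition on all coordinates but the last
  let O : ℕ → Prop := fun i =>
    i < n ∧ ∀ j, j + 1 < d → a (2 * j) < β j i ∧ β j i < a (2 * j + 1)
  have hlast : ∀ {p : ℕ → Prop}, (∀ j < d, p j) ↔ (∀ j, j + 1 < d → p j) ∧ p (d - 1) := by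
    intro p
    refine ⟨fun h => ⟨fun j hj => h j (by omega), h _ (by omega)⟩, fun h j hj => ?_⟩
    by_cases hj' : j + 1 < d
    · exact h.1 j hj'
    · obtain rfl : j = d - 1 := by omega
      exact h.2
  have e1 : 2 * (d - 1) + 1 = 2 * d - 1 := by omega
  replace hI : ∀ i, i ∈ bucketBox d b n β (∑ q ∈ Finset.range (2 * d), a q * b ^ q) ↔
      O i ∧ a (2 * (d - 1)) < β (d - 1) i ∧ β (d - 1) i < a (2 * d - 1) := fun i => by
    rw [hI, hlast, e1, ← and_assoc]
  replace hL : ∀ i, i ∈ openBox d b n β (∑ q ∈ Finset.range (2 * d - 1), a q * b ^ q) ↔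
      O i ∧ a (2 * (d - 1)) < β (d - 1) i := fun i => by
    rw [hL, hlast, ← and_assoc]
    refine and_congr (and_congr_right fun _ => forall₂_congr fun j hj => ?_) ?_
    · simp [hj]
    · rw [and_iff_left]; intro h; omega
  replace hU : ∀ i, i ∈ openBox d b n β
      (∑ q ∈ Finset.range (2 * d - 1), upperDigits d a q * b ^ q) ↔
      O i ∧ a (2 * d - 1) - 1 < β (d - 1) i := fun i => by
    rw [hU, hlast, ← and_assoc, hu2]
    refine and_congr (and_congr_right fun _ => forall₂_congr fun j hj => ?_) ?_
    · simp [hj, hu1 j hj]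
    · rw [and_iff_left]; intro h; omega
  unfold mult
  by_cases hc : a (2 * (d - 1)) ≤ a (2 * d - 1) - 1
  · rw [eq_tsub_iff_add_eq_of_le, ← Finset.card_union_of_disjoint, ← Finset.filter_union]
    · congr 2
      ext i
      rw [Finset.mem_union, hI, hL, hU, ← and_or_left]
      refine and_congr_right fun _ => ?_
      omega
    · rw [Finset.disjoint_left]
      intro i hi hi'
      rw [Finset.mem_filter, hI] at hi
      rw [Finset.mem_filter, hU] at hi'
      omega
    · refine Finset.card_le_card (Finset.filter_subset_filter _ fun i => ?_)
      rw [hL, hU]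
      exact fun h => ⟨h.1, by omega⟩
  · rw [Nat.sub_eq_zero_of_le, Finset.card_eq_zero, Finset.filter_eq_empty_iff]
    · intro i hi
      rw [hI] at hi
      omega
    · refine Finset.card_le_card (Finset.filter_subset_filter _ fun i => ?_)
      rw [hL, hU]
      exact fun h => ⟨h.1, by omega⟩

/-- The points in the closed box whose sides are bounded by `v (2 * j)` and `v (2 * j + 1)`. -/
def InRange (d : ℕ) (x : ℕ → ℕ → ℝ) (v : ℕ → ℝ) (i : ℕ) : Prop :=
  ∀ j < d, v (2 * j) ≤ x j i ∧ x j i ≤ v (2 * j + 1)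

namespace RealRAM

/-! ### Locating the box -/

/-- The order position `p` of coordinate `q / 2` lies below the side `q` of the box: the coordinate
is less than the lower bound (`q` even), or at most the upper bound (`q` odd). -/
def Below (x : ℕ → ℕ → ℝ) (o : ℕ → ℕ → ℕ) (v : ℕ → ℝ) (q p : ℕ) : Prop :=
  if q % 2 = 0 then x (q / 2) (o (q / 2) p) < v q else x (q / 2) (o (q / 2) p) ≤ v q

/-- The test for `Below`; the position is in word variable `12`. -/
def belowTest (q : ℕ) : BExpr :=
  if q % 2 = 0 then .rlt (.read (q / 2) (.read (3 + 2 * (q / 2)) (.var 12))) (.var q)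
  else .not (.rlt (.var q) (.read (q / 2) (.read (3 + 2 * (q / 2)) (.var 12))))

/-- Binary search for the bucket in which side `q` of the box lies, into word variable `20 + q`. -/
def locate (q : ℕ) : Stmt :=
  .seq (.seq (.iset 10 (.const 0)) (.iset 11 (.var 0)))
    (.seq (.loop (.ilt (.var 10) (.var 11))
        (.seq (.iset 12 (.div (.add (.var 10) (.var 11)) (.const 2)))
          (.cond (belowTest q) (.iset 10 (.add (.var 12) (.const 1))) (.iset 11 (.var 12)))))
      (.iset (20 + q) (.div (.var 10) (.var 1))))

theorem locate_WI {q y : ℕ} : (locate q).WI y ↔ y = 10 ∨ y = 11 ∨ y = 12 ∨ y = 20 + q := by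
  simp [locate, Stmt.WI]; omega
theorem locate_WR {q y : ℕ} : ¬ (locate q).WR y := by simp [locate, Stmt.WR]
theorem locate_WA {q y : ℕ} : ¬ (locate q).WA y := by simp [locate, Stmt.WA]
theorem locate_WB {q y : ℕ} : ¬ (locate q).WB y := by simp [locate, Stmt.WB]

theorem locate_runs {W d n S b q : ℕ} {α : ℝ} {x : ℕ → ℕ → ℝ} {o β : ℕ → ℕ → ℕ} {col : ℕ → ℕ}
    {s : State} (hp : Params W d n S b x o β) (hW : 2 * n + 2 < W)
    (hh : Holds d n S b α x o β col s) (hq : q < 2 * d) :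
    Runs W (locate q) s (50 * (n.size + 1)) fun s' => ∃ L ≤ n, s'.ivar (20 + q) = L / S ∧
      ∀ p < n, p < L ↔ Below x o s.rvar q p := by
  have h1 : 1 % W = 1 := Nat.mod_eq_of_lt (by omega)
  have h2 : 2 % W = 2 := Nat.mod_eq_of_lt (by omega)
  have hB := hp.buckets (q / 2) (by omega)
  have hanti : ∀ p p', p ≤ p' → p' < n → Below x o s.rvar q p' → Below x o s.rvar q p := by
    intro p p' h h'
    have := hB.mono p p' h h'
    unfold Below
    split_ifs <;> intro <;> linarith
  let I : State → Prop := fun s' => s'.ivar 10 ≤ s'.ivar 11 ∧ s'.ivar 11 ≤ n ∧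
    (∀ p < s'.ivar 10, Below x o s.rvar q p) ∧
    (∀ p, s'.ivar 11 ≤ p → p < n → ¬ Below x o s.rvar q p)
  have htc : (belowTest q).cost ≤ 6 := by
    unfold belowTest
    split_ifs <;> simp [BExpr.cost, RExpr.cost, IExpr.cost]
  refine Runs.mono (Runs.seq (Q := fun s' => s'.ivar 11 = n ∧ I s') (Runs.of_wp ?_)
    fun s₁ hf₁ hQ₁ => Runs.seq
      (Q := fun s' => ¬ (BExpr.ilt (.var 10) (.var 11)).Holds W s' ∧ I s')
      (c₁ := (26 + (BExpr.ilt (.var 10) (.var 11)).cost + 1) * (n.size + 1))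
      ((Runs.loop_halving (c := 26) (fun s' => s'.ivar 11 - s'.ivar 10) I
        ?_ hQ₁.2).mono ?_ fun _ _ h => h) fun s₂ hf₂ hQ₂ => Runs.of_wp ?_) ?_ fun _ _ h => h
  · simp only [Stmt.wp, IExpr.eval, Nat.zero_mod, I]
    simp only [Function.update_self, Function.update_of_ne (show (0 : ℕ) ≠ 10 by omega),
      Function.update_of_ne (show (10 : ℕ) ≠ 11 by omega), hh.n]
    exact ⟨trivial, by omega, le_rfl, by omega, by omega⟩
  · rintro s' hf ⟨hi1, hi2, hi3, hi4⟩ hb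
    have hf' : Frame (locate q) s s' := hf₁.seq_left.trans hf.seq_left.seq_right
    simp only [BExpr.Holds, IExpr.eval] at hb
    have hmid : (s'.ivar 10 + s'.ivar 11) % W = s'.ivar 10 + s'.ivar 11 :=
      Nat.mod_eq_of_lt (by omega)
    have htest : ∀ s'' : State, s''.rvar = s'.rvar → s''.iarr = s'.iarr → s''.rarr = s'.rarr →
        ((belowTest q).Holds W s'' ↔ Below x o s.rvar q (s''.ivar 12)) := by
      intro s'' hs1 hs2 hs3
      have ho : s''.iarr (3 + 2 * (q / 2)) = o (q / 2) := by
        rw [hs2, hf'.iarr _ locate_WA, hh.ord _ (by omega)]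
      have hx : s''.rarr (q / 2) = x (q / 2) := by
        rw [hs3, hf'.rarr _ locate_WB, hh.pts _ (by omega)]
      have hv : s''.rvar q = s.rvar q := by rw [hs1, hf'.rvar _ locate_WR]
      unfold belowTest Below
      split_ifs <;> simp [BExpr.Holds, RExpr.eval, IExpr.eval, ho, hx, hv]
    refine ⟨by omega, (Runs.of_wp ?_).mono ?_ fun _ _ h => h⟩
    · simp only [Stmt.wp, IExpr.eval, h1, h2, hmid]
      rw [htest { s' with ivar := Function.update s'.ivar 12 ((s'.ivar 10 + s'.ivar 11) / 2) }
        rfl rfl rfl]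
      simp only [Function.update_self, I]
      set m := (s'.ivar 10 + s'.ivar 11) / 2 with hm
      have e1 : (m + 1) % W = m + 1 := Nat.mod_eq_of_lt (by omega)
      simp only [e1, Function.update_of_ne (show (10 : ℕ) ≠ 12 by omega),
        Function.update_of_ne (show (11 : ℕ) ≠ 12 by omega),
        Function.update_of_ne (show (11 : ℕ) ≠ 10 by omega),
        Function.update_of_ne (show (10 : ℕ) ≠ 11 by omega)]
      constructor
      · intro hbel
        exact ⟨by omega, by omega, hi2, fun p hp => hanti p m (by omega) (by omega) hbel, hi4⟩
      · intro hbel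
        refine ⟨by omega, by omega, by omega, hi3, fun p hp hpn hbel' => hbel ?_⟩
        exact hanti m p hp hpn hbel'
    · simp only [Stmt.flatCost, IExpr.cost]; omega
  · have : (s₁.ivar 11 - s₁.ivar 10).size ≤ n.size :=
      Nat.size_le_size (by rw [hQ₁.1]; omega)
    exact Nat.mul_le_mul_left _ (by omega)
  · obtain ⟨hb, hi1, hi2, hi3, hi4⟩ := hQ₂
    simp only [BExpr.Holds, IExpr.eval] at hb
    have hS : s₂.ivar 1 = S := by
      rw [hf₂.ivar 1 (by simp [Stmt.WI]), hf₁.ivar 1 (by simp [Stmt.WI]), hh.S]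
    simp only [Stmt.wp, IExpr.eval, hS, Function.update_self]
    refine ⟨s₂.ivar 10, by omega, rfl, fun p hp => ⟨hi3 p, fun h => ?_⟩⟩
    by_contra hc
    exact hi4 p (by omega) hp h
  · simp only [Stmt.flatCost, IExpr.cost, BExpr.cost]
    omega

/-- The bucket numbers `a q` of the sides of the box: points in buckets strictly between them are
in the range, and points in the range are in buckets between them, the ends included. -/
structure Located (d n S : ℕ) (x : ℕ → ℕ → ℝ) (β : ℕ → ℕ → ℕ) (v : ℕ → ℝ) (a : ℕ → ℕ) :
    Prop where
  le : ∀ q < 2 * d, a q ≤ n / S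
  inner : ∀ i < n, (∀ j < d, a (2 * j) < β j i ∧ β j i < a (2 * j + 1)) → InRange d x v i
  outer : ∀ i < n, InRange d x v i → ∀ j < d, a (2 * j) ≤ β j i ∧ β j i ≤ a (2 * j + 1)

theorem located_of_below {W d n S b : ℕ} {x : ℕ → ℕ → ℝ} {o β : ℕ → ℕ → ℕ} {v : ℕ → ℝ}
    {a : ℕ → ℕ} (hp : Params W d n S b x o β)
    (h : ∀ q < 2 * d, ∃ L ≤ n, a q = L / S ∧ ∀ p < n, p < L ↔ Below x o v q p) :
    Located d n S x β v a := by
  have key : ∀ j < d, ∀ i < n, (a (2 * j) < β j i → v (2 * j) ≤ x j i) ∧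
      (v (2 * j) ≤ x j i → a (2 * j) ≤ β j i) ∧ (β j i < a (2 * j + 1) → x j i ≤ v (2 * j + 1)) ∧
      (x j i ≤ v (2 * j + 1) → β j i ≤ a (2 * j + 1)) := by
    intro j hj i hi
    obtain ⟨L, hL, haL, hbL⟩ := h (2 * j) (by omega)
    obtain ⟨R, hR, haR, hbR⟩ := h (2 * j + 1) (by omega)
    obtain ⟨p, hpn, rfl⟩ := (hp.buckets j hj).surj hi
    have h1 := hbL p hpn
    have h2 := hbR p hpn
    simp only [Below, show 2 * j % 2 = 0 by omega, show (2 * j + 1) % 2 = 1 by omega, if_true,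
      show 2 * j / 2 = j by omega, show (2 * j + 1) / 2 = j by omega, one_ne_zero,
      if_false] at h1 h2
    rw [(hp.buckets j hj).bucket p hpn, haL, haR, ← not_lt (b := v (2 * j)), ← h1, ← h2, not_lt]
    refine ⟨fun h => ?_, fun h => Nat.div_le_div_right h, fun h => ?_,
      fun h => Nat.div_le_div_right h.le⟩
    · by_contra hc
      exact absurd (Nat.div_le_div_right (c := S) (not_le.1 hc).le) (not_le.2 h)
    · by_contra hc
      exact absurd (Nat.div_le_div_right (c := S) (not_lt.1 hc)) (not_le.2 h)
  refine ⟨fun q hq => ?_, fun i hi hin j hj => ?_, fun i hi hin j hj => ?_⟩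
  · obtain ⟨L, hL, haL, -⟩ := h q hq
    rw [haL]
    exact Nat.div_le_div_right hL
  · obtain ⟨h1, -, h2, -⟩ := key j hj i hi
    exact ⟨h1 (hin j hj).1, h2 (hin j hj).2⟩
  · obtain ⟨-, h1, -, h2⟩ := key j hj i hi
    exact ⟨h1 (hin j hj).1, h2 (hin j hj).2⟩

/-! ### Scanning the boundary buckets -/

/-- Run `body` for the points in the buckets of the `2 * d` sides of the box, with the number of
the point in word variable `5`. A point may be visited several times. -/
def scan (d : ℕ) (body : Stmt) : Stmt :=
  seqN (2 * d) fun q => forUp 4 (.var 1)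
    (.seq (.iset 7 (.add (.mul (.var (20 + q)) (.var 1)) (.var 4)))
      (.cond (.ilt (.var 7) (.var 0))
        (.seq (.iset 5 (.read (3 + 2 * (q / 2)) (.var 7))) body) .skip))

theorem scan_WI {d y : ℕ} {body : Stmt} (h : (scan d body).WI y) :
    y = 4 ∨ y = 5 ∨ y = 7 ∨ body.WI y := by
  simp only [scan, seqN_WI, forUp_WI, Stmt.WI] at h
  tauto
theorem scan_WR {d y : ℕ} {body : Stmt} (h : (scan d body).WR y) : body.WR y := by
  simp only [scan, seqN_WR, forUp_WR, Stmt.WR] at h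
  tauto
theorem scan_WA {d y : ℕ} {body : Stmt} (h : (scan d body).WA y) : body.WA y := by
  simp only [scan, seqN_WA, forUp_WA, Stmt.WA] at h
  tauto
theorem scan_WB {d y : ℕ} {body : Stmt} (h : (scan d body).WB y) : body.WB y := by
  simp only [scan, seqN_WB, forUp_WB, Stmt.WB] at h
  tauto

/-- The points that a scan visits. -/
def boundaryPoints (d n : ℕ) (β : ℕ → ℕ → ℕ) (a : ℕ → ℕ) : Finset ℕ :=
  (Finset.range n).filter fun i => ∃ q < 2 * d, β (q / 2) i = a q

/-- Rule for scans. The invariant speaks of the set of points visited so far. -/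
theorem scan_runs {W d n S b c : ℕ} {α : ℝ} {x : ℕ → ℕ → ℝ} {o β : ℕ → ℕ → ℕ} {col a : ℕ → ℕ}
    {body : Stmt} {s : State} (hp : Params W d n S b x o β) (hW : 2 * n + 2 < W)
    (hSn : S ≤ n + 1) (hh : Holds d n S b α x o β col s)
    (ha : ∀ q < 2 * d, s.ivar (20 + q) = a q) (han : ∀ q < 2 * d, a q ≤ n / S)
    (hbI : ∀ y, body.WI y → y = 6) (hbR : ¬ body.WR (2 * d + 3))
    (hbA : ∀ y, body.WA y → 2 * d + 4 ≤ y) (hbB : ∀ y, ¬ body.WB y)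
    (Inv : Finset ℕ → State → Prop)
    (hI : ∀ D s₁ s₂, s₁.rvar = s₂.rvar → s₁.iarr = s₂.iarr → Inv D s₁ → Inv D s₂)
    (h0 : Inv ∅ s)
    (hs : ∀ D i s', D ⊆ boundaryPoints d n β a → i ∈ boundaryPoints d n β a →
      Frame (scan d body) s s' → Holds d n S b α x o β col s' → s'.ivar 5 = i → Inv D s' →
      Runs W body s' c (Inv (insert i D))) :
    Runs W (scan d body) s ((2 * d + 1) * ((S + 1) * (c + 30)))
      (Inv (boundaryPoints d n β a)) := by
  have hS := hp.S_pos
  have hH : ∀ s', Frame (scan d body) s s' → Holds d n S b α x o β col s' := fun s' hf => by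
    refine hh.of_frame hf (fun y hy h => ?_) (fun h => hbR (scan_WR h)) (fun y hy _ h => ?_)
      fun y _ h => hbB y (scan_WB h)
    · rcases scan_WI h with h | h | h | h
      · omega
      · omega
      · omega
      · have := hbI y h; omega
    · have := hbA y (scan_WA h); omega
  have ha' : ∀ s', Frame (scan d body) s s' → ∀ q < 2 * d, s'.ivar (20 + q) = a q :=
    fun s' hf q hq => by
      rw [hf.ivar _ fun h => ?_, ha q hq]
      rcases scan_WI h with h | h | h | h
      · omega
      · omega
      · omega
      · have := hbI _ h; omega
  refine Runs.mono (Runs.seqN (c := (S + 1) * (c + 29)) (fun k s' => ∃ D ⊆ boundaryPoints d n β a,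
    Inv D s' ∧ ∀ i < n, ∀ q < k, β (q / 2) i = a q → i ∈ D)
    ⟨∅, Finset.empty_subset _, h0, by omega⟩ ?_) ?_ ?_
  · rintro q hq s' hf ⟨D₀, hD₀, hi₀, hc₀⟩
    have hB := hp.buckets (q / 2) (by omega)
    have haS : a q * S ≤ n := (Nat.le_div_iff_mul_le hS).1 (han q hq)
    refine Runs.mono (Runs.forUp (c := c + 18) S (fun k s' => ∃ D ⊆ boundaryPoints d n β a,
      Inv D s' ∧ (∀ i < n, ∀ q' < q, β (q' / 2) i = a q' → i ∈ D) ∧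
      ∀ p < n, a q * S ≤ p → p < a q * S + k → o (q / 2) p ∈ D) (by omega) ?_ ?_ ?_ ?_)
      (by simp [IExpr.cost]) ?_
    · simp only [Stmt.WI]
      intro h
      have := hbI 4
      tauto
    all_goals
      have hfq : ∀ s'', Frame (forUp 4 (.var 1)
          (.seq (.iset 7 (.add (.mul (.var (20 + q)) (.var 1)) (.var 4)))
            (.cond (.ilt (.var 7) (.var 0))
              (.seq (.iset 5 (.read (3 + 2 * (q / 2)) (.var 7))) body) .skip))) s' s'' →
          Frame (scan d body) s s'' := fun s'' h => hf.trans (h.mono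
        (fun y h => seqN_WI.2 ⟨q, hq, h⟩) (fun y h => seqN_WR.2 ⟨q, hq, h⟩)
        (fun y h => seqN_WA.2 ⟨q, hq, h⟩) (fun y h => seqN_WB.2 ⟨q, hq, h⟩))
    · exact fun s'' hf'' => (hH s'' (hfq s'' hf'')).S
    · exact ⟨D₀, hD₀, hI D₀ s' _ rfl rfl hi₀, hc₀, by intros; omega⟩
    · rintro k hk s'' hf'' hx ⟨D, hD, hi, hc1, hc2⟩
      have hf3 := hfq s'' hf''
      have hh'' := hH s'' hf3
      have e1 : a q * S % W = a q * S := Nat.mod_eq_of_lt (by omega)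
      have e2 : (a q * S + k) % W = a q * S + k := Nat.mod_eq_of_lt (by omega)
      refine Runs.mono (c := 6 + ((BExpr.ilt (.var 7) (.var 0)).cost + 1 + (3 + c)))
        (Runs.seq (Q := fun s₁ => s₁.ivar 7 = a q * S + k ∧ s₁.ivar 0 = n ∧
          s₁.rvar = s''.rvar ∧ s₁.iarr = s''.iarr) (Runs.of_wp ?_)
          fun s₁ hf₁ hQ₁ => Runs.cond (fun hb => Runs.wp_seq (c := c) ?_) fun hb => ?_)
        (by simp only [BExpr.cost, IExpr.cost]; omega) fun _ _ h => h
      · simp only [Stmt.wp, IExpr.eval, hx, hh''.S, hh''.n, ha' s'' hf3 q hq, e1, e2,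
          Function.update_self, Function.update_of_ne (show (0 : ℕ) ≠ 7 by omega), and_self]
      all_goals
        obtain ⟨h7, h0', hrv, hia⟩ := hQ₁
        simp only [BExpr.Holds, IExpr.eval, h7, h0'] at hb
      · have hord : s₁.iarr (3 + 2 * (q / 2)) = o (q / 2) := by
          rw [hia]; exact hh''.ord _ (by omega)
        simp only [Stmt.wp, IExpr.eval, h7, hord]
        have hlt := hB.lt _ hb
        have hbk : β (q / 2) (o (q / 2) (a q * S + k)) = a q := by
          rw [hB.bucket _ hb, mul_comm, Nat.mul_add_div hS, Nat.div_eq_of_lt hk, add_zero]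
        have hmem : o (q / 2) (a q * S + k) ∈ boundaryPoints d n β a :=
          Finset.mem_filter.2 ⟨Finset.mem_range.2 hlt, q, hq, hbk⟩
        have hf4 : Frame (scan d body) s₁
            { s₁ with ivar := Function.update s₁.ivar 5 (o (q / 2) (a q * S + k)) } := by
          refine ⟨fun y hy => Function.update_of_ne ?_ _ _, fun _ _ => rfl, fun _ _ => rfl,
            fun _ _ => rfl⟩
          rintro rfl
          exact hy (seqN_WI.2 ⟨q, hq, by simp [forUp_WI, Stmt.WI]⟩)
        have hf5 : Frame (scan d body) s s₁ := hf3.trans (hf₁.mono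
          (fun y h => seqN_WI.2 ⟨q, hq, by
            simp only [Stmt.WI] at h; simp [forUp_WI, Stmt.WI, h]⟩)
          (fun y h => by simp [Stmt.WR] at h) (fun y h => by simp [Stmt.WA] at h)
          (fun y h => by simp [Stmt.WB] at h))
        refine (hs D _ _ hD hmem (hf5.trans hf4) (hH _ (hf5.trans hf4)) (by simp)
          (hI D s'' _ hrv.symm hia.symm hi)).mono le_rfl fun s₂ _ h2 =>
          ⟨insert (o (q / 2) (a q * S + k)) D, Finset.insert_subset hmem hD,
            hI _ s₂ _ rfl rfl h2, fun i hi q' hq' h => Finset.mem_insert_of_mem (hc1 i hi q' hq' h),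
            fun p hp hp1 hp2 => ?_⟩
        rcases eq_or_ne p (a q * S + k) with rfl | hne
        · exact Finset.mem_insert_self _ _
        · exact Finset.mem_insert_of_mem (hc2 p hp hp1 (by omega))
      · refine Runs.mono (Runs.of_wp (p := .skip) (Q := fun s₂ => s₂ = s₁) rfl)
          (by simp only [Stmt.flatCost]; omega) ?_
        rintro s₂ - rfl
        exact ⟨D, hD, hI D s'' _ hrv.symm hia.symm hi, hc1, fun p hp hp1 hp2 =>
          hc2 p hp hp1 (by omega)⟩
    · rintro s'' - ⟨D, hD, hi, hc1, hc2⟩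
      refine ⟨D, hD, hi, fun i hin q' hq' h => ?_⟩
      rcases Nat.lt_succ_iff_lt_or_eq.1 hq' with hq' | rfl
      · exact hc1 i hin q' hq' h
      · obtain ⟨p, hpn, rfl⟩ := hB.surj hin
        rw [hB.bucket p hpn] at h
        have h3 := Nat.div_add_mod p S
        have h4 := Nat.mod_lt p hS
        rw [h, mul_comm] at h3
        exact hc2 p hpn (by omega) (by omega)
  · have : 1 ≤ (S + 1) * (c + 30) := Nat.mul_pos (by omega) (by omega)
    have h2 : (S + 1) * (c + 29) ≤ (S + 1) * (c + 30) := Nat.mul_le_mul_left _ (by omega)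
    have h3 := Nat.mul_le_mul_left (2 * d) h2
    rw [add_mul (2 * d)]
    omega
  · rintro s' - ⟨D, hD, hi, hc⟩
    have : D = boundaryPoints d n β a := by
      refine hD.antisymm fun i hi => ?_
      obtain ⟨h1, q, hq, h⟩ := Finset.mem_filter.1 hi
      exact hc i (Finset.mem_range.1 h1) q hq h
    rwa [← this]

/-! ### The query program -/

/-- The number with the digits `f 0, …, f (m - 1)` in the base in word variable `2`. -/
def keyE (m : ℕ) (f : ℕ → IExpr) : IExpr := sumE m fun q => .mul (f q) (powE (.var 2) q)

theorem keyE_eval {W m b : ℕ} {f : ℕ → IExpr} {s : State} {a : ℕ → ℕ} (hW1 : 1 < W) (hb : 1 ≤ b)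
    (hW : b ^ m < W) (h2 : s.ivar 2 = b) (hf : ∀ q < m, (f q).eval W s = a q)
    (ha : ∀ q < m, a q < b) :
    (keyE m f).eval W s = ∑ q ∈ Finset.range m, a q * b ^ q := by
  have hlt := sum_digits_lt ha
  refine sumE_eval (fun q hq => ?_) (hlt.trans hW)
  have h1 : b ^ q ≤ b ^ m := Nat.pow_le_pow_right hb hq.le
  have h3 : a q * b ^ q ≤ ∑ q ∈ Finset.range m, a q * b ^ q :=
    Finset.single_le_sum (f := fun q => a q * b ^ q) (fun _ _ => Nat.zero_le _)
      (Finset.mem_range.2 hq)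
  simp only [IExpr.eval, hf q hq]
  rw [powE_eval (v := b) (by simpa [IExpr.eval] using h2) hW1 hb (by omega),
    Nat.mod_eq_of_lt (by omega)]

/-- Load the parameters from the block. -/
def load (d : ℕ) : Stmt :=
  .seq (.seq (.iset 0 (.read 1 (.const 0))) (.seq (.iset 1 (.read 1 (.const 1)))
    (.iset 2 (.read 1 (.const 2))))) (.rset (2 * d + 3) (.read (d + 3) (.const 0)))

/-- Compute the keys of the inner box (word variable `8`) and of the two open boxes whose colour
counts have to be subtracted (`13` and `14`), and load the statistics of the inner box. -/
def prepare (d : ℕ) : Stmt :=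
  .seq (.iset 8 (keyE (2 * d) fun q => .var (20 + q)))
    (.seq (.iset 13 (keyE (2 * d - 1) fun q => .var (20 + q)))
      (.seq (.iset 14 (keyE (2 * d - 1) fun q =>
          if q = 2 * d - 2 then .sub (.var (20 + (2 * d - 1))) (.const 1) else .var (20 + q)))
        (seqN 3 fun k => .rset (2 * d + k) (.read (d + k) (.var 8)))))

theorem prepare_runs {W d n S b : ℕ} {α : ℝ} {x : ℕ → ℕ → ℝ} {o β : ℕ → ℕ → ℕ} {col a : ℕ → ℕ}
    {s : State} (hp : Params W d n S b x o β) (hh : Holds d n S b α x o β col s)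
    (ht : Tables d n S b α col β (b ^ (2 * d - 1)) s)
    (ha : ∀ q < 2 * d, s.ivar (20 + q) = a q) (han : ∀ q < 2 * d, a q ≤ n / S) :
    Runs W (prepare d) s (prepare d).flatCost fun s' =>
      s'.ivar 8 = ∑ q ∈ Finset.range (2 * d), a q * b ^ q ∧
      s'.ivar 13 = ∑ q ∈ Finset.range (2 * d - 1), a q * b ^ q ∧
      s'.ivar 14 = ∑ q ∈ Finset.range (2 * d - 1), upperDigits d a q * b ^ q ∧
      ∀ k < 3, s'.rvar (2 * d + k) =
        stat α col k (bucketBox d b n β (∑ q ∈ Finset.range (2 * d), a q * b ^ q)) := by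
  have hd := hp.hd
  have hb := hp.hb
  have hW := hp.lt_W
  have hdiv := hp.div_lt le_rfl
  have hab : ∀ q < 2 * d, a q < b := fun q hq => by have := han q hq; omega
  have hub := upperDigits_lt hd hab
  have e1 : ∀ s' : State, s'.ivar 2 = b → (∀ q < 2 * d, s'.ivar (20 + q) = a q) →
      (keyE (2 * d) fun q => .var (20 + q)).eval W s' =
        ∑ q ∈ Finset.range (2 * d), a q * b ^ q := fun s' h2 ha' =>
    keyE_eval (by omega) (by omega) (hp.pow_lt le_rfl) h2 (fun q hq => ha' q hq) hab
  have e2 : ∀ s' : State, s'.ivar 2 = b → (∀ q < 2 * d, s'.ivar (20 + q) = a q) →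
      (keyE (2 * d - 1) fun q => .var (20 + q)).eval W s' =
        ∑ q ∈ Finset.range (2 * d - 1), a q * b ^ q := fun s' h2 ha' =>
    keyE_eval (by omega) (by omega) (hp.pow_lt (by omega)) h2 (fun q hq => ha' q (by omega))
      fun q hq => hab q (by omega)
  have e3 : ∀ s' : State, s'.ivar 2 = b → (∀ q < 2 * d, s'.ivar (20 + q) = a q) →
      (keyE (2 * d - 1) fun q =>
        if q = 2 * d - 2 then .sub (.var (20 + (2 * d - 1))) (.const 1)
        else .var (20 + q)).eval W s' =
        ∑ q ∈ Finset.range (2 * d - 1), upperDigits d a q * b ^ q := fun s' h2 ha' => by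
    refine keyE_eval (by omega) (by omega) (hp.pow_lt (by omega)) h2 (fun q hq => ?_) hub
    unfold upperDigits
    split_ifs with h
    · subst h
      rw [Function.update_self]
      simp only [IExpr.eval, ha' (2 * d - 1) (by omega), Nat.mod_eq_of_lt (show 1 < W by omega)]
    · rw [Function.update_of_ne h]; exact ha' q (by omega)
  have hstat : ∀ k < 3, s.rarr (d + k) (∑ q ∈ Finset.range (2 * d), a q * b ^ q) =
      stat α col k (bucketBox d b n β (∑ q ∈ Finset.range (2 * d), a q * b ^ q)) := by
    intro k hk
    have hkey : ∑ q ∈ Finset.range (2 * d - 1), a q * b ^ q < b ^ (2 * d - 1) :=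
      sum_digits_lt fun q hq => hab q (by omega)
    have := ht.stat k hk _ hkey (a (2 * d - 1)) (han _ (by omega))
    rw [← bucketBox_eq_filter hd (by omega) hkey (hab _ (by omega))] at this
    have e : ∑ q ∈ Finset.range (2 * d), a q * b ^ q =
        ∑ q ∈ Finset.range (2 * d - 1), a q * b ^ q + b ^ (2 * d - 1) * a (2 * d - 1) := by
      conv_lhs => rw [show 2 * d = 2 * d - 1 + 1 by omega, Finset.sum_range_succ]
      rw [mul_comm (a _)]
    rw [e]
    exact this
  refine Runs.of_wp ?_
  have hne : ∀ q, 20 + q ≠ 8 ∧ 20 + q ≠ 13 := fun q => by omega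
  simp only [prepare, Stmt.wp]
  rw [e1 s hh.b ha, e2 _ (by simp [hh.b])
      (fun q hq => by simp only [Function.update_of_ne (hne q).1]; exact ha q hq),
    e3 _ (by simp [hh.b])
      (fun q hq => by
        simp only [Function.update_of_ne (hne q).1, Function.update_of_ne (hne q).2]
        exact ha q hq)]
  simp only [seqN, Stmt.wp, RExpr.eval, IExpr.eval]
  refine ⟨by simp, by simp, by simp, fun k hk => ?_⟩
  rw [← hstat k hk]
  interval_cases k <;> simp

/-- Initialize the mark and the colour count for a boundary point. -/
def resetBody (d : ℕ) : Stmt :=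
  .seq (.iwrite (2 * d + 6) (.var 5) (.const 0))
    (.iwrite (2 * d + 4) (.read 0 (.var 5))
      (.sub (.read 2 (.add (.mul (.var 13) (.var 0)) (.var 5)))
        (.read 2 (.add (.mul (.var 14) (.var 0)) (.var 5)))))

/-- The test that the point in word variable `5` lies in the query box. -/
def rangeTest (d : ℕ) : BExpr :=
  allB d fun j => .and (.not (.rlt (.read j (.var 5)) (.var (2 * j))))
    (.not (.rlt (.var (2 * j + 1)) (.read j (.var 5))))

/-- Insert a boundary point, unless it is marked, outside the query box, or in the inner box. -/
def visitBody (d : ℕ) : Stmt :=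
  .cond (.and (rangeTest d)
      (.and (.ilt (.read (2 * d + 6) (.var 5)) (.const 1)) (.not (inBoxTest d))))
    (.seq (insertProg d) (.iwrite (2 * d + 6) (.var 5) (.const 1))) .skip

theorem visitBody_WI {d y : ℕ} : (visitBody d).WI y ↔ y = 6 := by
  simp [visitBody, Stmt.WI, insertProg_WI]
theorem visitBody_WR {d y : ℕ} :
    (visitBody d).WR y ↔ y = 2 * d ∨ y = 2 * d + 1 ∨ y = 2 * d + 2 := by
  simp [visitBody, Stmt.WR, insertProg_WR]
theorem visitBody_WA {d y : ℕ} : (visitBody d).WA y ↔ y = 2 * d + 4 ∨ y = 2 * d + 6 := by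
  simp [visitBody, Stmt.WA, insertProg_WA]
theorem visitBody_WB {d y : ℕ} : ¬ (visitBody d).WB y := by
  simp [visitBody, Stmt.WB, insertProg_WB]

/-- The first scan. A colour count may be written several times, always with the same value, since
it depends on the colour only. -/
theorem scan_reset_runs {W d n S b : ℕ} {α : ℝ} {x : ℕ → ℕ → ℝ} {o β : ℕ → ℕ → ℕ}
    {col a : ℕ → ℕ} {s : State} (hp : Params W d n S b x o β) (hW : 2 * n + 2 < W)
    (hSn : S ≤ n + 1) (hh : Holds d n S b α x o β col s)
    (ht : Tables d n S b α col β (b ^ (2 * d - 1)) s)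
    (ha : ∀ q < 2 * d, s.ivar (20 + q) = a q) (han : ∀ q < 2 * d, a q ≤ n / S)
    (h13 : s.ivar 13 = ∑ q ∈ Finset.range (2 * d - 1), a q * b ^ q)
    (h14 : s.ivar 14 = ∑ q ∈ Finset.range (2 * d - 1), upperDigits d a q * b ^ q) :
    Runs W (scan d (resetBody d)) s ((2 * d + 1) * ((S + 1) * ((resetBody d).flatCost + 30)))
      fun s' => ∀ i ∈ boundaryPoints d n β a, s'.iarr (2 * d + 6) i = 0 ∧
        s'.iarr (2 * d + 4) (col i) = mult col
          (bucketBox d b n β (∑ q ∈ Finset.range (2 * d), a q * b ^ q)) (col i) := by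
  have hd := hp.hd
  have hdiv := hp.div_lt le_rfl
  have hPn := hp.mul_pow_lt
  have hab : ∀ q < 2 * d, a q < b := fun q hq => by have := han q hq; omega
  have hub := upperDigits_lt hd hab
  refine scan_runs hp hW hSn hh ha han (fun y h => ?_) ?_ (fun y h => ?_) (fun y h => ?_)
    (fun D s' => ∀ i ∈ D, s'.iarr (2 * d + 6) i = 0 ∧ s'.iarr (2 * d + 4) (col i) = mult col
          (bucketBox d b n β (∑ q ∈ Finset.range (2 * d), a q * b ^ q)) (col i)) ?_ ?_ ?_
  · simp [resetBody, Stmt.WI] at h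
  · simp [resetBody, Stmt.WR]
  · simp [resetBody, Stmt.WA] at h; omega
  · simp [resetBody, Stmt.WB] at h
  · intro D s₁ s₂ _ h h'
    rwa [← h]
  · simp
  · intro D i s' hD hi hf hh' h5 hinv
    have hin : i < n := Finset.mem_range.1 (Finset.mem_filter.1 hi).1
    have h13' : s'.ivar 13 = s.ivar 13 := hf.ivar 13 fun h => by
      have := scan_WI h
      simp [resetBody, Stmt.WI] at this
    have h14' : s'.ivar 14 = s.ivar 14 := hf.ivar 14 fun h => by
      have := scan_WI h
      simp [resetBody, Stmt.WI] at this
    have h2' : s'.iarr 2 = s.iarr 2 := hf.iarr 2 fun h => by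
      have := scan_WA h
      simp [resetBody, Stmt.WA] at this
    have hmod : ∀ key < b ^ (2 * d - 1), (key * n % W + i) % W = key * n + i := by
      intro key hk
      have : (key + 1) * n ≤ b ^ (2 * d - 1) * n := Nat.mul_le_mul_right _ hk
      rw [Nat.mod_eq_of_lt (a := key * n) (by nlinarith), Nat.mod_eq_of_lt (by nlinarith)]
    have hk1 := sum_digits_lt (b := b) (m := 2 * d - 1) fun q hq => hab q (by omega)
    have hk2 := sum_digits_lt hub
    refine Runs.of_wp ?_
    simp only [resetBody, Stmt.wp, IExpr.eval, h5, h13', h14', h13, h14, hh'.n,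
      Function.update_of_ne (show (0 : ℕ) ≠ 2 * d + 6 by omega),
      Function.update_of_ne (show (2 : ℕ) ≠ 2 * d + 6 by omega), hh'.col, h2', hmod _ hk1,
      hmod _ hk2, ht.count _ hk1 i hin, ht.count _ hk2 i hin, ← mult_bucketBox hd hab,
      Function.update_of_ne (show 2 * d + 6 ≠ 2 * d + 4 by omega),
      Function.update_of_ne (show 2 * d + 4 ≠ 2 * d + 6 by omega), Function.update_self]
    intro i' hi'
    constructor
    · by_cases h : i' = i
      · subst h; simp
      · rw [Function.update_of_ne h]
        exact (hinv i' (Finset.mem_of_mem_insert_of_ne hi' h)).1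
    · by_cases h : col i' = col i
      · rw [h, Function.update_self]
      · rw [Function.update_of_ne h]
        refine (hinv i' (Finset.mem_of_mem_insert_of_ne hi' ?_)).2
        rintro rfl
        exact h rfl

open Classical in
/-- The second scan. It starts from the inner box and inserts every other point of the query box
exactly once, because all these points lie in boundary buckets. -/
theorem scan_visit_runs {W d n S b : ℕ} {α : ℝ} {x : ℕ → ℕ → ℝ} {o β : ℕ → ℕ → ℕ}
    {col a : ℕ → ℕ} {v : ℕ → ℝ} {s : State} (hp : Params W d n S b x o β) (hW : 2 * n + 2 < W)
    (hSn : S ≤ n + 1) (hh : Holds d n S b α x o β col s)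
    (ha : ∀ q < 2 * d, s.ivar (20 + q) = a q) (hloc : Located d n S x β v a)
    (hv : ∀ q < 2 * d, s.rvar q = v q)
    (h8 : s.ivar 8 = ∑ q ∈ Finset.range (2 * d), a q * b ^ q)
    (hacc : Acc d α col (boundaryPoints d n β a)
      (bucketBox d b n β (∑ q ∈ Finset.range (2 * d), a q * b ^ q)) s)
    (hmark : ∀ i ∈ boundaryPoints d n β a, s.iarr (2 * d + 6) i = 0) :
    Runs W (scan d (visitBody d)) s ((2 * d + 1) * ((S + 1) * ((visitBody d).flatCost + 30)))
      fun s' => ∀ k < 3, s'.rvar (2 * d + k) =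
        stat α col k ((Finset.range n).filter (InRange d x v)) := by
  have hd := hp.hd
  have hb := hp.hb
  have hdiv := hp.div_lt le_rfl
  have hab : ∀ q < 2 * d, a q < b := fun q hq => by have := hloc.le q hq; omega
  set I := bucketBox d b n β (∑ q ∈ Finset.range (2 * d), a q * b ^ q) with hI
  have hmem : ∀ i, i ∈ I ↔ i < n ∧ ∀ j < d, a (2 * j) < β j i ∧ β j i < a (2 * j + 1) :=
    fun i => mem_bucketBox_digits hab
  -- the points inserted after the points of `D` have been visited
  let V : Finset ℕ → Finset ℕ := fun D => D.filter fun i => InRange d x v i ∧ i ∉ I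
  refine (scan_runs hp hW hSn hh ha hloc.le (fun y h => visitBody_WI.1 h)
    (by simp [visitBody_WR])
    (fun y h => by have := visitBody_WA.1 h; omega) (fun y => visitBody_WB)
    (fun D s' => Acc d α col (boundaryPoints d n β a) (I ∪ V D) s' ∧
      ∀ i ∈ boundaryPoints d n β a, s'.iarr (2 * d + 6) i = if i ∈ V D then 1 else 0)
    ?_ ?_ ?_).mono le_rfl ?_
  · rintro D s₁ s₂ hr hi ⟨h1, h2⟩
    exact ⟨⟨by rw [← hr]; exact h1.stat, by rw [← hi]; exact h1.cnt⟩, by rw [← hi]; exact h2⟩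
  · simpa [V] using ⟨hacc, hmark⟩
  · rintro D i s' hD hi hf hh' h5 ⟨hA, hM⟩
    have hin : i < n := Finset.mem_range.1 (Finset.mem_filter.1 hi).1
    have h8' : s'.ivar 8 = s.ivar 8 := hf.ivar 8 fun h => by
      have := scan_WI h
      simp [visitBody_WI] at this
    have hv' : ∀ q < 2 * d, s'.rvar q = v q := fun q hq => by
      rw [hf.rvar q fun h => ?_, hv q hq]
      have := visitBody_WR.1 (scan_WR h)
      omega
    have hrange : (rangeTest d).Holds W s' ↔ InRange d x v i := by
      rw [rangeTest, allB_holds (by omega)]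
      refine forall₂_congr fun j hj => ?_
      simp only [BExpr.Holds, RExpr.eval, IExpr.eval, h5, hh'.pts j hj, hv' (2 * j) (by omega),
        hv' (2 * j + 1) (by omega), not_lt]
    have hbox := inBoxTest_holds (hp.pow_lt le_rfl) hb hd hh'.b h5 (h8'.trans h8) hin
      fun j hj => congrFun (hh'.bucket j hj) i
    rw [← hI] at hbox
    have htest : (BExpr.and (rangeTest d)
        (.and (.ilt (.read (2 * d + 6) (.var 5)) (.const 1)) (.not (inBoxTest d)))).Holds W s' ↔
        (InRange d x v i ∧ i ∉ I) ∧ i ∉ V D := by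
      have h1 : 1 % W = 1 := Nat.mod_eq_of_lt (by omega)
      simp only [BExpr.Holds, hrange, hbox, IExpr.eval, h5, h1, hM i hi]
      split_ifs with h <;> simp [h]
    have hcost : (visitBody d).flatCost = (BExpr.and (rangeTest d)
        (.and (.ilt (.read (2 * d + 6) (.var 5)) (.const 1)) (.not (inBoxTest d)))).cost + 1 +
        ((insertProg d).flatCost + 3 + 1) := rfl
    rw [hcost]
    refine Runs.cond (fun hb => ?_) fun hb => ?_
    · rw [htest] at hb
      have hVi : V (insert i D) = insert i (V D) := by
        simp only [V, Finset.filter_insert, if_pos hb.1]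
      have hiU : i ∉ I ∪ V D := by
        rw [Finset.mem_union]
        exact fun h => h.elim hb.1.2 hb.2
      have hcard : (I ∪ V D).card ≤ n := by
        have : I ∪ V D ⊆ Finset.range n := Finset.union_subset (Finset.filter_subset _ _)
          ((Finset.filter_subset _ _).trans (hD.trans (Finset.filter_subset _ _)))
        exact (Finset.card_le_card this).trans_eq (Finset.card_range n)
      refine ((insertProg_runs (by omega) hh'.col hh'.α h5 hi hiU hA).seq
        fun s₁ hf₁ hQ₁ => Runs.of_wp ?_).mono (by simp [Stmt.flatCost, IExpr.cost])
        fun _ _ h => h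
      have h51 : s₁.ivar 5 = i := (hf₁.ivar 5 (by simp [insertProg_WI])).trans h5
      have hm1 : s₁.iarr (2 * d + 6) = s'.iarr (2 * d + 6) :=
        hf₁.iarr _ (by simp [insertProg_WA])
      simp only [Stmt.wp, IExpr.eval, h51, Nat.mod_eq_of_lt (show 1 < W by omega), hVi,
        Finset.union_insert]
      refine ⟨⟨hQ₁.stat, ?_⟩, fun i' hi' => ?_⟩
      · simp only [Function.update_of_ne (show 2 * d + 4 ≠ 2 * d + 6 by omega)]
        exact hQ₁.cnt
      · simp only [Function.update_self, hm1]
        by_cases h : i' = i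
        · subst h; simp
        · rw [Function.update_of_ne h, hM i' hi']
          simp [h]
    · rw [htest] at hb
      have hVi : V (insert i D) = V D := by
        simp only [V, Finset.filter_insert]
        split_ifs with h
        · exact Finset.insert_eq_of_mem (not_not.1 fun h' => hb ⟨h, h'⟩)
        · rfl
      refine Runs.mono (Runs.of_wp (p := .skip) (Q := fun s₂ => s₂ = s') rfl)
        (by simp only [Stmt.flatCost]; omega) ?_
      rintro s₂ - rfl
      rw [hVi]
      exact ⟨hA, hM⟩
  · rintro s' - ⟨hA, -⟩ k hk
    rw [hA.stat k hk]
    congr 1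
    ext i
    simp only [V, Finset.mem_union, Finset.mem_filter, Finset.mem_range, boundaryPoints]
    constructor
    · rintro (h | ⟨⟨h1, -⟩, h2, -⟩)
      · have := (hmem i).1 h
        exact ⟨this.1, hloc.inner i this.1 this.2⟩
      · exact ⟨h1, h2⟩
    · rintro ⟨h1, h2⟩
      by_cases h : i ∈ I
      · exact .inl h
      · refine .inr ⟨⟨h1, ?_⟩, h2, h⟩
        -- outside the inner box some coordinate falls into a boundary bucket
        have h3 := hloc.outer i h1 h2
        rw [hmem] at h
        push Not at h
        obtain ⟨j, hj, hj'⟩ := h h1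
        obtain ⟨h4, h5⟩ := h3 j hj
        rcases h4.eq_or_lt with h4 | h4
        · refine ⟨2 * j, by omega, ?_⟩
          rw [h4]; congr 1; omega
        · refine ⟨2 * j + 1, by omega, ?_⟩
          rw [show (2 * j + 1) / 2 = j by omega]
          exact h5.antisymm (hj' h4)

/-- Compute both entropies from the statistics. -/
def output (d : ℕ) : Stmt :=
  .seq (.rset 0 (.sub (.log2 (.var (2 * d))) (.div (.var (2 * d + 1)) (.var (2 * d)))))
    (.rset 1 (.mul
      (.div (.sub (.ofInt (.const 0)) (.ofInt (.const 1)))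
        (.sub (.var (2 * d + 3)) (.ofInt (.const 1))))
      (.log2 (.div (.var (2 * d + 2)) (.mul (.var (2 * d))
        (.exp2 (.mul (.sub (.var (2 * d + 3)) (.ofInt (.const 1))) (.log2 (.var (2 * d))))))))))

theorem ite_logb_of_nonneg {y : ℝ} (hy : 0 ≤ y) :
    (open Classical in if 0 < y then Real.logb 2 y else 0) = Real.logb 2 y := by
  split_ifs with h
  · rfl
  · rw [le_antisymm (not_lt.1 h) hy, Real.logb_zero]

theorem output_runs {W d : ℕ} {α N F G : ℝ} {s : State} (hW : 1 < W) (hd : 1 ≤ d)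
    (hα : s.rvar (2 * d + 3) = α) (hN : s.rvar (2 * d) = N) (hF : s.rvar (2 * d + 1) = F)
    (hG : s.rvar (2 * d + 2) = G) (hN0 : 0 ≤ N) (hG0 : 0 ≤ G) :
    Runs W (output d) s (output d).flatCost fun s' =>
      s'.rvar 0 = Real.logb 2 N - F / N ∧
      s'.rvar 1 = -(1 / (α - 1)) *
        Real.logb 2 (G / (N * 2 ^ ((α - 1) * Real.logb 2 N))) := by
  refine Runs.of_wp ?_
  have e : ∀ k y, Function.update s.rvar 0 y (2 * d + k) = s.rvar (2 * d + k) :=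
    fun k y => Function.update_of_ne (by omega) _ _
  have e0 : ∀ y, Function.update s.rvar 0 y (2 * d) = s.rvar (2 * d) := fun y => e 0 y
  simp only [output, Stmt.wp, RExpr.eval, IExpr.eval, e, e0, hα, hN, hF, hG,
    Nat.mod_eq_of_lt hW, Nat.zero_mod, ite_logb_of_nonneg hN0]
  rw [ite_logb_of_nonneg (by positivity)]
  constructor
  · simp
  · simp [neg_div]

/-- The query program. -/
def queryProg (d : ℕ) : Stmt :=
  .seq (load d) (.seq (seqN (2 * d) locate) (.seq (prepare d)
    (.seq (scan d (resetBody d)) (.seq (scan d (visitBody d)) (output d)))))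

theorem stat_nonneg {α : ℝ} {col : ℕ → ℕ} {Q : Finset ℕ} {k : ℕ} : 0 ≤ stat α col k Q := by
  refine Finset.sum_nonneg fun u _ => ?_
  rcases k with _ | _ | k
  · exact Nat.cast_nonneg _
  · exact mul_nonneg (Nat.cast_nonneg _)
      (div_nonneg (Real.log_natCast_nonneg _) (Real.log_nonneg (by norm_num)))
  · simp only [statFun]; positivity

open Classical in
theorem queryProg_runs (d : ℕ) : ∃ K : ℕ, ∀ {W n S b : ℕ} {α : ℝ} {s : State},
    Params W d n S b s.rarr (fun j => s.iarr (3 + 2 * j)) (fun j => s.iarr (4 + 2 * j)) →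
    2 * n + 2 < W → S ≤ n + 1 → s.iarr 1 0 = n → s.iarr 1 1 = S → s.iarr 1 2 = b →
    s.rarr (d + 3) 0 = α →
    Tables d n S b α (s.iarr 0) (fun j => s.iarr (4 + 2 * j)) (b ^ (2 * d - 1)) s →
    ∀ Q, Q = (Finset.range n).filter (InRange d s.rarr s.rvar) →
    Runs W (queryProg d) s (K * (n.size + 1 + (S + 1))) fun s' =>
      s'.rvar 0 = Real.logb 2 (stat α (s.iarr 0) 0 Q) -
        stat α (s.iarr 0) 1 Q / stat α (s.iarr 0) 0 Q ∧
      s'.rvar 1 = -(1 / (α - 1)) * Real.logb 2 (stat α (s.iarr 0) 2 Q /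
        (stat α (s.iarr 0) 0 Q * 2 ^ ((α - 1) * Real.logb 2 (stat α (s.iarr 0) 0 Q)))) := by
  refine ⟨(load d).flatCost + (2 * d * 50 + 1) + (prepare d).flatCost +
    (2 * d + 1) * ((resetBody d).flatCost + 30) + (2 * d + 1) * ((visitBody d).flatCost + 30) +
    (output d).flatCost, fun {W n S b α s} hp hW hSn hn hS hb hα ht Q hQ => ?_⟩
  have hd := hp.hd
  have hb2 := hp.hb
  have hW3 := hp.lt_W
  set x := s.rarr with hx
  set o := fun j => s.iarr (3 + 2 * j) with ho
  set β := fun j => s.iarr (4 + 2 * j) with hβ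
  set col := s.iarr 0 with hcol
  -- programs that touch only working storage keep the parameters and the tables
  have hblock : ∀ {p : Stmt} {s₁ s₂ : State}, Frame p s₁ s₂ → (∀ y, p.WA y → 2 * d + 4 ≤ y) →
      (∀ y, ¬ p.WB y) → Tables d n S b α col β (b ^ (2 * d - 1)) s₁ →
      Tables d n S b α col β (b ^ (2 * d - 1)) s₂ := by
    intro p s₁ s₂ hf hA hB ht
    have h2 : s₂.iarr 2 = s₁.iarr 2 := hf.iarr 2 fun h => by have := hA _ h; omega
    exact ⟨by rw [h2]; exact ht.count, fun m hm => by rw [hf.rarr _ (hB _)]; exact ht.stat m hm⟩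
  refine Runs.mono (Runs.seq (Q := Holds d n S b α x o β col)
    (c₂ := (2 * d * (50 * (n.size + 1)) + 1) + ((prepare d).flatCost +
      ((2 * d + 1) * ((S + 1) * ((resetBody d).flatCost + 30)) +
      ((2 * d + 1) * ((S + 1) * ((visitBody d).flatCost + 30)) + (output d).flatCost))))
    (Runs.of_wp ?_) fun s₁ hf₁ hh₁ =>
    Runs.seq (Runs.seqN (c := 50 * (n.size + 1)) (fun k s' => ∀ q < k, ∃ L ≤ n,
      s'.ivar (20 + q) = L / S ∧ ∀ p < n, p < L ↔ Below x o s.rvar q p) (by omega) ?_)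
    fun s₂ hf₂ hQ₂ => ?_) ?_ fun _ _ h => h
  · have e1 : 1 % W = 1 := Nat.mod_eq_of_lt (by omega)
    have e2 : 2 % W = 2 := Nat.mod_eq_of_lt (by omega)
    simp only [load, Stmt.wp, IExpr.eval, RExpr.eval, Nat.zero_mod, e1, e2, hn, hS, hb]
    exact ⟨by simp, by simp, by simp, by simpa using hα, rfl, fun _ _ => rfl, fun _ _ => rfl,
      fun _ _ => rfl⟩
  · intro q hq s' hf hi
    have hv : ∀ q < 2 * d, s'.rvar q = s.rvar q := fun q hq =>
      (hf.rvar q (by simp [seqN_WR, locate_WR])).trans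
        (hf₁.rvar q (by simp [load, Stmt.WR]; omega))
    have hh' : Holds d n S b α x o β col s' := by
      apply hh₁.of_frame hf <;> simp [seqN_WI, seqN_WR, seqN_WA, seqN_WB, locate_WI,
        locate_WR, locate_WA, locate_WB]
      omega
    refine (locate_runs hp hW hh' hq).mono le_rfl fun s'' hf'' h q' hq' => ?_
    rcases Nat.lt_succ_iff_lt_or_eq.1 hq' with hq' | rfl
    · rw [hf''.ivar _ (by rw [locate_WI]; omega)]
      exact hi q' hq'
    · simpa only [Below, hv q' hq] using h
  · obtain ⟨a, ha⟩ : ∃ a : ℕ → ℕ, ∀ q, s₂.ivar (20 + q) = a q := ⟨_, fun _ => rfl⟩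
    have hh₂ : Holds d n S b α x o β col s₂ := by
      apply hh₁.of_frame hf₂ <;> simp [seqN_WI, seqN_WR, seqN_WA, seqN_WB, locate_WI,
        locate_WR, locate_WA, locate_WB]
      omega
    have hv₂ : ∀ q < 2 * d, s₂.rvar q = s.rvar q := fun q hq =>
      (hf₂.rvar q (by simp [seqN_WR, locate_WR])).trans
        (hf₁.rvar q (by simp [load, Stmt.WR]; omega))
    have ht₂ : Tables d n S b α col β (b ^ (2 * d - 1)) s₂ :=
      hblock hf₂ (by simp [seqN_WA, locate_WA]) (by simp [seqN_WB, locate_WB])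
        (hblock hf₁ (by simp [load, Stmt.WA]) (by simp [load, Stmt.WB]) ht)
    have hloc : Located d n S x β s.rvar a := located_of_below hp fun q hq => by
      rw [← ha]; exact hQ₂ q hq
    refine Runs.seq (prepare_runs hp hh₂ ht₂ (fun q _ => ha q) hloc.le) fun s₃ hf₃ hQ₃ => ?_
    obtain ⟨h8, h13, h14, hst⟩ := hQ₃
    have hh₃ : Holds d n S b α x o β col s₃ := by
      apply hh₂.of_frame hf₃ <;> simp [prepare, seqN, Stmt.WI, Stmt.WR, Stmt.WA, Stmt.WB]
      omega
    have ht₃ : Tables d n S b α col β (b ^ (2 * d - 1)) s₃ :=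
      hblock hf₃ (by simp [prepare, seqN, Stmt.WA]) (by simp [prepare, seqN, Stmt.WB]) ht₂
    have ha₃ : ∀ q < 2 * d, s₃.ivar (20 + q) = a q := fun q _ =>
      (hf₃.ivar _ (by simp [prepare, seqN, Stmt.WI]; omega)).trans (ha q)
    have hv₃ : ∀ q < 2 * d, s₃.rvar q = s.rvar q := fun q hq =>
      (hf₃.rvar q (by simp [prepare, seqN, Stmt.WR]; omega)).trans (hv₂ q hq)
    refine Runs.seq (scan_reset_runs hp hW hSn hh₃ ht₃ ha₃ hloc.le h13 h14)
      fun s₄ hf₄ hQ₄ => ?_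
    have hI₄ : ∀ y, y ≠ 4 → y ≠ 5 → y ≠ 7 → s₄.ivar y = s₃.ivar y := fun y h4 h5 h7 =>
      hf₄.ivar y fun h => by
        have := scan_WI h
        simp [resetBody, Stmt.WI] at this
        omega
    have hR₄ : s₄.rvar = s₃.rvar := by
      funext y
      exact hf₄.rvar y fun h => by simpa [resetBody, Stmt.WR] using scan_WR h
    have hA₄ : ∀ y < 2 * d + 4, s₄.iarr y = s₃.iarr y := fun y hy =>
      hf₄.iarr y fun h => by
        have := scan_WA h
        simp [resetBody, Stmt.WA] at this
        omega
    have hB₄ : s₄.rarr = s₃.rarr := by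
      funext y
      exact hf₄.rarr y fun h => by simpa [resetBody, Stmt.WB] using scan_WB h
    have hh₄ : Holds d n S b α x o β col s₄ :=
      ⟨by rw [hI₄ 0 (by omega) (by omega) (by omega)]; exact hh₃.n,
        by rw [hI₄ 1 (by omega) (by omega) (by omega)]; exact hh₃.S,
        by rw [hI₄ 2 (by omega) (by omega) (by omega)]; exact hh₃.b,
        by rw [hR₄]; exact hh₃.α, by rw [hA₄ 0 (by omega)]; exact hh₃.col,
        by rw [hB₄]; exact hh₃.pts,
        fun j hj => by rw [hA₄ _ (by omega)]; exact hh₃.ord j hj,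
        fun j hj => by rw [hA₄ _ (by omega)]; exact hh₃.bucket j hj⟩
    refine Runs.seq (scan_visit_runs hp hW hSn hh₄ (a := a) (v := s.rvar)
      (fun q hq => by rw [hI₄ _ (by omega) (by omega) (by omega)]; exact ha₃ q hq) hloc
      (by rw [hR₄]; exact hv₃)
      (by rw [hI₄ _ (by omega) (by omega) (by omega)]; exact h8)
      ⟨by rw [hR₄]; exact hst, fun i hi => (hQ₄ i hi).2⟩ fun i hi => (hQ₄ i hi).1)
      fun s₅ hf₅ hQ₅ => ?_
    rw [← hQ] at hQ₅
    refine output_runs (by omega) hd ?_ (hQ₅ 0 (by omega)) (hQ₅ 1 (by omega)) (hQ₅ 2 (by omega))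
      stat_nonneg stat_nonneg
    rw [hf₅.rvar _ fun h => ?_, hh₄.α]
    have := visitBody_WR.1 (scan_WR h)
    omega
  · have key : ∀ l p r v o' m : ℕ, ∀ e z : ℕ, 1 ≤ e → 1 ≤ z →
        l + (2 * d * (50 * e) + 1 + (p + (m * (z * r) + (m * (z * v) + o')))) ≤
        (l + (2 * d * 50 + 1) + p + m * r + m * v + o') * (e + z) := by
      intro l p r v o' m e z he hz
      have h1 : l ≤ l * (e + z) := Nat.le_mul_of_pos_right _ (by omega)
      have h2 : p ≤ p * (e + z) := Nat.le_mul_of_pos_right _ (by omega)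
      have h3 : o' ≤ o' * (e + z) := Nat.le_mul_of_pos_right _ (by omega)
      have h4 : 2 * d * (50 * e) ≤ (2 * d * 50) * (e + z) := by
        rw [← mul_assoc]; exact Nat.mul_le_mul_left _ (by omega)
      have h5 : m * (z * r) ≤ m * r * (e + z) := by
        rw [mul_comm z, ← mul_assoc]; exact Nat.mul_le_mul_left _ (by omega)
      have h6 : m * (z * v) ≤ m * v * (e + z) := by
        rw [mul_comm z, ← mul_assoc]; exact Nat.mul_le_mul_left _ (by omega)
      simp only [add_mul] at *
      omega
    exact key _ _ _ _ _ _ _ _ (by omega) (by omega)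

theorem queryProg_WA {d y : ℕ} (h : (queryProg d).WA y) : 2 * d + 4 ≤ y := by
  simp only [queryProg, Stmt.WA, seqN_WA, locate_WA] at h
  rcases h with h | h | h | h | h | h
  · simp [load, Stmt.WA] at h
  · simp at h
  · simp [prepare, seqN, Stmt.WA] at h
  · have := scan_WA h
    simp [resetBody, Stmt.WA] at this
    omega
  · have := visitBody_WA.1 (scan_WA h)
    omega
  · simp [output, Stmt.WA] at h

theorem queryProg_WB {d y : ℕ} : ¬ (queryProg d).WB y := by
  intro h
  simp only [queryProg, Stmt.WB, seqN_WB, locate_WB] at h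
  rcases h with h | h | h | h | h | h
  · simp [load, Stmt.WB] at h
  · simp at h
  · simp [prepare, seqN, Stmt.WB] at h
  · simpa [resetBody, Stmt.WB] using scan_WB h
  · exact visitBody_WB (scan_WB h)
  · simp [output, Stmt.WB] at h

end RealRAM

/-! ### The entropies in terms of the statistics -/

section Entropy

variable {n : ℕ} {c : Fin n → ℕ} {col : ℕ → ℕ} {Q : Finset (Fin n)}

theorem mult_map (hcol : ∀ i : Fin n, col i = c i) (u : ℕ) :
    mult col (Q.map Fin.valEmbedding) u = (Q.filter fun i => c i = u).card := by
  rw [mult, Finset.filter_map, Finset.card_map]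
  congr 1
  exact Finset.filter_congr fun i _ => by simp [hcol]

theorem stat_map (hcol : ∀ i : Fin n, col i = c i) (α : ℝ) (k : ℕ) :
    stat α col k (Q.map Fin.valEmbedding) =
      ∑ u ∈ Q.image c, statFun α k (Q.filter fun i => c i = u).card := by
  have h : (Q.map Fin.valEmbedding).image col = Q.image c := by
    ext u; simp [hcol]
  rw [stat, colorSum, h]
  exact Finset.sum_congr rfl fun u _ => by rw [mult_map hcol]

theorem stat_zero_map (hcol : ∀ i : Fin n, col i = c i) (α : ℝ) :
    stat α col 0 (Q.map Fin.valEmbedding) = Q.card := by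
  rw [stat_map hcol, Finset.card_eq_sum_card_image c Q]
  simp [statFun]

theorem card_color_pos {u : ℕ} (hu : u ∈ Q.image c) :
    (0 : ℝ) < (Q.filter fun i => c i = u).card := by
  obtain ⟨i, hi, rfl⟩ := Finset.mem_image.1 hu
  exact_mod_cast Finset.card_pos.2 ⟨i, by simp [hi]⟩

theorem card_pos_of_color {u : ℕ} (hu : u ∈ Q.image c) : (0 : ℝ) < Q.card := by
  obtain ⟨i, hi, rfl⟩ := Finset.mem_image.1 hu
  exact_mod_cast Finset.card_pos.2 ⟨i, hi⟩

theorem shannonEntropy_eq (hcol : ∀ i : Fin n, col i = c i) (α : ℝ) :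
    shannonEntropy c Q = Real.logb 2 (stat α col 0 (Q.map Fin.valEmbedding)) -
      stat α col 1 (Q.map Fin.valEmbedding) / stat α col 0 (Q.map Fin.valEmbedding) := by
  rw [stat_zero_map hcol]
  rcases Q.eq_empty_or_nonempty with rfl | hQ
  · simp [shannonEntropy]
  have hN : (0 : ℝ) < Q.card := by exact_mod_cast hQ.card_pos
  have h0 := stat_zero_map (Q := Q) hcol α
  rw [stat_map hcol] at h0
  simp only [statFun] at h0
  rw [stat_map hcol, shannonEntropy, Finset.sum_div]
  have h1 : ∀ u ∈ Q.image c, colorFreq c Q u * Real.logb 2 (colorFreq c Q u) =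
      statFun α 1 (Q.filter fun i => c i = u).card / Q.card -
        ((Q.filter fun i => c i = u).card : ℝ) * (Real.logb 2 Q.card / Q.card) := by
    intro u hu
    rw [colorFreq, Real.logb_div (card_color_pos hu).ne' hN.ne', statFun]
    ring
  rw [Finset.sum_congr rfl h1, Finset.sum_sub_distrib, ← Finset.sum_mul, h0]
  field_simp
  ring

theorem renyiEntropy_eq (hcol : ∀ i : Fin n, col i = c i) (α : ℝ) :
    renyiEntropy α c Q = -(1 / (α - 1)) * Real.logb 2 (stat α col 2 (Q.map Fin.valEmbedding) /
      (stat α col 0 (Q.map Fin.valEmbedding) *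
        2 ^ ((α - 1) * Real.logb 2 (stat α col 0 (Q.map Fin.valEmbedding))))) := by
  -- `m ^ α` for `m > 0` in the form that the program evaluates
  have hpow : ∀ y : ℝ, 0 < y → y ^ α = y * 2 ^ ((α - 1) * Real.logb 2 y) := by
    intro y hy
    rw [mul_comm (α - 1), Real.rpow_mul (by norm_num),
      Real.rpow_logb (by norm_num) (by norm_num) hy,
      Real.rpow_sub_one hy.ne', mul_div_cancel₀ _ hy.ne']
  rw [stat_zero_map hcol, stat_map hcol, renyiEntropy, Finset.sum_div]
  congr 2
  refine Finset.sum_congr rfl fun u hu => ?_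
  have hN := card_pos_of_color hu
  rw [colorFreq, Real.div_rpow (card_color_pos hu).le hN.le, hpow _ (card_color_pos hu), hpow _ hN]
  rfl

end Entropy

namespace RealRAM

/-! ### The block of the data structure -/

theorem Buckets.congr {n S : ℕ} {x x' : ℕ → ℝ} {o o' β β' : ℕ → ℕ} (h : Buckets n S x o β)
    (hx : ∀ i < n, x' i = x i) (ho : ∀ p < n, o' p = o p) (hβ : ∀ i < n, β' i = β i) :
    Buckets n S x' o' β' where
  lt p hp := by rw [ho p hp]; exact h.lt p hp
  inj p hp p' hp' := by rw [ho p hp, ho p' hp']; exact h.inj p hp p' hp'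
  mono p p' hp hp' := by
    rw [ho p (by omega), ho p' hp', hx _ (h.lt p (by omega)), hx _ (h.lt p' hp')]
    exact h.mono p p' hp hp'
  bucket p hp := by rw [ho p hp, hβ _ (h.lt p hp)]; exact h.bucket p hp

theorem openBox_congr {d b n key : ℕ} {β β' : ℕ → ℕ → ℕ} (h : ∀ j < d, ∀ i < n, β' j i = β j i) :
    openBox d b n β' key = openBox d b n β key := by
  refine Finset.filter_congr fun i hi => forall₂_congr fun j hj => ?_
  rw [h j hj i (Finset.mem_range.1 hi)]

/-- The number of cells of each array in the block. -/
def blockSize (d n b : ℕ) : ℕ := (n + 3) * b ^ (2 * d - 1)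

/-- The data structure survives arbitrary changes outside its block. -/
theorem Stored.of_sameBlock {W d n S b : ℕ} {α : ℝ} {x : ℕ → ℕ → ℝ} {o β : ℕ → ℕ → ℕ}
    {col : ℕ → ℕ} {s q : State} (hp : Params W d n S b x o β)
    (h : Stored d n S b α x o β col s) (hq : SameBlock (2 * d + 4) (blockSize d n b) s q) :
    Stored d n S b α x o β col q := by
  have hd := hp.hd
  have hb := hp.hb
  have hdiv := hp.div_lt le_rfl
  have hP : 1 ≤ b ^ (2 * d - 1) := Nat.one_le_pow _ _ (by omega)
  have h3 : n + 3 ≤ blockSize d n b := Nat.le_mul_of_pos_right _ hP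
  refine ⟨⟨fun key hk i hi => ?_, fun m hm key hk r hr => ?_⟩, fun i hi => ?_, fun j hj i hi => ?_,
    fun j hj i hi => ?_, fun j hj i hi => ?_, ?_, ?_, ?_, ?_⟩
  · have : (key + 1) * n ≤ b ^ (2 * d - 1) * n := Nat.mul_le_mul_right _ hk
    rw [← (hq 2 (by omega) (key * n + i) (by unfold blockSize; nlinarith)).1]
    exact h.count key hk i hi
  · have h1 := hp.key_lt hk (show r < n + 3 ∧ r < b by
      have := Nat.div_le_self n S; constructor <;> omega).2
    have h2 : b ^ (2 * d - 1) * (r + 1) ≤ b ^ (2 * d - 1) * (n + 3) :=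
      Nat.mul_le_mul_left _ (by have := Nat.div_le_self n S; omega)
    rw [← (hq (d + m) (by omega) _ (by unfold blockSize; nlinarith)).2]
    exact h.stat m hm key hk r hr
  · rw [← (hq 0 (by omega) i (by omega)).1]; exact h.col i hi
  · rw [← (hq j (by omega) i (by omega)).2]; exact h.pts j hj i hi
  · rw [← (hq (3 + 2 * j) (by omega) i (by omega)).1]; exact h.ord j hj i hi
  · rw [← (hq (4 + 2 * j) (by omega) i (by omega)).1]; exact h.bucket j hj i hi
  · rw [← (hq 1 (by omega) 0 (by omega)).1]; exact h.n
  · rw [← (hq 1 (by omega) 1 (by omega)).1]; exact h.S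
  · rw [← (hq 1 (by omega) 2 (by omega)).1]; exact h.b
  · rw [← (hq (d + 3) (by omega) 0 (by omega)).2]; exact h.α

/-- A state that holds the data structure holds it with respect to its own arrays. -/
theorem Stored.self {W d n S b : ℕ} {α : ℝ} {x : ℕ → ℕ → ℝ} {o β : ℕ → ℕ → ℕ} {col : ℕ → ℕ}
    {q : State} (hp : Params W d n S b x o β) (h : Stored d n S b α x o β col q) :
    Params W d n S b q.rarr (fun j => q.iarr (3 + 2 * j)) (fun j => q.iarr (4 + 2 * j)) ∧
    Tables d n S b α (q.iarr 0) (fun j => q.iarr (4 + 2 * j)) (b ^ (2 * d - 1)) q := by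
  refine ⟨⟨hp.hd, hp.hb, hp.hS, hp.hW, fun j hj =>
    (hp.buckets j hj).congr (h.pts j hj) (h.ord j hj) (h.bucket j hj)⟩, ⟨?_, ?_⟩⟩
  · intro key hk i hi
    rw [h.count key hk i hi, openBox_congr h.bucket, h.col i hi]
    exact mult_congr (fun i hi => (h.col i (Finset.mem_range.1 (openBox_subset hi))).symm) _
  · intro m hm key hk r hr
    rw [h.stat m hm key hk r hr, openBox_congr h.bucket]
    have hd := hp.hd
    have e : (openBox d b n β key).filter (fun i => q.iarr (4 + 2 * (d - 1)) i < r) =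
        (openBox d b n β key).filter (fun i => β (d - 1) i < r) :=
      Finset.filter_congr fun i hi => by
        rw [h.bucket (d - 1) (by omega) i (Finset.mem_range.1 (openBox_subset hi))]
    rw [e]
    exact colorSum_congr fun i hi => (h.col i (Finset.mem_range.1
      (openBox_subset (Finset.mem_filter.1 hi).1))).symm

/-! ### The bounds -/

section Bounds

variable {n : ℕ} {t : ℝ}

theorem one_le_logb (hn : 2 ≤ n) : 1 ≤ Real.logb 2 n := by
  have h2 : (2 : ℝ) ≤ n := by exact_mod_cast hn
  rw [Real.le_logb_iff_rpow_le (by norm_num) (by linarith), Real.rpow_one]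
  exact h2

theorem size_le_logb (hn : 2 ≤ n) : (n.size : ℝ) ≤ Real.logb 2 n + 1 := by
  obtain ⟨m, hm⟩ : ∃ m, n.size = m + 1 :=
    ⟨n.size - 1, by have := Nat.size_pos.2 (show 0 < n by omega); omega⟩
  have h1 : 2 ^ m ≤ n := Nat.lt_size.1 (by omega)
  have h2 : (m : ℝ) ≤ Real.logb 2 n := by
    rw [Real.le_logb_iff_rpow_le (by norm_num) (by exact_mod_cast (by omega : 0 < n)),
      Real.rpow_natCast]
    exact_mod_cast h1
  rw [hm]
  push_cast
  linarith

theorem one_le_natCast_rpow (hn : 2 ≤ n) {y : ℝ} (hy : 0 ≤ y) : 1 ≤ (n : ℝ) ^ y :=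
  Real.one_le_rpow (by exact_mod_cast (by omega : 1 ≤ n)) hy

theorem keyBase_le_rpow (hn : 2 ≤ n) (ht : 0 ≤ t) : (keyBase n t : ℝ) ≤ 3 * (n : ℝ) ^ t := by
  have h1 := one_le_natCast_rpow hn ht
  have h2 := Nat.ceil_lt_add_one (show 0 ≤ (n : ℝ) ^ t by linarith)
  unfold keyBase
  rw [two_rpow_mul_logb (by omega)]
  push_cast
  exact max_le (by linarith) (by linarith)

theorem rpow_le_keyBase (hn : 2 ≤ n) : (n : ℝ) ^ t ≤ (keyBase n t - 1 : ℕ) := by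
  refine (Nat.le_ceil _).trans ?_
  unfold keyBase
  rw [two_rpow_mul_logb (by omega)]
  exact_mod_cast (by omega)

theorem bucketSize_le_rpow (hn : 2 ≤ n) (ht : t ≤ 1) :
    (bucketSize n t : ℝ) ≤ 2 * (n : ℝ) ^ (1 - t) := by
  have hn0 : (0 : ℝ) < n := by exact_mod_cast (by omega : 0 < n)
  have h1 := one_le_natCast_rpow hn (show 0 ≤ 1 - t by linarith)
  have h2 : ((n / (keyBase n t - 1) : ℕ) : ℝ) ≤ (n : ℝ) ^ (1 - t) := by
    refine Nat.cast_div_le.trans ?_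
    rw [Real.rpow_sub hn0, Real.rpow_one]
    exact div_le_div_of_nonneg_left hn0.le (by positivity) (rpow_le_keyBase hn)
  unfold bucketSize
  push_cast
  linarith

/-- The count table, with one cell per key and point, dominates the space and, apart from sorting,
the construction time. -/
theorem mul_keyBase_pow_le {d : ℕ} (hd : 1 ≤ d) (hn : 2 ≤ n) (ht : 0 ≤ t) :
    ((n : ℝ) + 3) * (keyBase n t : ℝ) ^ (2 * d - 1) ≤
      3 ^ (2 * d) * (n : ℝ) ^ ((2 * d - 1 : ℝ) * t + 1) := by
  have hn0 : (0 : ℝ) < n := by exact_mod_cast (by omega : 0 < n)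
  have h2 : (2 : ℝ) ≤ n := by exact_mod_cast hn
  have h1 : (keyBase n t : ℝ) ^ (2 * d - 1) ≤
      3 ^ (2 * d - 1) * (n : ℝ) ^ ((2 * d - 1 : ℝ) * t) := by
    refine (pow_le_pow_left₀ (Nat.cast_nonneg _) (keyBase_le_rpow hn ht) _).trans_eq ?_
    rw [mul_pow, ← Real.rpow_natCast ((n : ℝ) ^ t), ← Real.rpow_mul hn0.le]
    congr 2
    rw [Nat.cast_sub (by omega)]
    push_cast
    ring
  calc ((n : ℝ) + 3) * (keyBase n t : ℝ) ^ (2 * d - 1)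
      ≤ (3 * n) * (3 ^ (2 * d - 1) * (n : ℝ) ^ ((2 * d - 1 : ℝ) * t)) :=
        mul_le_mul (by linarith) h1 (by positivity) (by positivity)
    _ = 3 ^ (2 * d) * (n : ℝ) ^ ((2 * d - 1 : ℝ) * t + 1) := by
        rw [Real.rpow_add hn0, Real.rpow_one, show 2 * d = 2 * d - 1 + 1 by omega, pow_succ]
        simp only [Nat.add_sub_cancel]
        ring

end Bounds

theorem pointsInBox_map {d n : ℕ} {p : Fin n → Fin d → ℝ} {lo hi : Fin d → ℝ} {x : ℕ → ℕ → ℝ}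
    {v : ℕ → ℝ} (hx : ∀ (i : Fin n) (j : Fin d), x j i = p i j)
    (hv : ∀ j : Fin d, v (2 * j) = lo j ∧ v (2 * j + 1) = hi j) :
    (pointsInBox p lo hi).map Fin.valEmbedding =
      open Classical in (Finset.range n).filter (InRange d x v) := by
  classical
  ext i
  simp only [pointsInBox, Finset.mem_map, Finset.mem_filter, Finset.mem_univ, true_and,
    Fin.valEmbedding_apply, Finset.mem_range]
  constructor
  · rintro ⟨i, h, rfl⟩
    refine ⟨i.2, fun j hj => ?_⟩
    have := h ⟨j, hj⟩
    rwa [← hx, ← (hv ⟨j, hj⟩).1, ← (hv ⟨j, hj⟩).2] at this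
  · rintro ⟨hi, h⟩
    refine ⟨⟨i, hi⟩, fun j => ?_, rfl⟩
    rw [← hx, ← (hv j).1, ← (hv j).2]
    exact h j j.2

end RealRAM

open RealRAM in
/-- Exact range entropy queries in dimension `d`, with size, construction time and query time. -/
theorem mainTheorem6 (d : ℕ) (hd : 1 ≤ d) :
    ∃ (build query : RealRAM.Stmt) (C : ℝ) (k : ℕ),
      ∀ (α t : ℝ), 1 < α → 0 ≤ t → t ≤ 1 →
      ∀ (n W : ℕ), (n + 2) ^ k ≤ W →
      ∀ (p : Fin n → Fin d → ℝ) (c : Fin n → ℕ), (∀ i, c i < W) →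
      ∀ s : RealRAM.State, RealRAM.BuildInput α t p c s →
      ∃ (D : RealRAM.State) (T A S : ℕ),
        RealRAM.Exec W build s D T ∧
        (2 ≤ n →
          (2 * A * S : ℝ) ≤
            C * (n * Real.logb 2 n ^ (2 * d - 1) + (n : ℝ) ^ ((2 * d - 1 : ℝ) * t + 1)) ∧
          (T : ℝ) ≤
            C * (n * Real.logb 2 n ^ (2 * d) +
              (n : ℝ) ^ ((2 * d - 1 : ℝ) * t + 1) * Real.logb 2 n ^ (d + 1))) ∧
        ∀ (lo hi : Fin d → ℝ) (q : RealRAM.State),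
          RealRAM.SameBlock A S D q → RealRAM.QueryInput lo hi q →
          ∃ (q' : RealRAM.State) (T' : ℕ),
            RealRAM.Exec W query q q' T' ∧
            RealRAM.SameBlock A S D q' ∧
            q'.rvar 0 = shannonEntropy c (pointsInBox p lo hi) ∧
            q'.rvar 1 = renyiEntropy α c (pointsInBox p lo hi) ∧
            (2 ≤ n → (T' : ℝ) ≤ C * ((n : ℝ) ^ (1 - t) * Real.logb 2 n ^ (2 * d))) := by
  classical
  obtain ⟨K₁, hK₁⟩ := buildProg_runs hd
  obtain ⟨K₂, hK₂⟩ := queryProg_runs d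
  refine ⟨buildProg d, queryProg d,
    2 * (2 * d + 4) * 3 ^ (2 * d) + K₁ * (6 + 3 ^ (2 * d)) + K₂ * 6, 2 * d + 3,
    fun α t _ ht0 ht1 n W hW p c _ s ⟨hn, hα, ht, hpts, hcol⟩ => ?_⟩
  have hW1 : (n + 3) * (n + 2) ^ (2 * d) < W := by
    refine lt_of_lt_of_le ?_ hW
    rw [pow_add, mul_comm]
    have h4 : 4 ≤ (n + 2) ^ 2 := Nat.pow_le_pow_left (show 2 ≤ n + 2 by omega) 2
    have h3 : n + 3 < (n + 2) ^ 3 := by rw [pow_succ]; nlinarith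
    exact Nat.mul_lt_mul_of_pos_left h3 (by positivity)
  have hW2 : 2 * n + 2 < W := by
    have : (n + 2) ^ 1 ≤ (n + 2) ^ (2 * d) := Nat.pow_le_pow_right (by omega) (by omega)
    nlinarith
  obtain ⟨D, T, hT, hTc, o, β, hp, hst⟩ := hK₁ hW1 ht1 hn hα ht
  refine ⟨D, T, 2 * d + 4, blockSize d n (keyBase n t), hT, fun hn2 => ?_,
    fun lo hi q hq hqi => ?_⟩
  · have hn0 : (0 : ℝ) < n := by exact_mod_cast (by omega : 0 < n)
    have hL := one_le_logb hn2
    have hsz := size_le_logb hn2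
    have hY := mul_keyBase_pow_le hd hn2 ht0
    set L := Real.logb 2 n with hLdef
    set Y := (n : ℝ) ^ ((2 * d - 1 : ℝ) * t + 1) with hYdef
    have hY0 : 0 ≤ Y := by positivity
    have hLd : L ≤ L ^ (2 * d) := le_self_pow₀ hL (by omega)
    have hL1 : 1 ≤ L ^ (d + 1) := one_le_pow₀ hL
    constructor
    · have h1 : (blockSize d n (keyBase n t) : ℝ) ≤ 3 ^ (2 * d) * Y := by
        unfold blockSize; push_cast; exact hY
      have h2 : 0 ≤ n * L ^ (2 * d - 1) := by positivity
      calc (2 * ((2 * d + 4 : ℕ) : ℝ) * blockSize d n (keyBase n t) : ℝ)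
          ≤ 2 * (2 * d + 4) * (3 ^ (2 * d) * Y) := by
            push_cast; exact mul_le_mul_of_nonneg_left h1 (by positivity)
        _ = 2 * (2 * d + 4) * 3 ^ (2 * d) * Y := by ring
        _ ≤ _ := mul_le_mul (by
            have : (0 : ℝ) ≤ K₁ * (6 + 3 ^ (2 * d)) := by positivity
            have : (0 : ℝ) ≤ K₂ * 6 := by positivity
            linarith) (by linarith) hY0 (by positivity)
    · have h1 : ((n : ℝ) + 1) * (n.size + 1) ≤ 6 * (n * L ^ (2 * d)) := by
        have h2 : (2 : ℝ) ≤ n := by exact_mod_cast hn2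
        calc ((n : ℝ) + 1) * (n.size + 1) ≤ (2 * n) * (3 * L ^ (2 * d)) :=
              mul_le_mul (by linarith) (by linarith) (by positivity) (by positivity)
          _ = _ := by ring
      have h2 : (keyBase n t : ℝ) ^ (2 * d - 1) * (n + 1) ≤ 3 ^ (2 * d) * (Y * L ^ (d + 1)) := by
        have h3 : (keyBase n t : ℝ) ^ (2 * d - 1) * (n + 1) ≤ 3 ^ (2 * d) * Y := by
          refine le_trans ?_ hY
          rw [mul_comm]
          exact mul_le_mul_of_nonneg_right (by linarith) (by positivity)
        refine h3.trans (mul_le_mul_of_nonneg_left ?_ (by positivity))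
        exact le_mul_of_one_le_right hY0 hL1
      have hX0 : 0 ≤ n * L ^ (2 * d) := by positivity
      have hZ0 : 0 ≤ Y * L ^ (d + 1) := by positivity
      calc (T : ℝ) ≤ K₁ * (((n : ℝ) + 1) * (n.size + 1) +
            (keyBase n t : ℝ) ^ (2 * d - 1) * (n + 1)) := by exact_mod_cast hTc
        _ ≤ K₁ * ((6 + 3 ^ (2 * d)) * (n * L ^ (2 * d) + Y * L ^ (d + 1))) := by
            refine mul_le_mul_of_nonneg_left ?_ (by positivity)
            have h3 : (0 : ℝ) ≤ 3 ^ (2 * d) * (n * L ^ (2 * d)) := by positivity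
            nlinarith
        _ = K₁ * (6 + 3 ^ (2 * d)) * (n * L ^ (2 * d) + Y * L ^ (d + 1)) := by ring
        _ ≤ _ := mul_le_mul_of_nonneg_right (by
            have : (0 : ℝ) ≤ 2 * (2 * d + 4) * 3 ^ (2 * d) := by positivity
            have : (0 : ℝ) ≤ K₂ * 6 := by positivity
            linarith) (by positivity)
  · have hstq := hst.of_sameBlock hp hq
    obtain ⟨hpq, htq⟩ := hstq.self hp
    have hSn : bucketSize n t ≤ n + 1 := Nat.succ_le_succ (Nat.div_le_self _ _)
    have hcolq : ∀ i : Fin n, q.iarr 0 i = c i := fun i => (hstq.col i i.2).trans (hcol i)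
    have hQ := pointsInBox_map (x := q.rarr) (v := q.rvar) (p := p) (lo := lo) (hi := hi)
      (fun i j => (hstq.pts j j.2 i i.2).trans (hpts i j)) hqi
    obtain ⟨q', T', hT', hTc', h0, h1⟩ := hK₂ hpq hW2 hSn hstq.n hstq.S hstq.b hstq.α htq _ hQ
    refine ⟨q', T', hT', fun a ha i hi => ?_, ?_, ?_, fun hn2 => ?_⟩
    · have h1 : q'.iarr a = q.iarr a := hT'.frame.iarr a fun h => by
        have := queryProg_WA h; omega
      rw [h1, hT'.frame.rarr a queryProg_WB]
      exact hq a ha i hi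
    · rw [h0, shannonEntropy_eq hcolq α]
    · rw [h1, renyiEntropy_eq hcolq α]
    · have hL := one_le_logb hn2
      have hsz := size_le_logb hn2
      have hbs := bucketSize_le_rpow hn2 ht1
      have hZ := one_le_natCast_rpow hn2 (show 0 ≤ 1 - t by linarith)
      set L := Real.logb 2 n with hLdef
      set Z := (n : ℝ) ^ (1 - t) with hZdef
      have hLd : L ≤ L ^ (2 * d) := le_self_pow₀ hL (by omega)
      have h1 : (n.size : ℝ) + 1 + (bucketSize n t + 1) ≤ 6 * (Z * L ^ (2 * d)) := by
        nlinarith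
      calc (T' : ℝ) ≤ K₂ * ((n.size : ℝ) + 1 + (bucketSize n t + 1)) := by exact_mod_cast hTc'
        _ ≤ K₂ * (6 * (Z * L ^ (2 * d))) := mul_le_mul_of_nonneg_left h1 (by positivity)
        _ = K₂ * 6 * (Z * L ^ (2 * d)) := by ring
        _ ≤ _ := mul_le_mul_of_nonneg_right (by
            have : (0 : ℝ) ≤ 2 * (2 * d + 4) * 3 ^ (2 * d) := by positivity
            have : (0 : ℝ) ≤ K₁ * (6 + 3 ^ (2 * d)) := by positivity
            linarith) (by positivity)
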